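/- **Setting.** A computational problem consists of a set $\Omega$, a metric space $\mathcal M$, a problem function $\Xi:\Omega\to\mathcal M$ and a set $\Lambda$ of functions $\Omega\to\mathbb C$ (the evaluations). A *general algorithm* is a map $\Gamma:\Omega\to\mathcal M$ such that for each $A\in\Omega$ there is a finite set $\Lambda_\Gamma(A)\subset\Lambda$ with the property: if $B\in\Omega$ and $\varphi(B)=\varphi(A)$ for all $\varphi\in\Lambda_\Gamma(A)$, then $\Gamma(B)=\Gamma(A)$ and $\Lambda_\Gamma(B)=\Lambda_\Gamma(A)$. When $\mathcal M$ is the set of compact subsets of $\mathbb C$, an *arithmetic algorithm* is a general algorithm which for each $A$ returns a finite set of numbers obtained from Gaussian rational constants and the values $\varphi(A)$, $\varphi\in\Lambda_\Gamma(A)$, by finitely many operations $+,-,\cdot,/$, real and imaginary parts, and comparisons of real numbers, and for which the set of constant functions in $\Lambda_\Gamma(A)$ is the same for all $A\in\Omega$. A *general* (*arithmetic*) *tower of height $k\ge1$* for $\Xi$ is a family of maps $\Gamma_{n_k},\ \Gamma_{n_k,n_{k-1}},\ \dots,\ \Gamma_{n_k,\dots,n_1}:\Omega\to\mathcal M$,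 indexed by natural numbers, such that all $\Gamma_{n_k,\dots,n_1}$ are general (arithmetic) algorithms and, for every $A\in\Omega$, $\Xi(A)=\lim_{n_k\to\infty}\Gamma_{n_k}(A)$ and $\Gamma_{n_k,\dots,n_j}(A)=\lim_{n_{j-1}\to\infty}\Gamma_{n_k,\dots,n_{j-1}}(A)$ for $2\le j\le k$. The index $\mathrm{SCI}(\Xi,\Omega,\Lambda)_{\mathrm G}$ (respectively $\mathrm{SCI}(\Xi,\Omega,\Lambda)_{\mathrm A}$) is the least height of a general (respectively arithmetic) tower for $\Xi$; it is $0$ if $\Xi$ itself is such an algorithm, and $\infty$ if there is no tower. Let $\mathcal M$ be the set of compact subsets of $\mathbb C$ with the Hausdorff metric (the empty set being at distance $\infty$ from all others). For $A\in\mathcal B(l^2(\mathbb N))$ let $\Xi_1(A)=\mathrm{sp}(A)$ be the spectrum and let $\Xi_2(A)=\mathrm{sp}_{\mathrm{ess}}(A)=\{z\in\mathbb C: A-zI \text{ is not Fredholm}\}$ be the essential spectrum. Let $P_n$ be the orthogonal projection onto the span of the first $n$ canonical basis vectors $e_i$. Let $f:\mathbb N\to\mathbb N$ with $f(n)\to\infty$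 as $n\to\infty$. The dispersion of $A$ is *bounded by $f$* if $\max\{\|(I-P_{f(m)})AP_m\|,\|P_mA(I-P_{f(m)})\|\}\to0$ as $m\to\infty$. Let $g:[0,\infty)\to[0,\infty)$ be continuous, vanishing only at $0$, with $g(x)\to\infty$ as $x\to\infty$ and $g(x)\le x$ for all $x$. Consider the condition $$\|(A-zI)^{-1}\|^{-1}\ \ge\ g(\mathrm{dist}(z,\mathrm{sp}(A)))\quad\text{for all } z\in\mathbb C,\qquad(*)$$ where the left-hand side is $0$ if $A-zI$ has no bounded inverse. **Theorem (Spectrum vs. essential spectrum).** Let $\Omega_1=\mathcal B(l^2(\mathbb N))$, with $\Lambda$ consisting of the matrix entries $A\mapsto\langle Ae_j,e_i\rangle$, $i,j\in\mathbb N$. Let $\Omega_2$ be any one of the following three sets: 1. the bounded operators on $l^2(\mathbb N)$ with property $(*)$ whose dispersion is bounded by $f$, where $\Lambda$ consists of the matrix entries, the constant functions with values $f(m)$, $m\in\mathbb N$, and the constant functions with values $g(i/j)$ for positive integers $i,j$; 2. the bounded normal operators whose dispersion is bounded by $f$, where $\Lambda$ consists of the matrix entries and the constant functions with values $f(m)$,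 $m\in\mathbb N$; 3. the bounded self-adjoint operators whose dispersion is bounded by $f$, with $\Lambda$ as in 2. Then $$\mathrm{SCI}(\Xi_1,\Omega_2)_{\mathrm G}=\mathrm{SCI}(\Xi_1,\Omega_2)_{\mathrm A}=1,\qquad \mathrm{SCI}(\Xi_2,\Omega_2)_{\mathrm G}=\mathrm{SCI}(\Xi_2,\Omega_2)_{\mathrm A}=2,$$ $$\mathrm{SCI}(\Xi_2,\Omega_1)_{\mathrm G}=\mathrm{SCI}(\Xi_2,\Omega_1)_{\mathrm A}=3.$$ Moreover, for every $M>0$ all these equalities remain true if $\Omega_i$ is replaced by $\Omega_i^M=\{A\in\Omega_i:\|A\|\le M\}$, $i=1,2$. -/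

import Mathlib

open Filter Topology
open scoped NNReal lp

noncomputable section

namespace SolvIndex

/-! ### General algorithms, towers and the solvability complexity index -/

section General

variable {Ω : Type} {M : Type}

/-- `Γ : Ω → M` is a general algorithm for the evaluation set `Λ` which, on the input `A`, reads
the finitely many evaluations `L A`: its output and its choice of evaluations depend on `A` only
through the values `φ A`, `φ ∈ L A`. -/
structure IsGeneralAlgorithmWith (Λ : Set (Ω → ℂ)) (Γ : Ω → M) (L : Ω → Set (Ω → ℂ)) : Prop where
  finite : ∀ A, (L A).Finite
  subset : ∀ A, L A ⊆ Λ
  output_eq : ∀ A B, (∀ φ ∈ L A, φ B = φ A) → Γ B = Γ A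
  read_eq : ∀ A B, (∀ φ ∈ L A, φ B = φ A) → L B = L A

/-- General algorithms. -/
def IsGeneralAlgorithm (Λ : Set (Ω → ℂ)) (Γ : Ω → M) : Prop :=
  ∃ L, IsGeneralAlgorithmWith Λ Γ L

/-- A tower of height `k` for the problem function `Ξ`, whose lowest level consists of algorithms of
the type `alg`. The member `Γ_{n_k, …, n_j}` of the tower is `Γ [n_k, …, n_j]`, and the empty list
of indices gives `Ξ` itself. For `k = 0` this says that `Ξ` is an algorithm. -/
def HasTower [PseudoEMetricSpace M] (alg : (Ω → M) → Prop) (Ξ : Ω → M) (k : ℕ) : Prop :=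
  ∃ Γ : List ℕ → Ω → M, Γ [] = Ξ ∧
    (∀ l : List ℕ, l.length < k → ∀ A, Tendsto (fun n => Γ (l ++ [n]) A) atTop (𝓝 (Γ l A))) ∧
    ∀ l : List ℕ, l.length = k → alg (Γ l)

/-- The solvability complexity index with respect to towers of the type `alg`: the least possible
height of a tower, and `⊤` if there is no tower. -/
def sci [PseudoEMetricSpace M] (alg : (Ω → M) → Prop) (Ξ : Ω → M) : ℕ∞ :=
  sInf {h : ℕ∞ | ∃ k : ℕ, h = k ∧ HasTower alg Ξ k}

end General

/-! ### Arithmetic algorithms -/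

section Arithmetic

variable {Ω : Type}

/-- Arithmetic expressions in evaluations of the input, with constants from `ℚ` and the imaginary
unit. Real and imaginary parts may be taken. -/
inductive ArithExpr (Ω : Type) : Type
  | eval (φ : Ω → ℂ) : ArithExpr Ω
  | rat (q : ℚ) : ArithExpr Ω
  | imagUnit : ArithExpr Ω
  | add (a b : ArithExpr Ω) : ArithExpr Ω
  | sub (a b : ArithExpr Ω) : ArithExpr Ω
  | mul (a b : ArithExpr Ω) : ArithExpr Ω
  | div (a b : ArithExpr Ω) : ArithExpr Ω
  | re (a : ArithExpr Ω) : ArithExpr Ω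
  | im (a : ArithExpr Ω) : ArithExpr Ω

/-- The value of an expression at the input `A`. A quotient by zero has the value zero; as an
algorithm may test whether a number vanishes, this convention is immaterial. -/
def ArithExpr.val (A : Ω) : ArithExpr Ω → ℂ
  | .eval φ => φ A
  | .rat q => (q : ℂ)
  | .imagUnit => Complex.I
  | .add a b => a.val A + b.val A
  | .sub a b => a.val A - b.val A
  | .mul a b => a.val A * b.val A
  | .div a b => a.val A / b.val A
  | .re a => ((a.val A).re : ℂ)
  | .im a => ((a.val A).im : ℂ)

/-- The evaluations which occur in an expression. -/
def ArithExpr.reads : ArithExpr Ω → Set (Ω → ℂ)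
  | .eval φ => {φ}
  | .rat _ => ∅
  | .imagUnit => ∅
  | .add a b => a.reads ∪ b.reads
  | .sub a b => a.reads ∪ b.reads
  | .mul a b => a.reads ∪ b.reads
  | .div a b => a.reads ∪ b.reads
  | .re a => a.reads
  | .im a => a.reads

/-- A node of a computation tree: either a comparison of the real parts of two expressions, or a
halting node, which returns a finite list of expressions. -/
inductive CompNode (Ω : Type) : Type
  | test (a b : ArithExpr Ω) : CompNode Ω
  | output (l : List (ArithExpr Ω)) : CompNode Ω

/-- A computation tree. A node is addressed by the results of the comparisons on the way from the
root to it, the latest one first. -/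
abbrev CompTree (Ω : Type) : Type := List Bool → CompNode Ω

/-- On the input `A` the computation along the tree `T`, in which only evaluations from `S` are
used, arrives at the node with the address `p`. -/
inductive Reaches (T : CompTree Ω) (S : Set (Ω → ℂ)) (A : Ω) : List Bool → Prop
  | root : Reaches T S A []
  | isLess {p : List Bool} {a b : ArithExpr Ω} (hp : Reaches T S A p) (hT : T p = .test a b)
      (ha : a.reads ⊆ S) (hb : b.reads ⊆ S) (h : (a.val A).re < (b.val A).re) :
      Reaches T S A (true :: p)
  | notLess {p : List Bool} {a b : ArithExpr Ω} (hp : Reaches T S A p) (hT : T p = .test a b)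
      (ha : a.reads ⊆ S) (hb : b.reads ⊆ S) (h : (b.val A).re ≤ (a.val A).re) :
      Reaches T S A (false :: p)

/-- On the input `A` the computation along the tree `T` halts after finitely many steps, it uses
evaluations from `S` only, and the set of the returned numbers is `K`. -/
def Returns (T : CompTree Ω) (S : Set (Ω → ℂ)) (A : Ω) (K : Set ℂ) : Prop :=
  ∃ (p : List Bool) (l : List (ArithExpr Ω)), Reaches T S A p ∧ T p = .output l ∧
    (∀ a ∈ l, a.reads ⊆ S) ∧ K = {z | ∃ a ∈ l, z = a.val A}

/-- Arithmetic algorithms with values in the compact subsets of the plane: general algorithms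
which, for each input `A`, return a finite set that is obtained from the values of the evaluations
in `L A` by finitely many arithmetic operations and comparisons. The constant evaluation functions
which are used have to be the same for all inputs. -/
def IsArithmeticAlgorithm (Λ : Set (Ω → ℂ)) (Γ : Ω → TopologicalSpace.Compacts ℂ) : Prop :=
  ∃ L, IsGeneralAlgorithmWith Λ Γ L ∧
    (∀ A B, {φ ∈ L A | ∃ c, ∀ C, φ C = c} = {φ ∈ L B | ∃ c, ∀ C, φ C = c}) ∧
    ∃ T : CompTree Ω, ∀ A, Returns T (L A) A (Γ A)

end Arithmetic

/-! ### Operators on `ℓ²(ℕ)` -/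

/-- The bounded linear operators on `ℓ²(ℕ)`. -/
abbrev Op : Type := ℓ²(ℕ, ℂ) →L[ℂ] ℓ²(ℕ, ℂ)

/-- The canonical basis. -/
def stdVec (i : ℕ) : ℓ²(ℕ, ℂ) := lp.single 2 i 1

/-- The orthogonal projection onto the span of the first `n` basis vectors. -/
def proj (n : ℕ) : Op := ∑ i ∈ Finset.range n, (innerSL ℂ (stdVec i)).smulRight (stdVec i)

/-- The operators whose dispersion is bounded by `f`. -/
def dispersionClass (f : ℕ → ℕ) : Set Op :=
  {A | Tendsto (fun m => max ‖(1 - proj (f m)) * A * proj m‖ ‖proj m * A * (1 - proj (f m))‖) atTop (𝓝 0)}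

/-- The operators with `‖(A - z)⁻¹‖⁻¹ ≥ g (dist (z, sp A))` for all `z`. Here `resolvent A z` is
zero if `z` belongs to the spectrum, and then `‖resolvent A z‖⁻¹ = 0`. -/
def resolventClass (g : ℝ≥0 → ℝ≥0) : Set Op :=
  {A | ∀ z : ℂ, (g (Metric.infNndist z (spectrum ℂ A)) : ℝ) ≤ ‖resolvent A z‖⁻¹}

/-- The normal operators. -/
def normalClass : Set Op := {A | IsStarNormal A}

/-- The self-adjoint operators. -/
def selfAdjointClass : Set Op := {A | IsSelfAdjoint A}

/-- The operators of norm at most `M`. -/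
def normClass (M : ℝ) : Set Op := {A | ‖A‖ ≤ M}

/-- The spectrum, as a point of the space of compact sets with the Hausdorff metric. -/
def spec (A : Op) : TopologicalSpace.Compacts ℂ := ⟨spectrum ℂ A, spectrum.isCompact A⟩

/-- The set of all `z` for which `A - z` is not a Fredholm operator. -/
def essSpectrum (A : Op) : Set ℂ := {z | ¬ (A - z • (1 : Op)).IsFredholm}

open LinearMap.FiniteRangeSetoid in
/-- Small perturbations of Fredholm operators are Fredholm operators. -/
theorem isFredholm_add_of_norm_lt {u v w : Op} (hv : v.toLinearMap.IsQuasiInverse u.toLinearMap)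
    (hw : ‖v‖ * ‖w‖ < 1) : (u + w).IsFredholm := by
  have h1 : ‖-(v * w)‖ < 1 := by
    rw [norm_neg]; exact (norm_mul_le v w).trans_lt hw
  have h2 : ‖-(w * v)‖ < 1 := by
    rw [norm_neg]; exact (norm_mul_le w v).trans_lt (by rwa [mul_comm])
  obtain ⟨a, ha⟩ : IsUnit (1 + v * w) := by
    have := (Units.oneSub _ h1).isUnit
    simpa [Units.val_oneSub, sub_neg_eq_add] using this
  obtain ⟨b, hb⟩ : IsUnit (1 + w * v) := by
    have := (Units.oneSub _ h2).isUnit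
    simpa [Units.val_oneSub, sub_neg_eq_add] using this
  have key : (↑a⁻¹ : Op) * v = v * (↑b⁻¹ : Op) := by
    rw [Units.inv_mul_eq_iff_eq_mul, ← mul_assoc, Units.eq_mul_inv_iff_mul_eq, ha, hb]
    noncomm_ring
  refine ContinuousLinearMap.IsFredholm.of_isQuasiInverse (v := (↑a⁻¹ : Op) * v) ⟨?_, ?_⟩
  · have h : (v.toLinearMap ∘ₗ u.toLinearMap - LinearMap.id).HasNoetherianRange :=
      equiv_iff_hasNoetherianRange.mp hv.1
    refine equiv_iff_hasNoetherianRange.mpr ?_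
    have heq : (↑a⁻¹ : Op) * v * (u + w) - 1 = (↑a⁻¹ : Op) * (v * u - 1) := by
      have : (↑a⁻¹ : Op) * (1 + v * w) = 1 := by rw [← ha, Units.inv_mul]
      calc (↑a⁻¹ : Op) * v * (u + w) - 1
          = (↑a⁻¹ : Op) * (v * u - 1) + ((↑a⁻¹ : Op) * (1 + v * w) - 1) := by noncomm_ring
        _ = _ := by rw [this, sub_self, add_zero]
    have := h.comp_left (↑a⁻¹ : Op).toLinearMap
    exact (congrArg (fun x : Op => x.toLinearMap.HasNoetherianRange) heq).mpr this
  · have h : (u.toLinearMap ∘ₗ v.toLinearMap - LinearMap.id).HasNoetherianRange :=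
      equiv_iff_hasNoetherianRange.mp hv.2
    refine equiv_iff_hasNoetherianRange.mpr ?_
    have heq : (u + w) * ((↑a⁻¹ : Op) * v) - 1 = (u * v - 1) * (↑b⁻¹ : Op) := by
      have : (1 + w * v) * (↑b⁻¹ : Op) = 1 := by rw [← hb, Units.mul_inv]
      rw [key]
      calc (u + w) * (v * (↑b⁻¹ : Op)) - 1
          = (u * v - 1) * (↑b⁻¹ : Op) + ((1 + w * v) * (↑b⁻¹ : Op) - 1) := by noncomm_ring
        _ = _ := by rw [this, sub_self, add_zero]
    have := h.comp_right (↑b⁻¹ : Op).toLinearMap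
    exact (congrArg (fun x : Op => x.toLinearMap.HasNoetherianRange) heq).mpr this

open LinearMap.FiniteRangeSetoid in
theorem isCompact_essSpectrum (A : Op) : IsCompact (essSpectrum A) := by
  have hsub : essSpectrum A ⊆ spectrum ℂ A := by
    intro z hz
    rw [spectrum.mem_iff]
    intro hu
    apply hz
    have hu' : IsUnit (A - z • (1 : Op)) := by
      have := hu.neg
      rwa [neg_sub, Algebra.algebraMap_eq_smul_one] at this
    obtain ⟨a, ha⟩ := hu'
    have hq : (↑a⁻¹ : Op).toLinearMap.IsQuasiInverse (A - z • (1 : Op)).toLinearMap := by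
      rw [← ha]
      constructor
      · refine equiv_iff_hasNoetherianRange.mpr ?_
        have h0 : (↑a⁻¹ : Op) * (a : Op) - 1 = 0 := by simp
        exact (congrArg (fun x : Op => x.toLinearMap.HasNoetherianRange) h0).mpr
          LinearMap.HasNoetherianRange.zero
      · refine equiv_iff_hasNoetherianRange.mpr ?_
        have h0 : (a : Op) * (↑a⁻¹ : Op) - 1 = 0 := by simp
        exact (congrArg (fun x : Op => x.toLinearMap.HasNoetherianRange) h0).mpr
          LinearMap.HasNoetherianRange.zero
    exact ContinuousLinearMap.IsFredholm.of_isQuasiInverse hq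
  refine Metric.isCompact_of_isClosed_isBounded ?_ ((spectrum.isBounded A).subset hsub)
  rw [← isOpen_compl_iff, Metric.isOpen_iff]
  intro z hz
  have hz : (A - z • (1 : Op)).IsFredholm := not_not.mp hz
  obtain ⟨v, hv⟩ := hz.exists_isQuasiInverse
  refine ⟨(‖v‖ + 1)⁻¹, by positivity, fun y hy => ?_⟩
  have hy' : ‖z - y‖ < (‖v‖ + 1)⁻¹ := by
    rw [← dist_eq_norm, dist_comm]; exact hy
  have hlt : ‖v‖ * ‖(z - y) • (1 : Op)‖ < 1 := by
    have h1 : ‖(z - y) • (1 : Op)‖ ≤ ‖z - y‖ := by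
      rw [norm_smul]
      exact mul_le_of_le_one_right (norm_nonneg _) ContinuousLinearMap.norm_id_le
    have h2 : ‖v‖ * ‖(z - y) • (1 : Op)‖ ≤ ‖v‖ * (‖v‖ + 1)⁻¹ := by
      gcongr; exact h1.trans hy'.le
    refine h2.trans_lt ?_
    rw [← div_eq_mul_inv, div_lt_one (by positivity)]
    linarith
  have := isFredholm_add_of_norm_lt hv hlt
  have heq : A - z • (1 : Op) + (z - y) • (1 : Op) = A - y • (1 : Op) := by
    rw [sub_smul]; abel
  rw [heq] at this
  exact not_not.mpr this

/-- The essential spectrum, as a point of the space of compact sets with the Hausdorff metric. -/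
def essSpec (A : Op) : TopologicalSpace.Compacts ℂ := ⟨essSpectrum A, isCompact_essSpectrum A⟩

/-! ### Evaluation sets and the index of a spectral problem -/

/-- The matrix entries `A ↦ ⟨A e_j, e_i⟩`. In this formula the inner product is linear in its
first argument; that of Mathlib is linear in the second one. -/
def entries : Set (Op → ℂ) := {φ | ∃ i j : ℕ, φ = fun A => inner ℂ (stdVec i) (A (stdVec j))}

/-- The constant functions with the values `f m`. -/
def dispersionConsts (f : ℕ → ℕ) : Set (Op → ℂ) := {φ | ∃ m : ℕ, φ = fun _ => (f m : ℂ)}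

/-- The constant functions with the values `g (i / j)` at the positive rational numbers. -/
def resolventConsts (g : ℝ≥0 → ℝ≥0) : Set (Op → ℂ) :=
  {φ | ∃ i j : ℕ, 0 < i ∧ 0 < j ∧ φ = fun _ => ((g ((i : ℝ≥0) / (j : ℝ≥0)) : ℝ) : ℂ)}

/-- The restrictions to `Ω` of the functions in `Λ`. -/
def restr (Ω : Set Op) (Λ : Set (Op → ℂ)) : Set (Ω → ℂ) := (fun φ A => φ A) '' Λ

/-- The index of the problem `(Ξ, Ω, Λ)` with respect to general towers. -/
def sciG (Ξ : Op → TopologicalSpace.Compacts ℂ) (Ω : Set Op) (Λ : Set (Op → ℂ)) : ℕ∞ :=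
  sci (IsGeneralAlgorithm (restr Ω Λ)) (fun A : Ω => Ξ A)

/-- The index of the problem `(Ξ, Ω, Λ)` with respect to arithmetic towers. -/
def sciA (Ξ : Op → TopologicalSpace.Compacts ℂ) (Ω : Set Op) (Λ : Set (Op → ℂ)) : ℕ∞ :=
  sci (IsArithmeticAlgorithm (restr Ω Λ)) (fun A : Ω => Ξ A)

/-- Both indices of `(Ξ, Ω, Λ)` are equal to `k`, and the same is true if `Ω` is replaced by the
set of those operators in `Ω` whose norm is at most `M`, for every `M > 0`. -/
def HasIndex (Ξ : Op → TopologicalSpace.Compacts ℂ) (Ω : Set Op) (Λ : Set (Op → ℂ)) (k : ℕ∞) :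
    Prop :=
  (sciG Ξ Ω Λ = k ∧ sciA Ξ Ω Λ = k) ∧
    ∀ M : ℝ, 0 < M → sciG Ξ (Ω ∩ normClass M) Λ = k ∧ sciA Ξ (Ω ∩ normClass M) Λ = k

end SolvIndex

end

open SolvIndex

/-! ### Formal properties of towers, and algorithms as functions of comparison outcomes -/

namespace SolvIndex

/-! ### Towers -/

section Towers

variable {Ω : Type} {M : Type}

/-! Upper bounds. Everything is extracted from the infimum of min(‖(A - z)x‖, ‖(A - z)*x‖) over sets
of unit vectors x (`lowerBd`). Write γ_m(z) for the infimum over vectors supported in [m, ∞). By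
`notMem_essSpectrum_iff`, A - z is Fredholm exactly when γ_m(z) > 0 for some m, so the essential
spectrum is the limit of the sublevel sets of γ_m at a height of order 1/m. Each γ_m is the
decreasing limit of infima over vectors supported in [m, n), and these involve only the first n rows
and columns of A. If the dispersion is bounded by f, a section of size max(f(n), n) captures these
rows and columns up to a vanishing error. Then γ_m costs one limit and the essential spectrum two.
Without such information the size of the section needs a limit of its own, which gives three.
Comparing a convergent sequence with a threshold need not stabilise; `hyst` replaces the threshold
by an interval, and then it does.

For the spectrum only γ_0 matters. By (*) it lies above g(dist(z, sp A)), and it never exceeds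
dist(z, sp A). Any compact set that satisfies these two inequalities approximately is close to sp A,
so a single limit is enough (`tendsto_bestSet`). Self-adjoint and normal operators have property (*)
because the resolvent norm of a normal operator is 1/dist.

A computation tree is an arbitrary function on addresses. Hence every function of the outcomes of
finitely many comparisons between entries and rationals is an arithmetic algorithm once its values
are rounded to finite sets of Gaussian rationals. The numbers f(m) and g(i/j) are built into the
tree and never read.

Lower bounds. If all entries are locally constant along a family of operators indexed by a
topological space, then so is every general algorithm. By Baire's theorem a tower of height one
cannot separate two complementary dense sets (`not_hasTower_one`), and a tower of height two can
only decide countable unions of Gδ-sets (`exists_eq_iUnion_isGδ_of_hasTower_two`). The first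
obstruction is applied to block operators indexed by binary sequences, whose essential spectrum
contains M or is at most {0}, according to whether infinitely many blocks are switched on. As f may
grow very slowly, these blocks must be spread out so that all corners are small; this is done by
averaging over dyadic scales. The second is applied to involutions indexed by sequences in ℕ ∪ {∞},
for which 0 is in the essential spectrum exactly if ∞ occurs infinitely often. That set is not a
countable union of Gδ-sets (`ne_iUnion_of_isGδ`). -/

theorem HasTower.succ [PseudoEMetricSpace M] {alg : (Ω → M) → Prop} {Ξ : Ω → M} {k : ℕ}
    (h : HasTower alg Ξ k) : HasTower alg Ξ (k + 1) := by
  obtain ⟨Γ, h0, hlim, halg⟩ := h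
  -- The new outermost index is a dummy, so the new limit is that of a constant sequence.
  refine ⟨fun l => Γ l.tail, h0, ?_, ?_⟩
  · intro l hl A
    cases l with
    | nil => simpa using tendsto_const_nhds
    | cons n t => simpa using hlim t (by simpa using hl) A
  · intro l hl
    exact halg _ (by simp [hl])

theorem HasTower.mono_height [PseudoEMetricSpace M] {alg : (Ω → M) → Prop} {Ξ : Ω → M} {j k : ℕ}
    (h : HasTower alg Ξ j) (hjk : j ≤ k) : HasTower alg Ξ k := by
  induction hjk with
  | refl => exact h
  | step _ ih => exact ih.succ

theorem HasTower.mono_alg [PseudoEMetricSpace M] {alg alg' : (Ω → M) → Prop} {Ξ : Ω → M} {k : ℕ}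
    (h : HasTower alg Ξ k) (H : ∀ Γ, alg Γ → alg' Γ) : HasTower alg' Ξ k := by
  obtain ⟨Γ, h0, hlim, halg⟩ := h
  exact ⟨Γ, h0, hlim, fun l hl => H _ (halg l hl)⟩

theorem sci_eq_of_hasTower [PseudoEMetricSpace M] {alg : (Ω → M) → Prop} {Ξ : Ω → M} {k : ℕ}
    (h : HasTower alg Ξ (k + 1)) (h' : ¬ HasTower alg Ξ k) : sci alg Ξ = (k + 1 : ℕ) := by
  refine le_antisymm (sInf_le ⟨_, rfl, h⟩) (le_sInf ?_)
  rintro _ ⟨j, rfl, hj⟩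
  by_contra! hlt
  exact h' (hj.mono_height (Nat.lt_succ_iff.mp (by exact_mod_cast hlt)))

theorem IsArithmeticAlgorithm.isGeneralAlgorithm {Λ : Set (Ω → ℂ)}
    {Γ : Ω → TopologicalSpace.Compacts ℂ} (h : IsArithmeticAlgorithm Λ Γ) :
    IsGeneralAlgorithm Λ Γ :=
  h.imp fun _ hL => hL.1

end Towers

/-- Both indices equal `k + 1` as soon as there is an arithmetic tower of height `k + 1` and no
general tower of height `k`. -/
theorem sciG_sciA_eq {Ξ : Op → TopologicalSpace.Compacts ℂ} {Ω : Set Op} {Λ : Set (Op → ℂ)} {k : ℕ}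
    (h : HasTower (IsArithmeticAlgorithm (restr Ω Λ)) (fun A : Ω => Ξ A) (k + 1))
    (h' : ¬ HasTower (IsGeneralAlgorithm (restr Ω Λ)) (fun A : Ω => Ξ A) k) :
    sciG Ξ Ω Λ = (k + 1 : ℕ) ∧ sciA Ξ Ω Λ = (k + 1 : ℕ) :=
  ⟨sci_eq_of_hasTower (h.mono_alg fun _ => IsArithmeticAlgorithm.isGeneralAlgorithm) h',
    sci_eq_of_hasTower h fun h'' =>
      h' (h''.mono_alg fun _ => IsArithmeticAlgorithm.isGeneralAlgorithm)⟩

/-! ### Arithmetic algorithms from comparison patterns -/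

section Patterns

variable {Ω : Type}

theorem ArithExpr.val_eq_of_reads {A B : Ω} (e : ArithExpr Ω)
    (h : ∀ φ ∈ e.reads, φ B = φ A) : e.val B = e.val A := by
  induction e with
  | eval φ => exact h φ rfl
  | rat q => rfl
  | imagUnit => rfl
  | add a b iha ihb | sub a b iha ihb | mul a b iha ihb | div a b iha ihb =>
    simp only [ArithExpr.val]
    rw [iha fun φ hφ => h φ (Or.inl hφ), ihb fun φ hφ => h φ (Or.inr hφ)]
  | re a iha | im a iha =>
    simp only [ArithExpr.val]
    rw [iha h]

theorem ArithExpr.reads_finite (e : ArithExpr Ω) : e.reads.Finite := by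
  induction e with
  | eval φ => exact Set.finite_singleton φ
  | rat q => exact Set.finite_empty
  | imagUnit => exact Set.finite_empty
  | add a b iha ihb | sub a b iha ihb | mul a b iha ihb | div a b iha ihb => exact iha.union ihb
  | re a iha | im a iha => exact iha

/-- The constant expression with a Gaussian rational value. -/
def ArithExpr.gauss (q : ℚ × ℚ) : ArithExpr Ω := .add (.rat q.1) (.mul (.rat q.2) .imagUnit)

/-- The Gaussian rational with given real and imaginary part. -/
noncomputable def gauss (q : ℚ × ℚ) : ℂ := q.1 + q.2 * Complex.I

theorem ArithExpr.val_gauss (A : Ω) (q : ℚ × ℚ) : (ArithExpr.gauss q).val A = SolvIndex.gauss q :=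
  rfl

theorem ArithExpr.reads_gauss (q : ℚ × ℚ) : (ArithExpr.gauss q : ArithExpr Ω).reads = ∅ := by
  simp [ArithExpr.gauss, ArithExpr.reads]

open Classical in
/-- The result of the comparison of the real parts of two expressions. -/
noncomputable def outcome (A : Ω) (t : ArithExpr Ω × ArithExpr Ω) : Bool :=
  decide ((t.1.val A).re < (t.2.val A).re)

/-- A map with values in the finite sets of Gaussian rationals which is determined by the results
of finitely many comparisons is an arithmetic algorithm. -/
theorem isArithmeticAlgorithm_of_outcomes {Λ : Set (Ω → ℂ)}
    {Γ : Ω → TopologicalSpace.Compacts ℂ} (ts : List (ArithExpr Ω × ArithExpr Ω))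
    (hts : ∀ t ∈ ts, t.1.reads ⊆ Λ ∧ t.2.reads ⊆ Λ)
    (hdet : ∀ A B, ts.map (outcome A) = ts.map (outcome B) → Γ A = Γ B)
    (hfin : ∀ A, ∃ l : List (ℚ × ℚ), (Γ A : Set ℂ) = {z | ∃ q ∈ l, z = gauss q}) :
    IsArithmeticAlgorithm Λ Γ := by
  classical
  set S : Set (Ω → ℂ) := ⋃ t ∈ ts, (t.1.reads ∪ t.2.reads) with hS
  have hreads : ∀ t ∈ ts, t.1.reads ⊆ S ∧ t.2.reads ⊆ S := fun t ht =>
    ⟨fun φ hφ => Set.mem_biUnion ht (Or.inl hφ), fun φ hφ => Set.mem_biUnion ht (Or.inr hφ)⟩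
  have hSfin : S.Finite := by
    refine Set.Finite.biUnion (s := {t | t ∈ ts}) ts.finite_toSet fun t _ => ?_
    exact t.1.reads_finite.union t.2.reads_finite
  -- The same finite set is read on every input. This makes `read_eq` and the condition on constant
  -- functions trivial.
  refine ⟨fun _ => S, ⟨fun _ => hSfin, fun _ => ?_, fun A B h => ?_, fun _ _ _ => rfl⟩,
    fun _ _ => rfl, ?_⟩
  · refine Set.iUnion₂_subset fun t ht => ?_
    exact Set.union_subset (hts t ht).1 (hts t ht).2
  · refine hdet _ _ (List.map_congr_left fun t ht => ?_)
    have h1 := t.1.val_eq_of_reads fun φ hφ => h φ ((hreads t ht).1 hφ)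
    have h2 := t.2.val_eq_of_reads fun φ hφ => h φ ((hreads t ht).2 hφ)
    simp only [outcome, h1, h2]
  choose out hout using hfin
  -- Level i of the tree performs the i-th comparison. A leaf returns the output of any input with
  -- the recorded outcomes; the default `[]` sits only at leaves that no input reaches.
  let T : CompTree Ω := fun p =>
    match ts[p.length]? with
    | some t => .test t.1 t.2
    | none => .output (if h : ∃ A, (ts.map (outcome A)).reverse = p
        then (out h.choose).map ArithExpr.gauss else [])
  refine ⟨T, fun A => ?_⟩
  have key : ∀ n ≤ ts.length, Reaches T S A (((ts.take n).map (outcome A)).reverse) := by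
    intro n
    induction n with
    | zero => intro _; simpa using Reaches.root
    | succ n ih =>
      intro hn
      have hn' : n < ts.length := hn
      have h1 := ih hn'.le
      have hT : T (((ts.take n).map (outcome A)).reverse) = .test (ts[n]).1 (ts[n]).2 := by
        have : (((ts.take n).map (outcome A)).reverse).length = n := by
          simp [hn'.le]
        simp only [T, this, List.getElem?_eq_getElem hn']
      have hr := hreads _ (List.getElem_mem hn')
      have hlist : ((ts.take (n + 1)).map (outcome A)).reverse
          = outcome A ts[n] :: ((ts.take n).map (outcome A)).reverse := by
        rw [List.take_succ_eq_append_getElem hn', List.map_append, List.reverse_append]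
        rfl
      rw [hlist]
      by_cases hlt : ((ts[n]).1.val A).re < ((ts[n]).2.val A).re
      · have : outcome A ts[n] = true := by simpa [outcome] using hlt
        rw [this]
        exact .isLess h1 hT hr.1 hr.2 hlt
      · have : outcome A ts[n] = false := by simpa [outcome] using hlt
        rw [this]
        exact .notLess h1 hT hr.1 hr.2 (not_lt.mp hlt)
  have hex : ∃ B, (ts.map (outcome B)).reverse = (ts.map (outcome A)).reverse := ⟨A, rfl⟩
  have hΓ : Γ hex.choose = Γ A := hdet _ _ (List.reverse_injective hex.choose_spec)
  refine ⟨(ts.map (outcome A)).reverse, (out hex.choose).map ArithExpr.gauss, ?_, ?_, ?_, ?_⟩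
  · simpa using key _ le_rfl
  · have : ((ts.map (outcome A)).reverse).length = ts.length := by simp
    simp only [T, this, List.getElem?_eq_none le_rfl]
    rw [dif_pos hex]
  · intro a ha
    obtain ⟨q, -, rfl⟩ := List.mem_map.mp ha
    simp [ArithExpr.reads_gauss]
  · rw [← hΓ, hout]
    ext z
    simp [ArithExpr.val_gauss]

end Patterns

/-! ### Quantised matrix entries -/

/-- The matrix entries of an operator. -/
noncomputable def entry (A : Op) (i j : ℕ) : ℂ := inner ℂ (stdVec i) (A (stdVec j))

/-- The resolution to which the entries are read at stage `N`. -/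
def mesh (N : ℕ) : ℕ := 2 * (N + 1) ^ 3

/-- Two operators look the same at stage `N`: for the entries in the upper left `N × N`-corner, the
comparisons of their real and imaginary parts with the multiples of `1 / mesh N` up to `N + 1` have
the same results. -/
def SameView (N : ℕ) (A B : Op) : Prop :=
  ∀ i < N, ∀ j < N, ∀ t : ℤ, |t| ≤ (N + 1) * mesh N →
    ((entry A i j).re < ((t / mesh N : ℚ) : ℝ) ↔ (entry B i j).re < ((t / mesh N : ℚ) : ℝ)) ∧
    ((entry A i j).im < ((t / mesh N : ℚ) : ℝ) ↔ (entry B i j).im < ((t / mesh N : ℚ) : ℝ))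

/-- The value of `F` at `A` depends only on the views of `A` at the stages up to `N`. -/
def Determined {α : Type*} (N : ℕ) (F : Op → α) : Prop :=
  ∀ A B, (∀ k ≤ N, SameView k A B) → F A = F B

theorem SameView.refl (N : ℕ) (A : Op) : SameView N A A := fun _ _ _ _ _ _ => ⟨Iff.rfl, Iff.rfl⟩

theorem SameView.symm {N : ℕ} {A B : Op} (h : SameView N A B) : SameView N B A :=
  fun i hi j hj t ht => ⟨(h i hi j hj t ht).1.symm, (h i hi j hj t ht).2.symm⟩

theorem SameView.trans {N : ℕ} {A B C : Op} (h : SameView N A B) (h' : SameView N B C) :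
    SameView N A C :=
  fun i hi j hj t ht => ⟨(h i hi j hj t ht).1.trans (h' i hi j hj t ht).1,
    (h i hi j hj t ht).2.trans (h' i hi j hj t ht).2⟩

/-- The views up to stage `N` amount to finitely many comparisons of real and imaginary parts of
entries with rational constants, so no evaluation other than entries is read. -/
theorem Determined.isArithmeticAlgorithm {N : ℕ} {F : Op → TopologicalSpace.Compacts ℂ}
    (hF : Determined N F)
    (hfin : ∀ A, ∃ l : List (ℚ × ℚ), (F A : Set ℂ) = {z | ∃ q ∈ l, z = gauss q})
    {Ω : Set Op} {Λ : Set (Op → ℂ)} (hΛ : entries ⊆ Λ) :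
    IsArithmeticAlgorithm (restr Ω Λ) (fun A : Ω => F A) := by
  let ev (i j : ℕ) : ArithExpr Ω := .eval fun A : Ω => inner ℂ (stdVec i) ((A : Op) (stdVec j))
  let q (k : ℕ) (t : ℤ) : ArithExpr Ω := .rat (t / mesh k : ℚ)
  let ints (k : ℕ) : List ℤ := (Finset.Icc (-((k + 1) * mesh k : ℤ)) ((k + 1) * mesh k)).toList
  let ts : List (ArithExpr Ω × ArithExpr Ω) :=
    (List.range (N + 1)).flatMap fun k => (List.range k).flatMap fun i =>
      (List.range k).flatMap fun j => (ints k).flatMap fun t =>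
        [(.re (ev i j), q k t), (.im (ev i j), q k t)]
  have hmem : ∀ p, p ∈ ts ↔ ∃ k ≤ N, ∃ i < k, ∃ j < k, ∃ t : ℤ, |t| ≤ (k + 1) * mesh k ∧
      (p = (.re (ev i j), q k t) ∨ p = (.im (ev i j), q k t)) := by
    intro p
    simp only [ts, ints, List.mem_flatMap, List.mem_range, Finset.mem_toList, Finset.mem_Icc,
      abs_le, List.mem_cons, List.not_mem_nil, or_false, Nat.lt_succ_iff]
  have hev : ∀ i j, (ev i j).reads ⊆ restr Ω Λ := by
    intro i j φ hφ
    obtain rfl : φ = _ := hφ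
    exact ⟨_, hΛ ⟨i, j, rfl⟩, rfl⟩
  refine isArithmeticAlgorithm_of_outcomes ts ?_ ?_ fun A => hfin A
  · intro p hp
    obtain ⟨k, -, i, -, j, -, t, -, rfl | rfl⟩ := (hmem p).mp hp
    · exact ⟨hev i j, Set.empty_subset _⟩
    · exact ⟨hev i j, Set.empty_subset _⟩
  · intro A B hAB
    have hAB' : ∀ p ∈ ts, outcome A p = outcome B p := List.map_inj_left.mp hAB
    refine hF _ _ fun k hk i hi j hj t ht => ⟨?_, ?_⟩
    · have := hAB' _ ((hmem _).mpr ⟨k, hk, i, hi, j, hj, t, ht, Or.inl rfl⟩)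
      simpa [outcome, ev, q, ArithExpr.val, entry, ← Complex.ofReal_ratCast] using this
    · have := hAB' _ ((hmem _).mpr ⟨k, hk, i, hi, j, hj, t, ht, Or.inr rfl⟩)
      simpa [outcome, ev, q, ArithExpr.val, entry, ← Complex.ofReal_ratCast] using this

end SolvIndex

/-! ### Approximate recovery of finite sections, and rounding of the output -/

namespace SolvIndex

/-! ### The canonical basis and its projections -/

theorem inner_stdVec_left (i : ℕ) (x : ℓ²(ℕ, ℂ)) : inner ℂ (stdVec i) x = x i := by
  rw [stdVec, lp.inner_single_left]; simp

theorem stdVec_apply (i j : ℕ) : stdVec i j = if j = i then 1 else 0 := by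
  simp [stdVec, lp.single_apply, Pi.single_apply]

theorem norm_stdVec (i : ℕ) : ‖stdVec i‖ = 1 := by
  rw [stdVec, lp.norm_single] <;> simp

theorem entry_eq (A : Op) (i j : ℕ) : entry A i j = A (stdVec j) i := inner_stdVec_left _ _

theorem norm_entry_le (A : Op) (i j : ℕ) : ‖entry A i j‖ ≤ ‖A‖ := by
  refine (norm_inner_le_norm _ _).trans ?_
  simpa [norm_stdVec] using A.le_opNorm (stdVec j)

theorem proj_apply (n : ℕ) (x : ℓ²(ℕ, ℂ)) :
    proj n x = ∑ i ∈ Finset.range n, x i • stdVec i := by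
  simp [proj, inner_stdVec_left]

theorem proj_apply_apply (n : ℕ) (x : ℓ²(ℕ, ℂ)) (i : ℕ) :
    proj n x i = if i < n then x i else 0 := by
  rw [proj_apply, lp.coeFn_sum, Finset.sum_apply]
  simp [stdVec_apply]

theorem proj_stdVec (n i : ℕ) : proj n (stdVec i) = if i < n then stdVec i else 0 := by
  ext j
  rw [proj_apply_apply]
  split_ifs with h1 h2 h2 <;> simp [stdVec_apply] <;> omega

theorem proj_mul_proj (m n : ℕ) : proj m * proj n = proj (min m n) := by
  ext x i
  simp only [mul_apply_eq_comp, proj_apply_apply, lt_min_iff]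
  split_ifs <;> simp_all

theorem proj_zero : proj 0 = 0 := by simp [proj]

theorem isSelfAdjoint_proj (n : ℕ) : IsSelfAdjoint (proj n) := by
  rw [ContinuousLinearMap.isSelfAdjoint_iff_isSymmetric]
  intro x y
  simp only [ContinuousLinearMap.coe_coe, lp.inner_eq_tsum, proj_apply_apply]
  congr 1
  ext i
  split_ifs <;> simp

theorem norm_proj_apply_le (n : ℕ) (x : ℓ²(ℕ, ℂ)) : ‖proj n x‖ ≤ ‖x‖ := by
  refine lp.norm_mono (by simp) fun i => ?_
  rw [proj_apply_apply]
  split_ifs <;> simp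

theorem norm_proj_le (n : ℕ) : ‖proj n‖ ≤ 1 :=
  ContinuousLinearMap.opNorm_le_bound _ zero_le_one fun x => by
    simpa using norm_proj_apply_le n x

theorem one_sub_proj_apply_apply (n : ℕ) (x : ℓ²(ℕ, ℂ)) (i : ℕ) :
    (1 - proj n) x i = if i < n then 0 else x i := by
  simp only [sub_apply, one_apply_eq_self, lp.coeFn_sub,
    Pi.sub_apply, proj_apply_apply]
  split_ifs <;> simp

theorem norm_one_sub_proj_apply_le (n : ℕ) (x : ℓ²(ℕ, ℂ)) : ‖(1 - proj n) x‖ ≤ ‖x‖ := by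
  refine lp.norm_mono (by simp) fun i => ?_
  rw [one_sub_proj_apply_apply]
  split_ifs <;> simp

theorem norm_one_sub_proj_le (n : ℕ) : ‖1 - proj n‖ ≤ 1 :=
  ContinuousLinearMap.opNorm_le_bound _ zero_le_one fun x => by
    simpa using norm_one_sub_proj_apply_le n x

theorem tendsto_proj_apply (x : ℓ²(ℕ, ℂ)) : Tendsto (fun n => proj n x) atTop (𝓝 x) := by
  have h := (lp.hasSum_single (p := 2) (by simp) x).tendsto_sum_nat
  refine h.congr fun n => ?_
  rw [proj_apply]
  refine Finset.sum_congr rfl fun i _ => ?_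
  ext j
  simp [stdVec, lp.single_apply, Pi.single_apply]

theorem norm_proj_mul_proj_le {C : Op} {N : ℕ} {δ : ℝ}
    (h : ∀ i < N, ∀ j < N, ‖entry C i j‖ ≤ δ) : ‖proj N * C * proj N‖ ≤ N * (N * δ) := by
  rcases Nat.eq_zero_or_pos N with rfl | hN
  · simp [proj_zero]
  have hδ : 0 ≤ δ := (norm_nonneg _).trans (h 0 hN 0 hN)
  refine ContinuousLinearMap.opNorm_le_bound _ (by positivity) fun x => ?_
  have hx : (proj N * C * proj N) x = ∑ i ∈ Finset.range N, ∑ j ∈ Finset.range N,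
      (x j * entry C i j) • stdVec i := by
    simp only [mul_apply_eq_comp]
    rw [proj_apply]
    refine Finset.sum_congr rfl fun i _ => ?_
    rw [← Finset.sum_smul, proj_apply, map_sum, lp.coeFn_sum, Finset.sum_apply]
    simp [entry_eq]
  rw [hx]
  calc _ ≤ ∑ i ∈ Finset.range N, ∑ j ∈ Finset.range N, ‖x‖ * δ := by
        refine norm_sum_le_of_le _ fun i hi => norm_sum_le_of_le _ fun j hj => ?_
        rw [norm_smul, norm_mul, norm_stdVec, mul_one]
        have h1 : ‖x j‖ ≤ ‖x‖ := lp.norm_apply_le_norm (by simp) x j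
        have h2 := h i (Finset.mem_range.mp hi) j (Finset.mem_range.mp hj)
        gcongr
    _ = N * (N * δ) * ‖x‖ := by simp; ring

/-! ### Reconstruction of finite sections -/

/-- The two neighbouring cuts around `a` also enclose `b`. The bound `|a| ≤ N` keeps both cuts in
the tested range, where the extra `mesh N` makes room for the upper one. -/
theorem abs_sub_le_of_same_cuts {N : ℕ} {a b : ℝ} (ha : |a| ≤ N)
    (h : ∀ t : ℤ, |t| ≤ (N + 1) * mesh N →
      (a < ((t / mesh N : ℚ) : ℝ) ↔ b < ((t / mesh N : ℚ) : ℝ))) :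
    |a - b| ≤ 1 / mesh N := by
  have hD : (0 : ℝ) < mesh N := by unfold mesh; positivity
  have hD1 : (1 : ℝ) ≤ mesh N := by exact_mod_cast Nat.one_le_iff_ne_zero.mpr (by unfold mesh; positivity)
  obtain ⟨ha1, ha2⟩ := abs_le.mp ha
  have hfl := Int.floor_le (a * mesh N)
  have hfl' := Int.lt_floor_add_one (a * mesh N)
  have hb1 : -((N : ℝ) * mesh N) ≤ a * mesh N := by nlinarith
  have hb2 : a * mesh N ≤ (N : ℝ) * mesh N := by nlinarith
  have hfloor1 : -((N : ℤ) * mesh N) ≤ ⌊a * mesh N⌋ := Int.le_floor.mpr (by push_cast; exact hb1)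
  have hfloor2 : ⌊a * mesh N⌋ ≤ (N : ℤ) * mesh N := by
    have : ((⌊a * mesh N⌋ : ℤ) : ℝ) ≤ ((N * mesh N : ℤ) : ℝ) := by push_cast; linarith
    exact_mod_cast this
  have hDz : (1 : ℤ) ≤ mesh N := by exact_mod_cast hD1
  have e1 := h ⌊a * mesh N⌋ (abs_le.mpr ⟨by linarith, by linarith⟩)
  have e2 := h (⌊a * mesh N⌋ + 1) (abs_le.mpr ⟨by linarith, by linarith⟩)
  push_cast at e1 e2
  rw [lt_div_iff₀ hD, lt_div_iff₀ hD] at e1 e2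
  have h1 := mt e1.mpr (not_lt.mpr hfl)
  have h2 := e2.mp hfl'
  have h3 : |(a - b) * mesh N| ≤ 1 := by
    rw [abs_le]
    constructor <;> nlinarith
  rwa [le_div_iff₀ hD, ← abs_of_pos hD, ← abs_mul]

/-- Operators which look the same at stage `N`. -/
def viewSetoid (N : ℕ) : Setoid Op where
  r := SameView N
  iseqv := ⟨SameView.refl N, SameView.symm, SameView.trans⟩

/-- An operator which is computed from the view of `A` at stage `N`, and approximates the finite
section of `A`. -/
noncomputable def rep (N : ℕ) (A : Op) : Op :=
  proj N * (Quotient.mk (viewSetoid N) A).out * proj N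

theorem SameView.rep_eq {N : ℕ} {A B : Op} (h : SameView N A B) : rep N A = rep N B := by
  have : Quotient.mk (viewSetoid N) A = Quotient.mk (viewSetoid N) B := Quotient.sound h
  rw [rep, rep, this]

theorem norm_rep_sub_le {N : ℕ} {A : Op} (hA : ‖A‖ ≤ N) :
    ‖rep N A - proj N * A * proj N‖ ≤ 1 / (N + 1) := by
  set B := (Quotient.mk (viewSetoid N) A).out with hB
  have hview : SameView N A B := SameView.symm (Quotient.mk_out (s := viewSetoid N) A)
  have h1 : rep N A - proj N * A * proj N = proj N * (B - A) * proj N := by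
    rw [rep]; noncomm_ring
  rw [h1]
  -- Real and imaginary part of each entry are off by at most `1 / mesh N`, hence the entry by
  -- 1/(N+1)³. The N² entries together contribute at most 1/(N+1), which is the reason for the
  -- choice of `mesh`.
  refine (norm_proj_mul_proj_le (δ := 1 / (N + 1) ^ 3) fun i hi j hj => ?_).trans ?_
  · have h0 := norm_entry_le A i j
    have hre := abs_sub_le_of_same_cuts (((Complex.abs_re_le_norm _).trans h0).trans hA)
      fun t ht => (hview i hi j hj t ht).1
    have him := abs_sub_le_of_same_cuts (((Complex.abs_im_le_norm _).trans h0).trans hA)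
      fun t ht => (hview i hi j hj t ht).2
    have h2 : entry (B - A) i j = -(entry A i j - entry B i j) := by
      simp [entry]
    rw [h2, norm_neg]
    refine (Complex.norm_le_abs_re_add_abs_im _).trans ?_
    rw [Complex.sub_re, Complex.sub_im]
    refine (add_le_add hre him).trans (le_of_eq ?_)
    simp only [mesh]
    push_cast
    field_simp
    norm_num
  · have hN : (0 : ℝ) ≤ N := N.cast_nonneg
    rw [← mul_assoc, mul_one_div, div_le_div_iff₀ (by positivity) (by positivity)]
    nlinarith [mul_nonneg hN hN, mul_nonneg (mul_nonneg hN hN) hN]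

/-! ### Rounding -/

-- Take a finite ε/2-net inside `K` and move each of its points by less than ε/2 to a Gaussian
-- rational. The empty set is rounded to itself.
open TopologicalSpace in
theorem exists_gauss_close (K : Compacts ℂ) {ε : ℝ} (hε : 0 < ε) :
    ∃ K' : Compacts ℂ, (∃ l : List (ℚ × ℚ), (K' : Set ℂ) = {z | ∃ q ∈ l, z = gauss q}) ∧
      edist K' K ≤ ENNReal.ofReal ε := by
  classical
  have hgauss : ∀ z : ℂ, ∃ q : ℚ × ℚ, dist z (gauss q) < ε / 2 := by
    intro z
    obtain ⟨q1, h1, h1'⟩ := exists_rat_btwn (show z.re - ε / 4 < z.re by linarith)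
    obtain ⟨q2, h2, h2'⟩ := exists_rat_btwn (show z.im - ε / 4 < z.im by linarith)
    refine ⟨(q1, q2), ?_⟩
    rw [dist_eq_norm]
    refine (Complex.norm_le_abs_re_add_abs_im _).trans_lt ?_
    have e1 : (z - gauss (q1, q2)).re = z.re - q1 := by simp [gauss]
    have e2 : (z - gauss (q1, q2)).im = z.im - q2 := by simp [gauss]
    rw [e1, e2, abs_of_pos (by linarith), abs_of_pos (by linarith)]
    linarith
  choose r hr using hgauss
  obtain ⟨t, htK, htfin, hcov⟩ := K.isCompact.finite_cover_balls (half_pos hε)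
  have hfin : ((fun y => gauss (r y)) '' t).Finite := htfin.image _
  refine ⟨⟨_, hfin.isCompact⟩, ⟨htfin.toFinset.toList.map r, ?_⟩, ?_⟩
  · ext z
    constructor
    · rintro ⟨y, hy, rfl⟩
      exact ⟨r y, by simpa using ⟨y, hy, rfl⟩, rfl⟩
    · rintro ⟨q, hq, rfl⟩
      obtain ⟨y, hy, rfl⟩ := List.mem_map.mp hq
      exact ⟨y, by simpa using hy, rfl⟩
  · rw [Compacts.edist_eq]
    refine Metric.hausdorffEDist_le_of_mem_edist ?_ ?_
    · rintro _ ⟨y, hy, rfl⟩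
      refine ⟨y, htK hy, ?_⟩
      rw [edist_dist]
      refine ENNReal.ofReal_le_ofReal ?_
      rw [dist_comm]
      linarith [hr y]
    · intro z hz
      obtain ⟨y, hy, hzy⟩ := Set.mem_iUnion₂.mp (hcov hz)
      refine ⟨_, ⟨y, hy, rfl⟩, ?_⟩
      rw [edist_dist]
      refine ENNReal.ofReal_le_ofReal ?_
      have := Metric.mem_ball.mp hzy
      linarith [dist_triangle z y (gauss (r y)), hr y]

open TopologicalSpace in
/-- A finite set of Gaussian rationals which is close to `K`. -/
noncomputable def roundCompacts (n : ℕ) (K : Compacts ℂ) : Compacts ℂ :=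
  (exists_gauss_close K (Nat.one_div_pos_of_nat (α := ℝ) (n := n))).choose

open TopologicalSpace in
theorem tendsto_roundCompacts {F : ℕ → Compacts ℂ} {K : Compacts ℂ}
    (h : Tendsto F atTop (𝓝 K)) :
    Tendsto (fun n => roundCompacts n (F n)) atTop (𝓝 K) := by
  rw [tendsto_iff_edist_tendsto_0] at h ⊢
  have h1 : Tendsto (fun n : ℕ => ENNReal.ofReal (1 / ((n : ℝ) + 1))) atTop (𝓝 0) := by
    simpa using ENNReal.tendsto_ofReal (tendsto_one_div_add_atTop_nhds_zero_nat (𝕜 := ℝ))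
  have h2 := h1.add h
  rw [add_zero] at h2
  refine tendsto_of_tendsto_of_tendsto_of_le_of_le tendsto_const_nhds h2 (fun _ => zero_le)
    fun n => (edist_triangle _ (F n) _).trans (add_le_add_left ?_ _)
  exact (exists_gauss_close (F n) (Nat.one_div_pos_of_nat (α := ℝ) (n := n))).choose_spec.2

/-- A convergent scheme whose lowest level is determined by finitely many views gives rise to an
arithmetic tower. -/
theorem hasTower_of_determined {Ξ : Op → TopologicalSpace.Compacts ℂ} {Ω : Set Op}
    {Λ : Set (Op → ℂ)} {k : ℕ} (F : List ℕ → Op → TopologicalSpace.Compacts ℂ)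
    (hΛ : entries ⊆ Λ) (h0 : ∀ A ∈ Ω, F [] A = Ξ A)
    (hlim : ∀ l : List ℕ, l.length < k + 1 → ∀ A ∈ Ω,
      Tendsto (fun n => F (l ++ [n]) A) atTop (𝓝 (F l A)))
    (hdet : ∀ l : List ℕ, l.length = k + 1 → ∃ N, Determined N (F l)) :
    HasTower (IsArithmeticAlgorithm (restr Ω Λ)) (fun A : Ω => Ξ A) (k + 1) := by
  -- Only the lowest level is rounded, with a precision governed by the innermost index, so that the
  -- innermost limit is unchanged. The default 0 never occurs there, since these lists are nonempty.
  refine ⟨fun l A => if l.length = k + 1 then roundCompacts (l.getLast?.getD 0) (F l A)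
    else F l A, ?_, fun l hl A => ?_, fun l hl => ?_⟩
  · ext1 A
    simp [h0 A A.2]
  · have h1 := hlim l hl A A.2
    simp only [hl.ne, if_false, List.length_append, List.length_singleton]
    split_ifs
    · simpa using tendsto_roundCompacts h1
    · exact h1
  · obtain ⟨N, hN⟩ := hdet l hl
    have h1 : Determined N fun A => roundCompacts (l.getLast?.getD 0) (F l A) :=
      fun A B hAB => congrArg _ (hN A B hAB)
    simpa only [hl, if_true] using h1.isArithmeticAlgorithm (fun A =>
      (exists_gauss_close (F l A) Nat.one_div_pos_of_nat).choose_spec.1) hΛ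

end SolvIndex

/-! ### Lower bounds on vectors of restricted support, and their computation from finite sections -/

namespace SolvIndex

/-! ### Lower bounds of operators on sets of unit vectors -/

/-- The unit vectors supported in `[m, n)`. -/
def unitVecs (m n : ℕ) : Set ℓ²(ℕ, ℂ) := {x | ‖x‖ = 1 ∧ (∀ i < m, x i = 0) ∧ ∀ i, n ≤ i → x i = 0}

/-- The unit vectors supported in `[m, ∞)`. -/
def unitVecsFrom (m : ℕ) : Set ℓ²(ℕ, ℂ) := {x | ‖x‖ = 1 ∧ ∀ i < m, x i = 0}

/-- The smaller one of the norms of `(B - z) x` and `(B - z)* x`. -/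
noncomputable def lowerAt (B : Op) (z : ℂ) (x : ℓ²(ℕ, ℂ)) : ℝ :=
  min ‖B x - z • x‖ ‖star B x - star z • x‖

/-- The infimum of `lowerAt B z` over `S`. -/
noncomputable def lowerBd (S : Set ℓ²(ℕ, ℂ)) (B : Op) (z : ℂ) : ℝ := sInf (lowerAt B z '' S)

theorem lowerAt_nonneg (B : Op) (z : ℂ) (x : ℓ²(ℕ, ℂ)) : 0 ≤ lowerAt B z x :=
  le_min (norm_nonneg _) (norm_nonneg _)

theorem continuous_lowerAt (B : Op) (z : ℂ) : Continuous (lowerAt B z) := by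
  unfold lowerAt; fun_prop

theorem lowerBd_nonneg (S : Set ℓ²(ℕ, ℂ)) (B : Op) (z : ℂ) : 0 ≤ lowerBd S B z :=
  Real.sInf_nonneg (by rintro _ ⟨x, -, rfl⟩; exact lowerAt_nonneg B z x)

theorem lowerBd_le {S : Set ℓ²(ℕ, ℂ)} {B : Op} {z : ℂ} {x : ℓ²(ℕ, ℂ)} (hx : x ∈ S) :
    lowerBd S B z ≤ lowerAt B z x :=
  csInf_le ⟨0, by rintro _ ⟨x, -, rfl⟩; exact lowerAt_nonneg B z x⟩ ⟨x, hx, rfl⟩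

theorem le_lowerBd {S : Set ℓ²(ℕ, ℂ)} (hS : S.Nonempty) {B : Op} {z : ℂ} {c : ℝ}
    (h : ∀ x ∈ S, c ≤ lowerAt B z x) : c ≤ lowerBd S B z :=
  le_csInf (hS.image _) (by rintro _ ⟨x, hx, rfl⟩; exact h x hx)

theorem lowerBd_anti {S T : Set ℓ²(ℕ, ℂ)} (hS : S.Nonempty) (hST : S ⊆ T) (B : Op) (z : ℂ) :
    lowerBd T B z ≤ lowerBd S B z :=
  le_lowerBd hS fun _ hx => lowerBd_le (hST hx)

theorem lowerBd_le_add {S : Set ℓ²(ℕ, ℂ)} (hS : S.Nonempty) {B B' : Op} {z z' : ℂ} {δ : ℝ}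
    (h : ∀ x ∈ S, lowerAt B z x ≤ lowerAt B' z' x + δ) : lowerBd S B z ≤ lowerBd S B' z' + δ := by
  rw [← sub_le_iff_le_add]
  exact le_lowerBd hS fun x hx => by linarith [h x hx, lowerBd_le hx (B := B) (z := z)]

theorem lowerAt_le_add_norm_sub (B : Op) (z z' : ℂ) {x : ℓ²(ℕ, ℂ)} (hx : ‖x‖ = 1) :
    lowerAt B z x ≤ lowerAt B z' x + ‖z - z'‖ := by
  unfold lowerAt
  rw [← min_add_add_right]
  refine min_le_min ?_ ?_
  · have : B x - z • x = (B x - z' • x) - (z - z') • x := by rw [sub_smul]; abel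
    rw [this]
    refine (norm_sub_le _ _).trans ?_
    rw [norm_smul, hx, mul_one]
  · have : star B x - star z • x = (star B x - star z' • x) - star (z - z') • x := by
      rw [star_sub, sub_smul]; abel
    rw [this]
    refine (norm_sub_le _ _).trans ?_
    rw [norm_smul, hx, mul_one, norm_star]

/-- This is the 1-Lipschitz estimate in `z`, by which values at grid points control values
elsewhere. -/
theorem lowerBd_le_add_norm_sub {S : Set ℓ²(ℕ, ℂ)} (hS : S.Nonempty) (hu : ∀ x ∈ S, ‖x‖ = 1)
    (B : Op) (z z' : ℂ) : lowerBd S B z ≤ lowerBd S B z' + ‖z - z'‖ :=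
  lowerBd_le_add hS fun _ hx => lowerAt_le_add_norm_sub B z z' (hu _ hx)

theorem continuous_lowerBd {S : Set ℓ²(ℕ, ℂ)} (hS : S.Nonempty) (hu : ∀ x ∈ S, ‖x‖ = 1) (B : Op) :
    Continuous (lowerBd S B) :=
  (LipschitzWith.of_le_add fun z z' => by
    rw [dist_eq_norm]; exact lowerBd_le_add_norm_sub hS hu B z z').continuous

/-- Sublevel sets are therefore bounded, which is needed for the compactness argument below. -/
theorem norm_sub_norm_le_lowerBd {S : Set ℓ²(ℕ, ℂ)} (hS : S.Nonempty) (hu : ∀ x ∈ S, ‖x‖ = 1)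
    (B : Op) (z : ℂ) : ‖z‖ - ‖B‖ ≤ lowerBd S B z := by
  refine le_lowerBd hS fun x hx => le_min ?_ ?_
  · have h1 := norm_sub_norm_le (z • x) (B x)
    have h2 := B.le_opNorm x
    rw [norm_smul, hu x hx, mul_one] at h1
    rw [hu x hx, mul_one] at h2
    rw [norm_sub_rev]
    linarith
  · have h1 := norm_sub_norm_le (star z • x) (star B x)
    have h2 := (star B).le_opNorm x
    rw [norm_smul, hu x hx, mul_one, norm_star] at h1
    rw [hu x hx, mul_one, norm_star B] at h2
    rw [norm_sub_rev]
    linarith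

theorem unitVecs_subset {m n n' : ℕ} (h : n ≤ n') : unitVecs m n ⊆ unitVecs m n' :=
  fun _ hx => ⟨hx.1, hx.2.1, fun i hi => hx.2.2 i (h.trans hi)⟩

theorem unitVecs_subset_from (m n : ℕ) : unitVecs m n ⊆ unitVecsFrom m :=
  fun _ hx => ⟨hx.1, hx.2.1⟩

theorem unitVecs_nonempty {m n : ℕ} (h : m < n) : (unitVecs m n).Nonempty :=
  ⟨stdVec m, norm_stdVec m, fun i hi => by simp [stdVec_apply, hi.ne],
    fun i hi => by simp [stdVec_apply, (h.trans_le hi).ne']⟩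

theorem unitVecsFrom_nonempty (m : ℕ) : (unitVecsFrom m).Nonempty :=
  (unitVecs_nonempty m.lt_succ_self).mono (unitVecs_subset_from _ _)

theorem unitVecsFrom_anti {m m' : ℕ} (h : m ≤ m') : unitVecsFrom m' ⊆ unitVecsFrom m :=
  fun _ hx => ⟨hx.1, fun i hi => hx.2 i (hi.trans_le h)⟩

theorem proj_eq_self_of_mem_unitVecs {m n : ℕ} {x : ℓ²(ℕ, ℂ)} (hx : x ∈ unitVecs m n) :
    proj n x = x := by
  ext i
  rw [proj_apply_apply]
  split_ifs with h
  · rfl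
  · exact (hx.2.2 i (not_lt.mp h)).symm

theorem lowerAt_le_add_of_proj {B B' : Op} {n : ℕ} {δ : ℝ} (h1 : ‖(B - B') * proj n‖ ≤ δ)
    (h2 : ‖proj n * (B - B')‖ ≤ δ) (z : ℂ) {x : ℓ²(ℕ, ℂ)} (hx : ‖x‖ = 1) (hn : proj n x = x) :
    lowerAt B z x ≤ lowerAt B' z x + δ := by
  unfold lowerAt
  rw [← min_add_add_right]
  refine min_le_min ?_ ?_
  · have h3 : B x - z • x = (B' x - z • x) + ((B - B') * proj n) x := by
      rw [mul_apply_eq_comp, hn, sub_apply]; abel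
    rw [h3]
    refine (norm_add_le _ _).trans (add_le_add_right ?_ _)
    simpa [hx] using ((B - B') * proj n).le_of_opNorm_le h1 x
  · have h3 : star B x - star z • x = (star B' x - star z • x) + (star (proj n * (B - B'))) x := by
      rw [star_mul, (isSelfAdjoint_proj n).star_eq, mul_apply_eq_comp, hn, star_sub, sub_apply]
      abel
    rw [h3]
    refine (norm_add_le _ _).trans (add_le_add_right ?_ _)
    rw [← norm_star] at h2
    simpa [hx] using (star (proj n * (B - B'))).le_of_opNorm_le h2 x

/-- A vector supported in [m, n) sees only the first n columns of `B`, and under the adjoint only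
its first n rows. -/
theorem abs_lowerBd_sub_le {B B' : Op} {m n : ℕ} (hmn : m < n) {δ : ℝ}
    (h1 : ‖(B - B') * proj n‖ ≤ δ) (h2 : ‖proj n * (B - B')‖ ≤ δ) (z : ℂ) :
    |lowerBd (unitVecs m n) B z - lowerBd (unitVecs m n) B' z| ≤ δ := by
  have e1 : lowerBd (unitVecs m n) B z ≤ lowerBd (unitVecs m n) B' z + δ :=
    lowerBd_le_add (unitVecs_nonempty hmn) fun x hx =>
      lowerAt_le_add_of_proj h1 h2 z hx.1 (proj_eq_self_of_mem_unitVecs hx)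
  have e2 : lowerBd (unitVecs m n) B' z ≤ lowerBd (unitVecs m n) B z + δ := by
    refine lowerBd_le_add (unitVecs_nonempty hmn) fun x hx =>
      lowerAt_le_add_of_proj (n := n) ?_ ?_ z hx.1 (proj_eq_self_of_mem_unitVecs hx)
    · rwa [← neg_sub, neg_mul, norm_neg]
    · rwa [← neg_sub, mul_neg, norm_neg]
  rw [abs_le]
  constructor <;> linarith

theorem antitone_lowerBd_unitVecs (m : ℕ) (A : Op) (z : ℂ) :
    Antitone fun n => lowerBd (unitVecs m (m + 1 + n)) A z :=
  fun n n' h => lowerBd_anti (unitVecs_nonempty (by omega)) (unitVecs_subset (by omega)) A z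

theorem lowerBd_from_le (m : ℕ) (A : Op) (z : ℂ) (n : ℕ) :
    lowerBd (unitVecsFrom m) A z ≤ lowerBd (unitVecs m (m + 1 + n)) A z :=
  lowerBd_anti (unitVecs_nonempty (by omega)) (unitVecs_subset_from _ _) A z

/-- Truncating and renormalising a nearly optimal unit vector gives finitely supported competitors.
The supports start with `m + 1 + n` so that the sets of unit vectors are never empty. -/
theorem tendsto_lowerBd_unitVecs (m : ℕ) (A : Op) (z : ℂ) :
    Tendsto (fun n => lowerBd (unitVecs m (m + 1 + n)) A z) atTop
      (𝓝 (lowerBd (unitVecsFrom m) A z)) := by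
  refine tendsto_order.mpr ⟨fun a ha => Eventually.of_forall fun n =>
    ha.trans_le (lowerBd_from_le m A z n), fun a ha => ?_⟩
  obtain ⟨_, ⟨x, hx, rfl⟩, hxa⟩ := exists_lt_of_csInf_lt ((unitVecsFrom_nonempty m).image _) ha
  have hP : Tendsto (fun n => proj (m + 1 + n) x) atTop (𝓝 x) :=
    (tendsto_proj_apply x).comp (tendsto_add_atTop_nat (m + 1) |>.congr fun n => by ring)
  have hne : ‖x‖ ≠ 0 := by rw [hx.1]; exact one_ne_zero
  have hN : Tendsto (fun n => ((‖proj (m + 1 + n) x‖⁻¹ : ℝ) : ℂ) • proj (m + 1 + n) x) atTop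
      (𝓝 x) := by
    have h1 := (Complex.continuous_ofReal.tendsto _).comp (hP.norm.inv₀ hne)
    simpa [hx.1] using h1.smul hP
  have hlow := ((continuous_lowerAt A z).tendsto x).comp hN
  have hpos : ∀ᶠ n in atTop, 0 < ‖proj (m + 1 + n) x‖ :=
    hP.norm.eventually_const_lt (by rw [hx.1]; exact one_pos)
  filter_upwards [hlow.eventually_lt_const hxa, hpos] with n hn hn'
  refine (lowerBd_le ?_).trans_lt hn
  refine ⟨?_, fun i hi => ?_, fun i hi => ?_⟩
  · rw [norm_smul, Complex.norm_real, norm_inv, norm_norm, inv_mul_cancel₀ hn'.ne']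
  · rw [lp.coeFn_smul, Pi.smul_apply, proj_apply_apply, hx.2 i hi]
    simp
  · rw [lp.coeFn_smul, Pi.smul_apply, proj_apply_apply, if_neg (by omega), smul_zero]

/-! ### Approximation by quantised finite sections -/

theorem proj_mul_of_le {n N : ℕ} (h : n ≤ N) : proj N * proj n = proj n := by
  rw [proj_mul_proj, min_eq_right h]

theorem mul_proj_of_le {n N : ℕ} (h : n ≤ N) : proj n * proj N = proj n := by
  rw [proj_mul_proj, min_eq_left h]

/-- The error consists of the quantisation error of the section and of the part of the first `n`
columns that lies below row `N`. -/
theorem norm_rep_sub_mul_proj_le {A : Op} {n N : ℕ} (hn : n ≤ N) (hA : ‖A‖ ≤ N) :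
    ‖(rep N A - A) * proj n‖ ≤ 1 / (N + 1) + ‖(1 - proj N) * A * proj n‖ := by
  have h : (rep N A - A) * proj n
      = (rep N A - proj N * A * proj N) * proj n - (1 - proj N) * A * proj n := by
    have : proj N * A * proj N * proj n = proj N * A * proj n := by
      rw [mul_assoc, proj_mul_of_le hn]
    rw [sub_mul, sub_mul, this]
    noncomm_ring
  rw [h]
  refine (norm_sub_le _ _).trans (add_le_add_left ?_ _)
  refine (norm_mul_le _ _).trans ((mul_le_of_le_one_right (norm_nonneg _) (norm_proj_le n)).trans ?_)
  exact norm_rep_sub_le hA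

theorem norm_proj_mul_rep_sub_le {A : Op} {n N : ℕ} (hn : n ≤ N) (hA : ‖A‖ ≤ N) :
    ‖proj n * (rep N A - A)‖ ≤ 1 / (N + 1) + ‖proj n * A * (1 - proj N)‖ := by
  have h : proj n * (rep N A - A)
      = proj n * (rep N A - proj N * A * proj N) - proj n * A * (1 - proj N) := by
    have : proj n * (proj N * A * proj N) = proj n * A * proj N := by
      rw [mul_assoc, ← mul_assoc, mul_proj_of_le hn, mul_assoc]
    rw [mul_sub, mul_sub, this]
    noncomm_ring
  rw [h]
  refine (norm_sub_le _ _).trans (add_le_add_left ?_ _)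
  refine (norm_mul_le _ _).trans ((mul_le_of_le_one_left (norm_nonneg _) (norm_proj_le n)).trans ?_)
  exact norm_rep_sub_le hA

theorem tendsto_rep_of_tendsto {A : Op} {n N : ℕ → ℕ} (hn : ∀ k, n k ≤ N k)
    (hN : Tendsto N atTop atTop)
    (h1 : Tendsto (fun k => ‖(1 - proj (N k)) * A * proj (n k)‖) atTop (𝓝 0))
    (h2 : Tendsto (fun k => ‖proj (n k) * A * (1 - proj (N k))‖) atTop (𝓝 0)) :
    Tendsto (fun k => max ‖(rep (N k) A - A) * proj (n k)‖ ‖proj (n k) * (rep (N k) A - A)‖)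
      atTop (𝓝 0) := by
  have h3 : Tendsto (fun k => 1 / ((N k : ℝ) + 1)) atTop (𝓝 0) :=
    (tendsto_one_div_add_atTop_nhds_zero_nat (𝕜 := ℝ)).comp hN
  have hA : ∀ᶠ k in atTop, ‖A‖ ≤ N k :=
    (tendsto_natCast_atTop_atTop.comp hN).eventually_ge_atTop ‖A‖
  have h4 := (h3.add h1).max (h3.add h2)
  simp only [add_zero, max_self] at h4
  refine squeeze_zero' (Eventually.of_forall fun k => le_max_of_le_left (norm_nonneg _)) ?_ h4
  filter_upwards [hA] with k hk
  exact max_le_max (norm_rep_sub_mul_proj_le (hn k) hk) (norm_proj_mul_rep_sub_le (hn k) hk)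

theorem norm_one_sub_proj_mul_le {n n' : ℕ} (h : n ≤ n') (B : Op) :
    ‖(1 - proj n') * B‖ ≤ ‖(1 - proj n) * B‖ := by
  have : (1 - proj n') * B = (1 - proj n') * ((1 - proj n) * B) := by
    rw [← mul_assoc]
    congr 1
    rw [mul_sub, sub_mul, sub_mul, proj_mul_of_le h]
    noncomm_ring
  rw [this]
  exact (norm_mul_le _ _).trans (mul_le_of_le_one_left (norm_nonneg _) (norm_one_sub_proj_le n'))

theorem norm_mul_one_sub_proj_le {n n' : ℕ} (h : n ≤ n') (B : Op) :
    ‖B * (1 - proj n')‖ ≤ ‖B * (1 - proj n)‖ := by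
  have : B * (1 - proj n') = (B * (1 - proj n)) * (1 - proj n') := by
    rw [mul_assoc]
    congr 1
    rw [mul_sub, sub_mul, sub_mul, mul_proj_of_le h]
    noncomm_ring
  rw [this]
  exact (norm_mul_le _ _).trans (mul_le_of_le_one_right (norm_nonneg _) (norm_one_sub_proj_le n'))

/-- The dispersion bound makes rows and columns of growing length accessible in one limit. The
maximum with `n` is taken because `f n` may be smaller than `n`. -/
theorem tendsto_rep_of_mem_dispersionClass {A : Op} {f : ℕ → ℕ} (hA : A ∈ dispersionClass f) :
    Tendsto (fun n => max ‖(rep (max (f n) n) A - A) * proj n‖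
      ‖proj n * (rep (max (f n) n) A - A)‖) atTop (𝓝 0) := by
  have hA : Tendsto (fun m => max ‖(1 - proj (f m)) * A * proj m‖
    ‖proj m * A * (1 - proj (f m))‖) atTop (𝓝 0) := hA
  refine tendsto_rep_of_tendsto (n := fun n => n) (fun k => le_max_right _ _)
    (tendsto_atTop_mono (fun k => le_max_right _ _) tendsto_id) ?_ ?_
  · refine squeeze_zero (fun _ => norm_nonneg _) (fun n => ?_) hA
    refine le_max_of_le_left ?_
    rw [mul_assoc, mul_assoc]
    exact norm_one_sub_proj_mul_le (le_max_left _ _) _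
  · refine squeeze_zero (fun _ => norm_nonneg _) (fun n => ?_) hA
    exact le_max_of_le_right (norm_mul_one_sub_proj_le (le_max_left _ _) _)

theorem tendsto_norm_one_sub_proj_mul_mul_proj (A : Op) (n : ℕ) :
    Tendsto (fun k => ‖(1 - proj k) * A * proj n‖) atTop (𝓝 0) := by
  have h : Tendsto (fun k => ∑ i ∈ Finset.range n, ‖(1 - proj k) (A (stdVec i))‖) atTop (𝓝 0) := by
    rw [← Finset.sum_const_zero (s := Finset.range n)]
    refine tendsto_finsetSum _ fun i _ => ?_
    have := (tendsto_const_nhds (x := A (stdVec i))).sub (tendsto_proj_apply (A (stdVec i)))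
    simpa using this.norm
  refine squeeze_zero (fun _ => norm_nonneg _) (fun k => ?_) h
  refine ContinuousLinearMap.opNorm_le_bound _ (Finset.sum_nonneg fun _ _ => norm_nonneg _)
    fun x => ?_
  rw [mul_apply_eq_comp, mul_apply_eq_comp, proj_apply, map_sum, map_sum, Finset.sum_mul]
  refine norm_sum_le_of_le _ fun i _ => ?_
  rw [map_smul, map_smul, norm_smul, mul_comm]
  gcongr
  exact lp.norm_apply_le_norm (by simp) x i

theorem tendsto_norm_proj_mul_mul_one_sub_proj (A : Op) (n : ℕ) :
    Tendsto (fun k => ‖proj n * A * (1 - proj k)‖) atTop (𝓝 0) := by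
  refine (tendsto_norm_one_sub_proj_mul_mul_proj (star A) n).congr fun k => ?_
  rw [← norm_star, star_mul, star_mul, star_star, star_sub, star_one,
    (isSelfAdjoint_proj n).star_eq, (isSelfAdjoint_proj k).star_eq, mul_assoc]

/-- Without a dispersion bound, `n` must stay fixed while the size of the section tends to infinity;
this is the source of the additional limit. -/
theorem tendsto_rep_mul_proj (A : Op) (n : ℕ) :
    Tendsto (fun k => max ‖(rep (k + n) A - A) * proj n‖ ‖proj n * (rep (k + n) A - A)‖)
      atTop (𝓝 0) := by
  have hN := tendsto_add_atTop_nat n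
  exact tendsto_rep_of_tendsto (n := fun _ => n) (fun k => by simp) hN
    ((tendsto_norm_one_sub_proj_mul_mul_proj A n).comp hN)
    ((tendsto_norm_proj_mul_mul_one_sub_proj A n).comp hN)

end SolvIndex

namespace SolvIndex

/-! ### A criterion for Fredholm operators -/

theorem mem_unitVecsFrom_smul {m : ℕ} {y : ℓ²(ℕ, ℂ)} (hy : y ≠ 0) (h : ∀ i < m, y i = 0) :
    ((‖y‖⁻¹ : ℝ) : ℂ) • y ∈ unitVecsFrom m := by
  refine ⟨?_, fun i hi => ?_⟩
  · rw [norm_smul, Complex.norm_real, norm_inv, norm_norm, inv_mul_cancel₀ (norm_ne_zero_iff.mpr hy)]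
  · rw [lp.coeFn_smul, Pi.smul_apply, h i hi, smul_zero]

theorem mul_norm_le_of_unitVecsFrom {u : Op} {m : ℕ} {c : ℝ} (h : ∀ x ∈ unitVecsFrom m, c ≤ ‖u x‖)
    {y : ℓ²(ℕ, ℂ)} (hy : ∀ i < m, y i = 0) : c * ‖y‖ ≤ ‖u y‖ := by
  rcases eq_or_ne y 0 with rfl | hne
  · simp
  have h1 := h _ (mem_unitVecsFrom_smul hne hy)
  have hpos : 0 < ‖y‖ := norm_pos_iff.mpr hne
  rw [map_smul, norm_smul, Complex.norm_real, norm_inv, norm_norm] at h1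
  rwa [← le_div_iff₀ hpos, div_eq_inv_mul]

theorem isUnit_star_mul_self_add_proj {u : Op} {m : ℕ} {c : ℝ} (hc : 0 < c)
    (h : ∀ x ∈ unitVecsFrom m, c ≤ ‖u x‖) : IsUnit (star u * u + proj m) := by
  -- The quadratic form of u*u + P is ‖ux‖² + ‖Px‖². Splitting x = (1 - P)x + Px gives c‖x‖ ≤ K(‖ux‖
  -- + ‖Px‖), and (a + b)² ≤ 2(a² + b²) then yields the constant c²/(2K²).
  set K : ℝ := c + ‖u‖ + 1 with hK
  have hKpos : 0 < K := by positivity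
  refine ContinuousLinearMap.isUnit_of_forall_le_norm_inner_map _
    (c := (c ^ 2 / (2 * K ^ 2)).toNNReal) (Real.toNNReal_pos.mpr (by positivity)) fun x => ?_
  rw [Real.coe_toNNReal _ (by positivity)]
  have hPP : ∀ y, inner ℂ (proj m y) y = ((‖proj m y‖ ^ 2 : ℝ) : ℂ) := fun y => by
    have h1 : proj m y = proj m (proj m y) := by
      rw [← mul_apply_eq_comp, proj_mul_proj, min_self]
    have h2 := (ContinuousLinearMap.isSelfAdjoint_iff_isSymmetric.mp (isSelfAdjoint_proj m))
      (proj m y) y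
    simp only [ContinuousLinearMap.coe_coe] at h2
    rw [← h1] at h2
    rw [h2, inner_self_eq_norm_sq_to_K]
    norm_cast
  have hinner : inner ℂ ((star u * u + proj m) x) x
      = ((‖u x‖ ^ 2 + ‖proj m x‖ ^ 2 : ℝ) : ℂ) := by
    rw [add_apply, inner_add_left, hPP, mul_apply_eq_comp, ContinuousLinearMap.star_eq_adjoint,
      ContinuousLinearMap.adjoint_inner_left, inner_self_eq_norm_sq_to_K]
    simp
  rw [hinner, Complex.norm_real, Real.norm_of_nonneg (by positivity)]
  have h1 : c * ‖(1 - proj m) x‖ ≤ ‖u ((1 - proj m) x)‖ :=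
    mul_norm_le_of_unitVecsFrom h fun i hi => by rw [one_sub_proj_apply_apply, if_pos hi]
  have hsplit : (1 - proj m) x = x - proj m x := by simp
  have h2 : ‖u ((1 - proj m) x)‖ ≤ ‖u x‖ + ‖u‖ * ‖proj m x‖ := by
    rw [hsplit, map_sub]
    exact (norm_sub_le _ _).trans (add_le_add_right (u.le_opNorm _) _)
  have h3 : ‖x‖ ≤ ‖(1 - proj m) x‖ + ‖proj m x‖ := by
    rw [hsplit]
    simpa using norm_add_le (x - proj m x) (proj m x)
  have h4 : c * ‖x‖ ≤ K * (‖u x‖ + ‖proj m x‖) := by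
    have e1 := mul_le_mul_of_nonneg_left h3 hc.le
    have e2 : 0 ≤ (c + ‖u‖) * ‖u x‖ := by positivity
    have e3 := norm_nonneg (proj m x)
    rw [hK]
    nlinarith
  have h5 : (c * ‖x‖) ^ 2 ≤ (K * (‖u x‖ + ‖proj m x‖)) ^ 2 :=
    pow_le_pow_left₀ (by positivity) h4 2
  rw [mul_div_assoc', div_le_iff₀ (by positivity)]
  nlinarith [mul_nonneg (sq_nonneg K) (sq_nonneg (‖u x‖ - ‖proj m x‖))]

theorem hasNoetherianRange_proj (m : ℕ) : (proj m).toLinearMap.HasNoetherianRange := by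
  have : FiniteDimensional ℂ (Submodule.span ℂ (stdVec '' (Finset.range m : Set ℕ))) :=
    FiniteDimensional.span_of_finite ℂ ((Finset.finite_toSet _).image _)
  rw [LinearMap.hasNoetherianRange_iff_range]
  refine isNoetherian_of_le (t := Submodule.span ℂ (stdVec '' (Finset.range m : Set ℕ))) ?_
  rintro _ ⟨x, rfl⟩
  rw [ContinuousLinearMap.coe_coe, proj_apply]
  exact Submodule.sum_mem _ fun i hi =>
    Submodule.smul_mem _ _ (Submodule.subset_span ⟨i, hi, rfl⟩)

open LinearMap.FiniteRangeSetoid in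
theorem isFredholm_of_mul_sub_one {u v : Op} (h1 : (v * u - 1).toLinearMap.HasNoetherianRange)
    (h2 : (u * v - 1).toLinearMap.HasNoetherianRange) : u.IsFredholm :=
  ContinuousLinearMap.IsFredholm.of_isQuasiInverse (v := v)
    ⟨equiv_iff_hasNoetherianRange.mpr h1, equiv_iff_hasNoetherianRange.mpr h2⟩

open LinearMap.FiniteRangeSetoid in
theorem exists_mul_sub_one_of_isFredholm {u : Op} (h : u.IsFredholm) :
    ∃ v : Op, (v * u - 1).toLinearMap.HasNoetherianRange ∧
      (u * v - 1).toLinearMap.HasNoetherianRange := by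
  obtain ⟨v, hv⟩ := h.exists_isQuasiInverse
  exact ⟨v, equiv_iff_hasNoetherianRange.mp hv.1, equiv_iff_hasNoetherianRange.mp hv.2⟩

/-- Both u*u + P and uu* + P are invertible, with P of finite rank. This provides a left and a right
inverse of u modulo finite rank operators, and any left one is then also a right one. -/
theorem isFredholm_of_forall_unitVecsFrom {u : Op} {m : ℕ} {c : ℝ} (hc : 0 < c)
    (h : ∀ x ∈ unitVecsFrom m, c ≤ ‖u x‖) (h' : ∀ x ∈ unitVecsFrom m, c ≤ ‖star u x‖) :
    u.IsFredholm := by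
  obtain ⟨a, ha⟩ := isUnit_star_mul_self_add_proj hc h
  obtain ⟨b, hb⟩ := isUnit_star_mul_self_add_proj hc h'
  rw [star_star] at hb
  have hP := hasNoetherianRange_proj m
  have e1 : (↑a⁻¹ : Op) * star u * u - 1 = -((↑a⁻¹ : Op) * proj m) := by
    have : (↑a⁻¹ : Op) * (star u * u + proj m) = 1 := by rw [← ha, Units.inv_mul]
    rw [← this]; noncomm_ring
  have e2 : u * (star u * (↑b⁻¹ : Op)) = 1 - proj m * (↑b⁻¹ : Op) := by
    have : (u * star u + proj m) * (↑b⁻¹ : Op) = 1 := by rw [← hb, Units.mul_inv]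
    rw [← this]; noncomm_ring
  set v : Op := (↑a⁻¹ : Op) * star u
  set w : Op := star u * (↑b⁻¹ : Op)
  have hG : ((↑a⁻¹ : Op) * proj m).toLinearMap.HasNoetherianRange := hP.comp_left _
  have hF : (proj m * (↑b⁻¹ : Op)).toLinearMap.HasNoetherianRange := hP.comp_right _
  refine isFredholm_of_mul_sub_one (v := v) ?_ ?_
  · rw [e1]
    exact hG.neg
  -- Evaluate u v u w in two ways, using vu = 1 - a⁻¹P and uw = 1 - Pb⁻¹.
  · have e3 : u * v - 1 = u * v * (proj m * (↑b⁻¹ : Op)) - u * ((↑a⁻¹ : Op) * proj m) * w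
        - proj m * (↑b⁻¹ : Op) := by
      have e4 : v * u = 1 - (↑a⁻¹ : Op) * proj m := by
        rw [sub_eq_iff_eq_add.mp e1]; abel
      have e5 : u * v * (u * w) = u * (v * u) * w := by noncomm_ring
      rw [e4, e2] at e5
      have e6 : u * v * (1 - proj m * (↑b⁻¹ : Op)) = u * v - u * v * (proj m * (↑b⁻¹ : Op)) := by
        noncomm_ring
      have e7 : u * (1 - (↑a⁻¹ : Op) * proj m) * w = u * w - u * ((↑a⁻¹ : Op) * proj m) * w := by
        noncomm_ring
      rw [e6, e7, e2] at e5
      linear_combination (norm := abel) e5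
    rw [e3]
    exact ((hF.comp_left (u * v).toLinearMap).sub
      ((hG.comp_left u.toLinearMap).comp_right w.toLinearMap)).sub hF

/-- In this form strong convergence of the projections becomes norm convergence after multiplication
with a finite rank operator. -/
theorem exists_eq_sum_of_hasNoetherianRange {F : Op} (hF : F.toLinearMap.HasNoetherianRange) :
    ∃ (d : ℕ) (w b : Fin d → ℓ²(ℕ, ℂ)), ∀ x, F x = ∑ i, inner ℂ (w i) x • b i := by
  have : FiniteDimensional ℂ F.toLinearMap.range :=
    IsNoetherian.iff_fg.mp (LinearMap.hasNoetherianRange_iff_range.mp hF)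
  let b := stdOrthonormalBasis ℂ F.toLinearMap.range
  refine ⟨_, fun i => star F (b i), fun i => b i, fun x => ?_⟩
  have h := congrArg Subtype.val (b.sum_repr' ⟨F x, x, rfl⟩)
  simp only [Submodule.coe_sum, Submodule.coe_smul, Submodule.coe_inner] at h
  rw [← h]
  refine Finset.sum_congr rfl fun i _ => ?_
  rw [ContinuousLinearMap.star_eq_adjoint, ContinuousLinearMap.adjoint_inner_left]

theorem tendsto_norm_one_sub_proj_apply (x : ℓ²(ℕ, ℂ)) :
    Tendsto (fun m => ‖(1 - proj m) x‖) atTop (𝓝 0) := by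
  simpa using ((tendsto_const_nhds (x := x)).sub (tendsto_proj_apply x)).norm

theorem tendsto_norm_one_sub_proj_mul {F : Op} (hF : F.toLinearMap.HasNoetherianRange) :
    Tendsto (fun m => ‖(1 - proj m) * F‖) atTop (𝓝 0) := by
  obtain ⟨d, w, b, h⟩ := exists_eq_sum_of_hasNoetherianRange hF
  have hlim : Tendsto (fun m => ∑ i, ‖w i‖ * ‖(1 - proj m) (b i)‖) atTop (𝓝 0) := by
    simpa using tendsto_finsetSum Finset.univ fun i _ =>
      (tendsto_norm_one_sub_proj_apply (b i)).const_mul ‖w i‖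
  refine squeeze_zero (fun _ => norm_nonneg _) (fun m => ?_) hlim
  refine ContinuousLinearMap.opNorm_le_bound _ (Finset.sum_nonneg fun _ _ => by positivity)
    fun x => ?_
  rw [mul_apply_eq_comp, h, map_sum, Finset.sum_mul]
  refine norm_sum_le_of_le _ fun i _ => ?_
  rw [map_smul, norm_smul, mul_right_comm]
  gcongr
  exact norm_inner_le_norm _ _

theorem tendsto_norm_mul_one_sub_proj {F : Op} (hF : F.toLinearMap.HasNoetherianRange) :
    Tendsto (fun m => ‖F * (1 - proj m)‖) atTop (𝓝 0) := by
  obtain ⟨d, w, b, h⟩ := exists_eq_sum_of_hasNoetherianRange hF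
  have hlim : Tendsto (fun m => ∑ i, ‖(1 - proj m) (w i)‖ * ‖b i‖) atTop (𝓝 0) := by
    simpa using tendsto_finsetSum Finset.univ fun i _ =>
      (tendsto_norm_one_sub_proj_apply (w i)).mul_const ‖b i‖
  refine squeeze_zero (fun _ => norm_nonneg _) (fun m => ?_) hlim
  refine ContinuousLinearMap.opNorm_le_bound _ (Finset.sum_nonneg fun _ _ => by positivity)
    fun x => ?_
  rw [mul_apply_eq_comp, h, Finset.sum_mul]
  refine norm_sum_le_of_le _ fun i _ => ?_
  have hs : IsSelfAdjoint (1 - proj m) := (IsSelfAdjoint.one _).sub (isSelfAdjoint_proj m)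
  have hsym := (ContinuousLinearMap.isSelfAdjoint_iff_isSymmetric.mp hs) (w i) x
  simp only [ContinuousLinearMap.coe_coe] at hsym
  rw [norm_smul, ← hsym, mul_right_comm]
  gcongr
  exact norm_inner_le_norm _ _

theorem one_sub_proj_apply_of_mem {m : ℕ} {x : ℓ²(ℕ, ℂ)} (hx : x ∈ unitVecsFrom m) :
    (1 - proj m) x = x := by
  ext i
  rw [one_sub_proj_apply_apply]
  split_ifs with h
  · exact (hx.2 i h).symm
  · rfl

/-- From x = v(ux) - Fx and ‖Fx‖ ≤ 1/2 one gets 1/2 ≤ ‖v‖‖ux‖. The summand 1 in the denominator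
takes care of v = 0. -/
theorem lower_bound_of_left_inverse {u v F : Op} {m : ℕ} (h : v * u - 1 = F)
    (hF : ‖F * (1 - proj m)‖ ≤ 1 / 2) {x : ℓ²(ℕ, ℂ)} (hx : x ∈ unitVecsFrom m) :
    1 / (2 * (‖v‖ + 1)) ≤ ‖u x‖ := by
  have h1 : x = v (u x) - (F * (1 - proj m)) x := by
    rw [mul_apply_eq_comp, one_sub_proj_apply_of_mem hx, ← h]
    simp
  have h2 : ‖x‖ ≤ ‖v‖ * ‖u x‖ + 1 / 2 := by
    conv_lhs => rw [h1]
    refine (norm_sub_le _ _).trans (add_le_add (v.le_opNorm _) ?_)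
    simpa [hx.1] using (F * (1 - proj m)).le_of_opNorm_le hF x
  rw [hx.1] at h2
  rw [div_le_iff₀ (by positivity)]
  nlinarith [norm_nonneg (u x)]

theorem star_sub_smul_one (A : Op) (z : ℂ) : star (A - z • (1 : Op)) = star A - star z • (1 : Op) := by
  rw [star_sub, star_smul, star_one]

theorem lowerAt_eq (A : Op) (z : ℂ) (x : ℓ²(ℕ, ℂ)) :
    lowerAt A z x = min ‖(A - z • (1 : Op)) x‖ ‖star (A - z • (1 : Op)) x‖ := by
  rw [star_sub_smul_one]; rfl

/-- A parametrix has finite rank errors, which are small far out, and this bounds A - z and its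
adjoint below there. Conversely such bounds produce a parametrix. This turns the essential spectrum
into a statement about quantities that can be approximated from the matrix. -/
theorem notMem_essSpectrum_iff {A : Op} {z : ℂ} :
    z ∉ essSpectrum A ↔ ∃ m, 0 < lowerBd (unitVecsFrom m) A z := by
  constructor
  · intro h
    have hfr : (A - z • (1 : Op)).IsFredholm := not_not.mp h
    obtain ⟨v, h1, h2⟩ := exists_mul_sub_one_of_isFredholm hfr
    have e1 := (tendsto_norm_mul_one_sub_proj h1).eventually_le_const (show (0 : ℝ) < 1 / 2 by norm_num)
    have e2 := (tendsto_norm_one_sub_proj_mul h2).eventually_le_const (show (0 : ℝ) < 1 / 2 by norm_num)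
    obtain ⟨m, hm1, hm2⟩ := (e1.and e2).exists
    refine ⟨m, lt_of_lt_of_le (show 0 < 1 / (2 * (‖v‖ + 1)) by positivity) ?_⟩
    refine le_lowerBd (unitVecsFrom_nonempty m) fun x hx => ?_
    rw [lowerAt_eq]
    refine le_min (lower_bound_of_left_inverse rfl hm1 hx) ?_
    rw [← norm_star v]
    refine lower_bound_of_left_inverse (F := star ((A - z • (1 : Op)) * v - 1)) ?_ ?_ hx
    · rw [star_sub ((A - z • (1 : Op)) * v), star_mul, star_one]
    · rwa [← norm_star, star_mul, star_star, star_sub, star_one, (isSelfAdjoint_proj m).star_eq]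
  · rintro ⟨m, hm⟩ h
    refine h (isFredholm_of_forall_unitVecsFrom (m := m) hm (fun x hx => ?_) fun x hx => ?_)
    · have := lowerBd_le hx (B := A) (z := z)
      rw [lowerAt_eq] at this
      exact this.trans (min_le_left _ _)
    · have := lowerBd_le hx (B := A) (z := z)
      rw [lowerAt_eq] at this
      exact this.trans (min_le_right _ _)

/-- For m = 0 the finite rank correction vanishes: a positive bound makes u*u and uu* invertible,
hence u. -/
theorem lowerBd_eq_zero_of_mem_spectrum {A : Op} {z : ℂ} (hz : z ∈ spectrum ℂ A) :
    lowerBd (unitVecsFrom 0) A z = 0 := by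
  by_contra hne
  have hpos := lt_of_le_of_ne (lowerBd_nonneg (unitVecsFrom 0) A z) (Ne.symm hne)
  set u : Op := A - z • (1 : Op) with hu
  have hle : ∀ x ∈ unitVecsFrom 0, lowerBd (unitVecsFrom 0) A z ≤ min ‖u x‖ ‖star u x‖ :=
    fun x hx => by
      have := lowerBd_le hx (B := A) (z := z)
      rwa [lowerAt_eq] at this
  have h1 := isUnit_star_mul_self_add_proj hpos fun x hx => (hle x hx).trans (min_le_left _ _)
  have h2 := isUnit_star_mul_self_add_proj hpos fun x hx => (hle x hx).trans (min_le_right _ _)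
  rw [star_star] at h2
  rw [proj_zero, add_zero] at h1 h2
  obtain ⟨a, ha⟩ := h1
  obtain ⟨b, hb⟩ := h2
  have hunit : IsUnit u := isUnit_iff_exists_and_exists.mpr
    ⟨⟨star u * (↑b⁻¹ : Op), by rw [← mul_assoc, ← hb, Units.mul_inv]⟩,
      ⟨(↑a⁻¹ : Op) * star u, by rw [mul_assoc, ← ha, Units.inv_mul]⟩⟩
  rw [spectrum.mem_iff] at hz
  apply hz
  have := hunit.neg
  rwa [hu, neg_sub, ← Algebra.algebraMap_eq_smul_one] at this

theorem inv_norm_resolvent_le_lowerBd (A : Op) (z : ℂ) :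
    ‖resolvent A z‖⁻¹ ≤ lowerBd (unitVecsFrom 0) A z := by
  by_cases hz : z ∈ spectrum ℂ A
  · have : resolvent A z = 0 := Ring.inverse_non_unit _ (spectrum.mem_iff.mp hz)
    rw [this, norm_zero, inv_zero]
    exact lowerBd_nonneg _ _ _
  have hunit : IsUnit (algebraMap ℂ Op z - A) := spectrum.notMem_iff.mp hz
  have h1 : resolvent A z * (A - z • (1 : Op)) = -1 := by
    rw [← neg_sub, mul_neg, ← Algebra.algebraMap_eq_smul_one, resolvent,
      Ring.inverse_mul_cancel _ hunit]
  have h2 : star (resolvent A z) * star (A - z • (1 : Op)) = -1 := by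
    rw [← star_mul, ← neg_sub, ← Algebra.algebraMap_eq_smul_one, resolvent, neg_mul,
      Ring.mul_inverse_cancel _ hunit, star_neg, star_one]
  have key : ∀ {r w : Op} {x : ℓ²(ℕ, ℂ)}, r * w = -1 → ‖x‖ = 1 → ‖r‖⁻¹ ≤ ‖w x‖ := by
    intro r w x hrw hx
    have h3 : r (w x) = -x := by
      rw [← mul_apply_eq_comp, hrw]; rfl
    have h4 : 1 ≤ ‖r‖ * ‖w x‖ := by
      rw [← hx, ← norm_neg x, ← h3]; exact r.le_opNorm _
    have h5 : 0 < ‖r‖ := by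
      by_contra! hr
      nlinarith [norm_nonneg (w x), norm_nonneg r]
    rwa [inv_le_iff_one_le_mul₀' h5]
  refine le_lowerBd (unitVecsFrom_nonempty 0) fun x hx => ?_
  rw [lowerAt_eq]
  refine le_min (key h1 hx.1) ?_
  rw [← norm_star (resolvent A z)]
  exact key h2 hx.1

end SolvIndex

/-! ### Stable decisions on grids, and towers for the essential spectrum -/

namespace SolvIndex

/-! ### Decisions with hysteresis -/

/-- A decision between `a n ≤ c` and `d ≤ a n`, which is not changed while `a n` is between
`c` and `d`. -/
def hyst (c d : ℝ) (a : ℕ → ℝ) : ℕ → Prop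
  | 0 => a 0 ≤ c
  | n + 1 => a (n + 1) ≤ c ∨ (a (n + 1) < d ∧ hyst c d a n)

/-- The eventual decision. -/
def hystLim (c d : ℝ) (a : ℕ → ℝ) : Prop := ∀ᶠ n in atTop, hyst c d a n

theorem hyst_congr {c d : ℝ} {a b : ℕ → ℝ} {n : ℕ} (h : ∀ k ≤ n, a k = b k) :
    hyst c d a n ↔ hyst c d b n := by
  induction n with
  | zero => simp [hyst, h 0 le_rfl]
  | succ n ih => simp only [hyst, h (n + 1) le_rfl, ih fun k hk => h k (hk.trans n.le_succ)]

theorem hyst_of_le {c d : ℝ} {a : ℕ → ℝ} {n : ℕ} (h : a n ≤ c) : hyst c d a n := by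
  cases n with
  | zero => exact h
  | succ n => exact Or.inl h

theorem lt_of_hyst {c d : ℝ} (hcd : c < d) {a : ℕ → ℝ} {n : ℕ} (h : hyst c d a n) : a n < d := by
  cases n with
  | zero => exact lt_of_le_of_lt h hcd
  | succ n => exact h.elim (fun h => lt_of_le_of_lt h hcd) fun h => h.1

theorem eventually_or_eventually_not_of_mono {p : ℕ → Prop} {N : ℕ}
    (h : ∀ n ≥ N, p n → p (n + 1)) : (∀ᶠ n in atTop, p n) ∨ ∀ᶠ n in atTop, ¬ p n := by
  by_cases hex : ∃ n ≥ N, p n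
  · obtain ⟨n, hn, hp⟩ := hex
    refine Or.inl (eventually_atTop.mpr ⟨n, fun k hk => ?_⟩)
    induction hk with
    | refl => exact hp
    | step hk ih => exact h _ (hn.trans hk) ih
  · push Not at hex
    exact Or.inr (eventually_atTop.mpr ⟨N, hex⟩)

/-- If α < d, a positive decision is eventually never revoked; if α ≥ d > c, a negative one is not.
So the decision stabilises in both cases, and between c and d either result is acceptable. -/
theorem hystLim_spec {c d : ℝ} (hcd : c < d) {a : ℕ → ℝ} {α : ℝ} (ha : Tendsto a atTop (𝓝 α)) :
    (∀ᶠ n in atTop, (hyst c d a n ↔ hystLim c d a)) ∧ (hystLim c d a → α ≤ d) ∧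
      (¬ hystLim c d a → c ≤ α) := by
  have hor : (∀ᶠ n in atTop, hyst c d a n) ∨ ∀ᶠ n in atTop, ¬ hyst c d a n := by
    rcases lt_or_ge α d with h | h
    · obtain ⟨N, hN⟩ := eventually_atTop.mp (ha.eventually_lt_const h)
      exact eventually_or_eventually_not_of_mono (N := N) fun n hn hp =>
        Or.inr ⟨hN (n + 1) (by omega), hp⟩
    · obtain ⟨N, hN⟩ := eventually_atTop.mp (ha.eventually_const_lt (hcd.trans_le h))
      have := eventually_or_eventually_not_of_mono (N := N) (p := fun n => ¬ hyst c d a n)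
        fun n hn hp hp' => hp'.elim (fun h' => (hN (n + 1) (by omega)).not_ge h') fun h' => hp h'.2
      simpa [or_comm] using this
  rcases hor with h | h
  · have hl : hystLim c d a := h
    refine ⟨h.mono fun n hn => iff_of_true hn hl, fun _ => ?_, fun hn => absurd hl hn⟩
    exact le_of_tendsto ha (h.mono fun n hn => (lt_of_hyst hcd hn).le)
  · have hl : ¬ hystLim c d a := fun hl => by
      obtain ⟨n, h1, h2⟩ := (h.and hl).exists
      exact h1 h2
    refine ⟨h.mono fun n hn => iff_of_false hn hl, fun hl' => absurd hl' hl, fun _ => ?_⟩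
    exact ge_of_tendsto ha (h.mono fun n hn => (not_le.mp fun h' => hn (hyst_of_le h')).le)

/-! ### Finite grids -/

/-- The points of the lattice `ℤ[i] / (m + 1)` whose coordinates are at most `m + 1`. -/
def grid (m : ℕ) : Set ℂ :=
  (fun p : ℤ × ℤ => ((p.1 : ℂ) + p.2 * Complex.I) / (m + 1)) ''
    (Set.Icc (-((m : ℤ) + 1) ^ 2) (((m : ℤ) + 1) ^ 2) ×ˢ
      Set.Icc (-((m : ℤ) + 1) ^ 2) (((m : ℤ) + 1) ^ 2))

theorem grid_finite (m : ℕ) : (grid m).Finite :=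
  ((Set.finite_Icc _ _).prod (Set.finite_Icc _ _)).image _

/-- Rounding each coordinate moves it by at most half a mesh width, so the sum of both errors is at
most one mesh width. -/
theorem exists_grid_dist_le {m : ℕ} {z : ℂ} (hz : ‖z‖ ≤ m) :
    ∃ w ∈ grid m, ‖w - z‖ ≤ 1 / ((m : ℝ) + 1) := by
  have hm : (0 : ℝ) < (m : ℝ) + 1 := by positivity
  have hround : ∀ t : ℝ, |t| ≤ m → round (t * (m + 1)) ∈
      Set.Icc (-((m : ℤ) + 1) ^ 2) (((m : ℤ) + 1) ^ 2) := by
    intro t ht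
    obtain ⟨h1, h2⟩ := abs_le.mp ht
    obtain ⟨h3, h4⟩ := abs_le.mp (abs_sub_round (t * (m + 1)))
    constructor
    · have : (((-((m : ℤ) + 1) ^ 2 : ℤ)) : ℝ) ≤ round (t * (m + 1)) := by push_cast; nlinarith
      exact_mod_cast this
    · have : (round (t * (m + 1)) : ℝ) ≤ ((((m : ℤ) + 1) ^ 2 : ℤ) : ℝ) := by push_cast; nlinarith
      exact_mod_cast this
  refine ⟨_, ⟨(round (z.re * (m + 1)), round (z.im * (m + 1))),
    ⟨hround _ ((Complex.abs_re_le_norm z).trans hz),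
      hround _ ((Complex.abs_im_le_norm z).trans hz)⟩, rfl⟩, ?_⟩
  have hm' : ((m : ℂ) + 1) ≠ 0 := by exact_mod_cast hm.ne'
  have hnorm : ‖((m : ℂ) + 1)‖ = (m : ℝ) + 1 := by
    rw [← Complex.ofReal_natCast, ← Complex.ofReal_one, ← Complex.ofReal_add, Complex.norm_real,
      Real.norm_of_nonneg hm.le]
  rw [div_sub' hm', norm_div, hnorm]
  refine div_le_div_of_nonneg_right ?_ hm.le
  refine (Complex.norm_le_abs_re_add_abs_im _).trans ?_
  have e1 := abs_sub_round (z.re * (m + 1))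
  have e2 := abs_sub_round (z.im * (m + 1))
  rw [abs_sub_comm] at e1 e2
  simp only [Complex.sub_re, Complex.sub_im, Complex.add_re, Complex.add_im, Complex.mul_re,
    Complex.mul_im, Complex.intCast_re, Complex.intCast_im, Complex.I_re, Complex.I_im,
    Complex.natCast_re, Complex.natCast_im, Complex.one_re, Complex.one_im]
  ring_nf at e1 e2 ⊢
  linarith

-- The hypotheses also cover an empty limit: then `K n` is eventually empty.
open TopologicalSpace in
theorem tendsto_compacts {K : ℕ → Compacts ℂ} {L : Compacts ℂ}
    (h1 : ∀ ε > 0, ∀ᶠ n in atTop, ∀ z ∈ K n, ∃ w ∈ L, dist z w < ε)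
    (h2 : ∀ ε > 0, ∀ᶠ n in atTop, ∀ z ∈ L, ∃ w ∈ K n, dist z w < ε) :
    Tendsto K atTop (𝓝 L) := by
  rw [EMetric.tendsto_nhds]
  intro ε hε
  obtain ⟨δ, hδ, hδε⟩ := ENNReal.lt_iff_exists_real_btwn.mp hε
  have hδ0 : 0 < δ := ENNReal.ofReal_pos.mp hδε.1
  filter_upwards [h1 δ hδ0, h2 δ hδ0] with n hn1 hn2
  refine lt_of_le_of_lt ?_ hδε.2
  rw [Compacts.edist_eq]
  refine Metric.hausdorffEDist_le_of_mem_edist (fun z hz => ?_) fun z hz => ?_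
  · obtain ⟨w, hw, hzw⟩ := hn1 z hz
    exact ⟨w, hw, by rw [edist_dist]; exact ENNReal.ofReal_le_ofReal hzw.le⟩
  · obtain ⟨w, hw, hzw⟩ := hn2 z hz
    exact ⟨w, hw, by rw [edist_dist]; exact ENNReal.ofReal_le_ofReal hzw.le⟩

open TopologicalSpace in
/-- The set of those grid points which satisfy `p`. -/
def gridSet (m : ℕ) (p : ℂ → Prop) : Compacts ℂ :=
  ⟨{z ∈ grid m | p z}, ((grid_finite m).subset (Set.sep_subset _ _)).isCompact⟩

theorem gridSet_congr {m : ℕ} {p q : ℂ → Prop} (h : ∀ z ∈ grid m, (p z ↔ q z)) :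
    gridSet m p = gridSet m q := by
  ext z
  exact and_congr_right fun hz => h z hz

theorem tendsto_gridSet {m : ℕ} {p : ℕ → ℂ → Prop} {q : ℂ → Prop}
    (h : ∀ z, ∀ᶠ n in atTop, (p n z ↔ q z)) :
    Tendsto (fun n => gridSet m (p n)) atTop (𝓝 (gridSet m q)) := by
  have : ∀ᶠ n in atTop, ∀ z ∈ grid m, (p n z ↔ q z) :=
    (eventually_all_finite (grid_finite m)).mpr fun z _ => h z
  exact tendsto_const_nhds.congr' (this.mono fun n hn => (gridSet_congr hn).symm)

/-! ### Approximation of the essential spectrum -/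

theorem monotone_lowerBd_from (A : Op) (z : ℂ) :
    Monotone fun m => lowerBd (unitVecsFrom m) A z :=
  fun _ _ h => lowerBd_anti (unitVecsFrom_nonempty _) (unitVecsFrom_anti h) A z

theorem lowerBd_from_eq_zero_of_mem {A : Op} {z : ℂ} (hz : z ∈ essSpectrum A) (m : ℕ) :
    lowerBd (unitVecsFrom m) A z = 0 := by
  by_contra hne
  exact notMem_essSpectrum_iff.mpr
    ⟨m, lt_of_le_of_ne (lowerBd_nonneg _ _ _) (Ne.symm hne)⟩ hz

theorem continuous_lowerBd_from (m : ℕ) (A : Op) : Continuous (lowerBd (unitVecsFrom m) A) :=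
  continuous_lowerBd (unitVecsFrom_nonempty m) (fun _ hx => hx.1) A

/-- The parts of the sublevel sets outside the ε-neighbourhood form a decreasing sequence of compact
sets. A common point would have all its lower bounds equal to zero and so belong to the essential
spectrum; hence one of these sets is empty. -/
theorem eventually_sublevel_subset_thickening (A : Op) {ε : ℝ} (hε : 0 < ε) :
    ∀ᶠ m : ℕ in atTop, ∀ z, lowerBd (unitVecsFrom m) A z ≤ 3 / ((m : ℝ) + 1) →
      ∃ w ∈ essSpectrum A, dist z w < ε := by
  set C : ℕ → Set ℂ := fun m =>
    {z | lowerBd (unitVecsFrom m) A z ≤ 3 / ((m : ℝ) + 1)} \ Metric.thickening ε (essSpectrum A)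
    with hC
  have hclosed : ∀ m, IsClosed (C m) := fun m =>
    (isClosed_le (continuous_lowerBd_from m A) continuous_const).sdiff Metric.isOpen_thickening
  have hanti : ∀ m n, m ≤ n → C n ⊆ C m := by
    rintro m n hmn z ⟨h1, h2⟩
    refine ⟨(monotone_lowerBd_from A z hmn).trans (le_trans h1 ?_), h2⟩
    have : (m : ℝ) ≤ n := by exact_mod_cast hmn
    gcongr
  have hbdd : C 0 ⊆ Metric.closedBall 0 (‖A‖ + 3) := by
    rintro z ⟨h1, -⟩
    have h1 : lowerBd (unitVecsFrom 0) A z ≤ 3 / (((0 : ℕ) : ℝ) + 1) := h1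
    have h3 := norm_sub_norm_le_lowerBd (unitVecsFrom_nonempty 0) (fun _ hx => hx.1) A z
    rw [mem_closedBall_zero_iff]
    norm_num at h1
    linarith
  have hex : ∃ m, C m = ∅ := by
    by_contra! hne
    obtain ⟨z, hz⟩ := IsCompact.nonempty_iInter_of_sequence_nonempty_isCompact_isClosed C
      (fun n => hanti n (n + 1) n.le_succ) hne
      ((isCompact_closedBall _ _).of_isClosed_subset (hclosed 0) hbdd) hclosed
    rw [Set.mem_iInter] at hz
    refine (hz 0).2 (Metric.self_subset_thickening hε _ ?_)
    by_contra hess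
    obtain ⟨m, hm⟩ := notMem_essSpectrum_iff.mp hess
    have hlim : Tendsto (fun n : ℕ => 3 / ((n : ℝ) + 1)) atTop (𝓝 0) := by
      simpa using (tendsto_one_div_add_atTop_nhds_zero_nat (𝕜 := ℝ)).const_mul 3 |>.congr
        fun n => by ring
    obtain ⟨n, h1, h2⟩ := ((hlim.eventually_lt_const hm).and (eventually_ge_atTop m)).exists
    exact absurd ((monotone_lowerBd_from A z h2).trans (hz n).1) (not_le.mpr h1)
  obtain ⟨m, hm⟩ := hex
  refine eventually_atTop.mpr ⟨m, fun n hn z hz => ?_⟩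
  by_contra hcon
  have : z ∈ C n := ⟨hz, fun h => hcon (Metric.mem_thickening_iff.mp h)⟩
  have := hanti m n hn this
  rw [hm] at this
  exact this

/-- A grid point within 1/(m+1) of the essential spectrum has lower bound at most 1/(m+1) and is
accepted, since rejection requires 2/(m+1). The larger constant 3 leaves the gap in which the
decision is free. -/
theorem tendsto_gridSet_essSpec {A : Op} {p : ℕ → ℂ → Prop}
    (h1 : ∀ m z, p m z → lowerBd (unitVecsFrom m) A z ≤ 3 / ((m : ℝ) + 1))
    (h2 : ∀ m z, ¬ p m z → 2 / ((m : ℝ) + 1) ≤ lowerBd (unitVecsFrom m) A z) :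
    Tendsto (fun m => gridSet m (p m)) atTop (𝓝 (essSpec A)) := by
  refine tendsto_compacts (fun ε hε => ?_) fun ε hε => ?_
  · filter_upwards [eventually_sublevel_subset_thickening A hε] with m hm z hz
    exact hm z (h1 m z hz.2)
  · obtain ⟨R, hR⟩ := (essSpec A).isCompact.isBounded.exists_norm_le
    filter_upwards [tendsto_natCast_atTop_atTop.eventually_ge_atTop R,
      (tendsto_one_div_add_atTop_nhds_zero_nat (𝕜 := ℝ)).eventually_lt_const hε] with m hm hm' z hz
    obtain ⟨w, hw, hwz⟩ := exists_grid_dist_le ((hR z hz).trans hm)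
    refine ⟨w, ⟨hw, ?_⟩, by rw [dist_comm, dist_eq_norm]; exact hwz.trans_lt hm'⟩
    by_contra hp
    have e1 := h2 m w hp
    have e2 := lowerBd_le_add_norm_sub (unitVecsFrom_nonempty m) (fun _ hx => hx.1) A w z
    rw [lowerBd_from_eq_zero_of_mem hz] at e2
    have e3 : (2 : ℝ) / ((m : ℝ) + 1) = 1 / ((m : ℝ) + 1) + 1 / ((m : ℝ) + 1) := by ring
    have e4 : (0 : ℝ) < 1 / ((m : ℝ) + 1) := by positivity
    linarith

theorem tendsto_lowerBd_of_approx {m n : ℕ} {A : Op} {B : ℕ → Op} (hmn : m < n)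
    (h : Tendsto (fun k => max ‖(B k - A) * proj n‖ ‖proj n * (B k - A)‖) atTop (𝓝 0)) (z : ℂ) :
    Tendsto (fun k => lowerBd (unitVecs m n) (B k) z) atTop (𝓝 (lowerBd (unitVecs m n) A z)) := by
  rw [tendsto_iff_norm_sub_tendsto_zero]
  exact squeeze_zero (fun _ => norm_nonneg _) (fun _ => abs_lowerBd_sub_le hmn (le_max_left _ _)
    (le_max_right _ _) z) h

/-! ### Arithmetic towers for the essential spectrum -/

theorem determined_of_rep {α : Type*} {F : Op → α} (r : ℕ → ℕ) (n : ℕ)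
    (h : ∀ A B, (∀ k ≤ n, rep (r k) A = rep (r k) B) → F A = F B) :
    Determined ((Finset.range (n + 1)).sup r) F :=
  fun A B hAB => h A B fun _ hk =>
    (hAB _ (Finset.le_sup (f := r) (Finset.mem_range.mpr (Nat.lt_succ_of_le hk)))).rep_eq

theorem two_div_lt_three_div (m : ℕ) : 2 / ((m : ℝ) + 1) < 3 / ((m : ℝ) + 1) := by
  gcongr; norm_num

theorem hasTower_essSpec_dispersion {f : ℕ → ℕ} {Ω : Set Op} {Λ : Set (Op → ℂ)}
    (hΩ : Ω ⊆ dispersionClass f) (hΛ : entries ⊆ Λ) :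
    HasTower (IsArithmeticAlgorithm (restr Ω Λ)) (fun A : Ω => essSpec A) 2 := by
  let r (m n : ℕ) : ℕ := max (f (m + 1 + n)) (m + 1 + n)
  let a (A : Op) (m : ℕ) (z : ℂ) (n : ℕ) : ℝ := lowerBd (unitVecs m (m + 1 + n)) (rep (r m n) A) z
  let c (m : ℕ) : ℝ := 2 / ((m : ℝ) + 1)
  let d (m : ℕ) : ℝ := 3 / ((m : ℝ) + 1)
  have hcd : ∀ m, c m < d m := two_div_lt_three_div
  have hlim : ∀ A ∈ Ω, ∀ m z, Tendsto (a A m z) atTop (𝓝 (lowerBd (unitVecsFrom m) A z)) := by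
    -- One limit suffices for the infimum over [m, ∞), because the supports and the sections can
    -- grow simultaneously.
    intro A hA m z
    have h1 := (tendsto_rep_of_mem_dispersionClass (hΩ hA)).comp
      ((tendsto_add_atTop_nat (m + 1)).congr fun n => add_comm n (m + 1))
    have h2 : Tendsto (fun n => a A m z n - lowerBd (unitVecs m (m + 1 + n)) A z) atTop (𝓝 0) :=
      squeeze_zero_norm (fun n => abs_lowerBd_sub_le (by omega) (le_max_left _ _)
        (le_max_right _ _) z) h1
    simpa using h2.add (tendsto_lowerBd_unitVecs m A z)
  refine hasTower_of_determined (k := 1) (fun l A => match l with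
    | [] => essSpec A
    | [m] => gridSet m fun z => hystLim (c m) (d m) (a A m z)
    | m :: n :: _ => gridSet m fun z => hyst (c m) (d m) (a A m z) n) hΛ (fun _ _ => rfl) ?_ ?_
  · rintro (_ | ⟨m, _ | ⟨n, l⟩⟩) hl A hA
    · exact tendsto_gridSet_essSpec (fun m z h => (hystLim_spec (hcd m) (hlim A hA m z)).2.1 h)
        fun m z h => (hystLim_spec (hcd m) (hlim A hA m z)).2.2 h
    · exact tendsto_gridSet fun z => (hystLim_spec (hcd m) (hlim A hA m z)).1
    · simp at hl
  · rintro (_ | ⟨m, _ | ⟨n, l⟩⟩) hl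
    · simp at hl
    · simp at hl
    · refine ⟨_, determined_of_rep (r m) n fun A B hAB => gridSet_congr fun z _ => ?_⟩
      exact hyst_congr fun k hk => by simp only [a, hAB k hk]

theorem hasTower_essSpec {Ω : Set Op} {Λ : Set (Op → ℂ)} (hΛ : entries ⊆ Λ) :
    HasTower (IsArithmeticAlgorithm (restr Ω Λ)) (fun A : Ω => essSpec A) 3 := by
  let a (A : Op) (m : ℕ) (z : ℂ) (j k : ℕ) : ℝ :=
    lowerBd (unitVecs m (m + 1 + j)) (rep (k + (m + 1 + j)) A) z
  let c (m : ℕ) : ℝ := 2 / ((m : ℝ) + 1)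
  let d (m : ℕ) : ℝ := 3 / ((m : ℝ) + 1)
  have hcd : ∀ m, c m < d m := two_div_lt_three_div
  have hlim : ∀ A m z j, Tendsto (a A m z j) atTop (𝓝 (lowerBd (unitVecs m (m + 1 + j)) A z)) :=
    fun A m z j => tendsto_lowerBd_of_approx (by omega) (tendsto_rep_mul_proj A (m + 1 + j)) z
  -- The infimum over [m, ∞) is the infimum over j of those over [m, m+1+j), so it is small if it is
  -- found small for some j. The bounded quantifier `∃ j ≤ n` is monotone in n and hence stabilises,
  -- while the decisions for individual j need not be monotone.
  refine hasTower_of_determined (k := 2) (fun l A => match l with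
    | [] => essSpec A
    | [m] => gridSet m fun z => ∃ j, hystLim (c m) (d m) (a A m z j)
    | [m, n] => gridSet m fun z => ∃ j ≤ n, hystLim (c m) (d m) (a A m z j)
    | m :: n :: k :: _ => gridSet m fun z => ∃ j ≤ n, hyst (c m) (d m) (a A m z j) k) hΛ
      (fun _ _ => rfl) ?_ ?_
  · rintro (_ | ⟨m, _ | ⟨n, _ | ⟨k, l⟩⟩⟩) hl A hA
    · refine tendsto_gridSet_essSpec (fun m z ⟨j, h⟩ => ?_) fun m z h => ?_
      · exact (lowerBd_from_le m A z j).trans ((hystLim_spec (hcd m) (hlim A m z j)).2.1 h)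
      · push Not at h
        exact ge_of_tendsto' (tendsto_lowerBd_unitVecs m A z) fun j =>
          (hystLim_spec (hcd m) (hlim A m z j)).2.2 (h j)
    · refine tendsto_gridSet fun z => ?_
      by_cases h : ∃ j, hystLim (c m) (d m) (a A m z j)
      · obtain ⟨j, hj⟩ := h
        filter_upwards [eventually_ge_atTop j] with n hn
        exact iff_of_true ⟨j, hn, hj⟩ ⟨j, hj⟩
      · exact Eventually.of_forall fun n =>
          iff_of_false (fun ⟨j, _, hj⟩ => h ⟨j, hj⟩) h
    · refine tendsto_gridSet fun z => ?_
      have : ∀ᶠ k in atTop, ∀ j ∈ Set.Iic n,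
          (hyst (c m) (d m) (a A m z j) k ↔ hystLim (c m) (d m) (a A m z j)) :=
        (eventually_all_finite (Set.finite_Iic n)).mpr fun j _ =>
          (hystLim_spec (hcd m) (hlim A m z j)).1
      filter_upwards [this] with k hk
      exact exists_congr fun j => and_congr_right fun hj => hk j hj
    · simp only [List.length_cons] at hl
      omega
  · rintro (_ | ⟨m, _ | ⟨n, _ | ⟨k, l⟩⟩⟩) hl
    · simp at hl
    · simp at hl
    · simp at hl
    · refine ⟨_, determined_of_rep id (k + (m + 1 + n)) fun A B hAB => gridSet_congr fun z _ => ?_⟩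
      refine exists_congr fun j => and_congr_right fun hj => hyst_congr fun i hi => ?_
      simp only [a]
      rw [show rep (i + (m + 1 + j)) A = rep (i + (m + 1 + j)) B from hAB _ (by omega)]

end SolvIndex

namespace SolvIndex

/-! ### Arithmetic towers for the spectrum -/

instance nontrivial_l2 : Nontrivial ℓ²(ℕ, ℂ) :=
  ⟨stdVec 0, 0, fun h => by simpa [h] using norm_stdVec 0⟩

theorem spectrum_nonempty (A : Op) : (spectrum ℂ A).Nonempty := spectrum.nonempty A

theorem lowerBd_from_zero_le_infDist (A : Op) (z : ℂ) :
    lowerBd (unitVecsFrom 0) A z ≤ Metric.infDist z (spectrum ℂ A) := by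
  refine (Metric.le_infDist (spectrum_nonempty A)).mpr fun {s} hs => ?_
  have := lowerBd_le_add_norm_sub (unitVecsFrom_nonempty 0) (fun _ hx => hx.1) A z s
  rwa [lowerBd_eq_zero_of_mem_spectrum hs, zero_add, ← dist_eq_norm] at this

theorem le_lowerBd_of_mem_resolventClass {A : Op} {g : ℝ≥0 → ℝ≥0} (hA : A ∈ resolventClass g)
    (z : ℂ) : (g (Metric.infNndist z (spectrum ℂ A)) : ℝ) ≤ lowerBd (unitVecsFrom 0) A z :=
  (hA z).trans (inv_norm_resolvent_le_lowerBd A z)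

/-- Dini's theorem: a decreasing sequence of continuous functions with continuous limit converges
uniformly on a disc. -/
theorem eventually_lowerBd_unitVecs_lt (A : Op) (R : ℝ) {ε : ℝ} (hε : 0 < ε) :
    ∀ᶠ n in atTop, ∀ z : ℂ, ‖z‖ ≤ R →
      lowerBd (unitVecs 0 (n + 1)) A z < lowerBd (unitVecsFrom 0) A z + ε := by
  have h : TendstoUniformlyOn (fun n z => lowerBd (unitVecs 0 (0 + 1 + n)) A z)
      (lowerBd (unitVecsFrom 0) A) atTop (Metric.closedBall 0 R) :=
    Antitone.tendstoUniformlyOn_of_forall_tendsto (isCompact_closedBall _ _)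
      (fun n => (continuous_lowerBd (unitVecs_nonempty (by omega)) (fun _ hx => hx.1) A).continuousOn)
      (fun z _ => antitone_lowerBd_unitVecs 0 A z) (continuous_lowerBd_from 0 A).continuousOn
      fun z _ => tendsto_lowerBd_unitVecs 0 A z
  filter_upwards [Metric.tendstoUniformlyOn_iff.mp h ε hε] with n hn z hz
  have := hn z (by simpa using hz)
  rw [show n + 1 = 0 + 1 + n by ring]
  rw [Real.dist_eq, abs_sub_comm] at this
  linarith [le_abs_self (lowerBd (unitVecs 0 (0 + 1 + n)) A z - lowerBd (unitVecsFrom 0) A z)]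

/-- As `g` need not be monotone, smallness of `g t` forces smallness of `t` by compactness: `g` has
a positive minimum on [ε, T] and is at least 1 beyond T. -/
theorem exists_pos_forall_lt_of_lt {g : ℝ≥0 → ℝ≥0} (hg : Continuous g)
    (hg_zero : ∀ x, g x = 0 ↔ x = 0) (hg_top : Tendsto g atTop atTop) {ε : ℝ≥0} (hε : 0 < ε) :
    ∃ δ > 0, ∀ t, g t < δ → t < ε := by
  obtain ⟨T, hT⟩ := eventually_atTop.mp (hg_top.eventually_ge_atTop 1)
  rcases (Set.Icc ε T).eq_empty_or_nonempty with he | hne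
  · refine ⟨1, one_pos, fun t ht => ?_⟩
    by_contra! hle
    have hTt : T ≤ t := by
      by_contra! h
      exact Set.notMem_empty t (he ▸ ⟨hle, h.le⟩)
    exact (hT t hTt).not_gt ht
  · obtain ⟨x, hx, hmin⟩ := isCompact_Icc.exists_isMinOn hne hg.continuousOn
    have hgx : 0 < g x := pos_iff_ne_zero.mpr fun h =>
      (hε.trans_le hx.1).ne' ((hg_zero x).mp h)
    refine ⟨min 1 (g x), lt_min one_pos hgx, fun t ht => ?_⟩
    by_contra! hle
    rcases le_total t T with h | h
    · exact (hmin ⟨hle, h⟩).not_gt (ht.trans_le (min_le_right _ _))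
    · exact (hT t h).not_gt (ht.trans_le (min_le_left _ _))

/-- On the disc of radius `k` the lower bounds of `B` on the unit vectors supported in `[0, n]`
are up to `1 / (k + 1)` those of an operator with spectrum `Z`. -/
structure Compatible (g : ℝ≥0 → ℝ≥0) (n k : ℕ) (B : Op) (Z : TopologicalSpace.Compacts ℂ) :
    Prop where
  nonempty : (Z : Set ℂ).Nonempty
  norm_le : ∀ z ∈ Z, ‖z‖ ≤ k
  le_lower : ∀ z : ℂ, ‖z‖ ≤ k → (g (Metric.infNndist z Z) : ℝ) ≤
    lowerBd (unitVecs 0 (n + 1)) B z + 1 / ((k : ℝ) + 1)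
  lower_le : ∀ z : ℂ, ‖z‖ ≤ k →
    lowerBd (unitVecs 0 (n + 1)) B z ≤ Metric.infDist z Z + 1 / ((k : ℝ) + 1)

open Classical in
/-- The best `k ≤ n` for which a compatible set exists. -/
noncomputable def bestLevel (g : ℝ≥0 → ℝ≥0) (n : ℕ) (B : Op) : ℕ :=
  Nat.findGreatest (fun k => ∃ Z, Compatible g n k B Z) n

open Classical in
/-- A set which is compatible with `B` at the best possible level. -/
noncomputable def bestSet (g : ℝ≥0 → ℝ≥0) (n : ℕ) (B : Op) : TopologicalSpace.Compacts ℂ :=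
  if h : ∃ Z, Compatible g n (bestLevel g n B) B Z then h.choose else ⊥

theorem Compatible.bestSet {g : ℝ≥0 → ℝ≥0} {n k : ℕ} {B : Op} {Z : TopologicalSpace.Compacts ℂ}
    (h : Compatible g n k B Z) (hk : k ≤ n) :
    k ≤ bestLevel g n B ∧ Compatible g n (bestLevel g n B) B (bestSet g n B) := by
  classical
  have hex : ∃ Z, Compatible g n (bestLevel g n B) B Z :=
    Nat.findGreatest_spec (P := fun k => ∃ Z, Compatible g n k B Z) hk ⟨Z, h⟩
  refine ⟨Nat.le_findGreatest hk ⟨Z, h⟩, ?_⟩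
  rw [SolvIndex.bestSet, dif_pos hex]
  exact hex.choose_spec

/-- The spectrum itself is compatible at every level k ≥ ‖A‖ once n is large, so the best level
tends to infinity. On a compatible set Z the lower bound nearly vanishes, and (*) puts Z near the
spectrum; on the spectrum it nearly vanishes too, and the first inequality for Z puts the spectrum
near Z. -/
theorem tendsto_bestSet {g : ℝ≥0 → ℝ≥0} (hg : Continuous g) (hg_zero : ∀ x, g x = 0 ↔ x = 0)
    (hg_top : Tendsto g atTop atTop) {A : Op} (hA : A ∈ resolventClass g) {B : ℕ → Op}
    (hB : Tendsto (fun n => max ‖(B n - A) * proj (n + 1)‖ ‖proj (n + 1) * (B n - A)‖)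
      atTop (𝓝 0)) :
    Tendsto (fun n => bestSet g n (B n)) atTop (𝓝 (spec A)) := by
  set γ : ℂ → ℝ := lowerBd (unitVecsFrom 0) A with hγ
  have hspec : ∀ z ∈ spectrum ℂ A, ‖z‖ ≤ ‖A‖ := fun z hz => spectrum.norm_le_norm_of_mem hz
  have hclose : ∀ n z, |lowerBd (unitVecs 0 (n + 1)) (B n) z - lowerBd (unitVecs 0 (n + 1)) A z| ≤
      max ‖(B n - A) * proj (n + 1)‖ ‖proj (n + 1) * (B n - A)‖ := fun n z =>
    abs_lowerBd_sub_le n.succ_pos (le_max_left _ _) (le_max_right _ _) z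
  have hlow : ∀ n z, γ z ≤ lowerBd (unitVecs 0 (n + 1)) A z := fun n z =>
    lowerBd_anti (unitVecs_nonempty n.succ_pos) (unitVecs_subset_from _ _) A z
  have hcomp : ∀ k : ℕ, ‖A‖ ≤ k → ∀ᶠ n in atTop, Compatible g n k (B n) (spec A) := by
    intro k hk
    -- Half of the tolerance is for replacing `A` by `B n`, the other half for the restriction to
    -- finitely supported vectors.
    have hpos : (0 : ℝ) < 1 / ((k : ℝ) + 1) / 2 := by positivity
    filter_upwards [hB.eventually_lt_const hpos, eventually_lowerBd_unitVecs_lt A k hpos]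
      with n h1 h2
    refine ⟨spectrum_nonempty A, fun z hz => (hspec z hz).trans hk, fun z hz => ?_, fun z hz => ?_⟩
    · have e1 := le_lowerBd_of_mem_resolventClass hA z
      have e2 := abs_le.mp (hclose n z)
      have e3 := hlow n z
      change (g (Metric.infNndist z (spectrum ℂ A)) : ℝ) ≤ _
      linarith
    · have e1 := lowerBd_from_zero_le_infDist A z
      have e2 := abs_le.mp (hclose n z)
      have e3 := h2 z hz
      change _ ≤ Metric.infDist z (spectrum ℂ A) + _
      linarith
  -- The factor 3 allows for the tolerance of the compatible set, the error of `B n` and the Dini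
  -- error.
  have hmain : ∀ ε > 0, ∃ k : ℕ, ‖A‖ ≤ k ∧ ∀ t : ℝ≥0, (g t : ℝ) < 3 * (1 / ((k : ℝ) + 1)) →
      (t : ℝ) < ε := by
    intro ε hε
    obtain ⟨δ, hδ, hδ'⟩ := exists_pos_forall_lt_of_lt hg hg_zero hg_top (ε := ε.toNNReal)
      (Real.toNNReal_pos.mpr hε)
    have hlim := (tendsto_one_div_add_atTop_nhds_zero_nat (𝕜 := ℝ)).const_mul 3
    rw [mul_zero] at hlim
    obtain ⟨k, hk1, hk2⟩ := ((hlim.eventually_lt_const (NNReal.coe_pos.mpr hδ)).and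
      (tendsto_natCast_atTop_atTop.eventually_ge_atTop ‖A‖)).exists
    refine ⟨k, hk2, fun t ht => ?_⟩
    have := hδ' t (NNReal.coe_lt_coe.mp (ht.trans hk1))
    rwa [← NNReal.coe_lt_coe, Real.coe_toNNReal _ hε.le] at this
  have hbest : ∀ k : ℕ, ‖A‖ ≤ k → ∀ᶠ n in atTop, k ≤ bestLevel g n (B n) ∧
      Compatible g n (bestLevel g n (B n)) (B n) (bestSet g n (B n)) := fun k hk => by
    filter_upwards [hcomp k hk, eventually_ge_atTop k] with n h1 h2
    exact h1.bestSet h2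
  refine tendsto_compacts (fun ε hε => ?_) fun ε hε => ?_
  · obtain ⟨k, hk, hk'⟩ := hmain ε hε
    have hpos : (0 : ℝ) < 1 / ((k : ℝ) + 1) := by positivity
    filter_upwards [hB.eventually_lt_const hpos, hbest k hk] with n h1 h2 z hz
    have hkn : 1 / ((bestLevel g n (B n) : ℝ) + 1) ≤ 1 / ((k : ℝ) + 1) := by
      have : (k : ℝ) ≤ bestLevel g n (B n) := by exact_mod_cast h2.1
      gcongr
    have e0 := h2.2.lower_le z (h2.2.norm_le z hz)
    rw [Metric.infDist_zero_of_mem hz, zero_add] at e0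
    have e1 := le_lowerBd_of_mem_resolventClass hA z
    have e2 := abs_le.mp (hclose n z)
    have e3 := hlow n z
    have e4 := hk' (Metric.infNndist z (spectrum ℂ A)) (by linarith)
    rw [Metric.coe_infNndist] at e4
    exact (Metric.infDist_lt_iff (spectrum_nonempty A)).mp e4
  · obtain ⟨k, hk, hk'⟩ := hmain ε hε
    have hpos : (0 : ℝ) < 1 / ((k : ℝ) + 1) := by positivity
    filter_upwards [hB.eventually_lt_const hpos, hbest k hk,
      eventually_lowerBd_unitVecs_lt A ‖A‖ hpos] with n h1 h2 h3 z hz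
    have hkn' : (k : ℝ) ≤ bestLevel g n (B n) := by exact_mod_cast h2.1
    have hkn : 1 / ((bestLevel g n (B n) : ℝ) + 1) ≤ 1 / ((k : ℝ) + 1) := by gcongr
    have hzA := hspec z hz
    have e0 := h2.2.le_lower z (hzA.trans (hk.trans hkn'))
    have e1 := lowerBd_eq_zero_of_mem_spectrum hz
    have e2 := abs_le.mp (hclose n z)
    have e3 := h3 z hzA
    have e4 := hk' (Metric.infNndist z (bestSet g n (B n))) (by linarith)
    rw [Metric.coe_infNndist] at e4
    exact (Metric.infDist_lt_iff h2.2.nonempty).mp e4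

theorem hasTower_spec {f : ℕ → ℕ} {g : ℝ≥0 → ℝ≥0} (hg : Continuous g)
    (hg_zero : ∀ x, g x = 0 ↔ x = 0) (hg_top : Tendsto g atTop atTop) {Ω : Set Op}
    {Λ : Set (Op → ℂ)} (hΩ : Ω ⊆ resolventClass g ∩ dispersionClass f) (hΛ : entries ⊆ Λ) :
    HasTower (IsArithmeticAlgorithm (restr Ω Λ)) (fun A : Ω => spec A) 1 := by
  let r (n : ℕ) : ℕ := max (f (n + 1)) (n + 1)
  refine hasTower_of_determined (k := 0) (fun l A => match l with
    | [] => spec A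
    | n :: _ => bestSet g n (rep (r n) A)) hΛ (fun _ _ => rfl) ?_ ?_
  · rintro (_ | ⟨n, l⟩) hl A hA
    · exact tendsto_bestSet hg hg_zero hg_top (hΩ hA).1
        ((tendsto_rep_of_mem_dispersionClass (hΩ hA).2).comp (tendsto_add_atTop_nat 1))
    · simp at hl
  · rintro (_ | ⟨n, l⟩) hl
    · simp at hl
    · refine ⟨_, determined_of_rep r n fun A B hAB => ?_⟩
      simp only [hAB n le_rfl]

/-! ### Normal operators -/

/-- The resolvent is normal, so its norm is its spectral radius. Each of its spectral values is ±
the inverse of some z - s with s in the spectrum, hence of modulus at most 1/dist. -/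
theorem mem_resolventClass_of_isStarNormal {A : Op} (hA : IsStarNormal A) {g : ℝ≥0 → ℝ≥0}
    (hg : ∀ x, g x ≤ x) : A ∈ resolventClass g := by
  intro z
  refine (NNReal.coe_le_coe.mpr (hg _)).trans ?_
  by_cases hz : z ∈ spectrum ℂ A
  · rw [Metric.coe_infNndist, Metric.infDist_zero_of_mem hz]
    positivity
  obtain ⟨u, hu⟩ : IsUnit (algebraMap ℂ Op z - A) := spectrum.notMem_iff.mp hz
  have hres : resolvent A z = (↑u⁻¹ : Op) := by rw [resolvent, ← hu, Ring.inverse_unit]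
  have hnormal : IsStarNormal (u : Op) := by
    rw [hu, Algebra.algebraMap_eq_smul_one]
    have := hA.star_comm_self
    refine ⟨?_⟩
    rw [star_sub, star_smul, star_one]
    exact ((((Commute.one_left _).smul_left _).sub_right ((Commute.one_left _).smul_left _)).sub_left
      (((Commute.one_right _).smul_right _).sub_right this))
  have hninv : IsStarNormal (↑u⁻¹ : Op) := inferInstance
  set D := Metric.infDist z (spectrum ℂ A) with hD
  have hDpos : 0 < D := by
    refine ((spectrum.isClosed A).notMem_iff_infDist_pos (spectrum_nonempty A)).mp hz
  have hrad : spectralRadius ℂ (↑u⁻¹ : Op) ≤ (Real.toNNReal D⁻¹ : NNReal) := by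
    refine iSup₂_le fun μ hμ => ?_
    have hμ0 : μ ≠ 0 := spectrum.ne_zero_of_mem_of_unit hμ
    have hinv : μ⁻¹ ∈ spectrum ℂ (u : Op) := by
      have := spectrum.inv_mem_iff (r := Units.mk0 μ hμ0) (a := u⁻¹)
      simpa using this.mp hμ
    have hmem : z - μ⁻¹ ∈ spectrum ℂ A := by
      rw [hu, spectrum.mem_iff] at hinv
      rw [spectrum.mem_iff]
      intro h
      apply hinv
      have := h.neg
      rw [map_sub] at this
      convert this using 1
      abel
    have hdist : D ≤ ‖μ‖⁻¹ := by
      have := Metric.infDist_le_dist_of_mem (x := z) hmem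
      rwa [dist_eq_norm, sub_sub_cancel, norm_inv] at this
    rw [ENNReal.coe_le_coe, ← NNReal.coe_le_coe, Real.coe_toNNReal _ (inv_nonneg.mpr hDpos.le),
      coe_nnnorm]
    rwa [le_inv_comm₀ (norm_pos_iff.mpr hμ0) hDpos]
  rw [IsStarNormal.spectralRadius_eq_nnnorm, ENNReal.coe_le_coe, ← NNReal.coe_le_coe,
    Real.coe_toNNReal _ (inv_nonneg.mpr hDpos.le), coe_nnnorm] at hrad
  rw [hres, Metric.coe_infNndist]
  exact (le_inv_comm₀ hDpos (norm_pos_iff.mpr u⁻¹.ne_zero)).mpr hrad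

end SolvIndex

/-! ### Topological obstructions to towers of low height -/

namespace SolvIndex

/-! ### Lower bounds for the height of towers -/

section LowerBounds

variable {Ω : Type} {X : Type*} [TopologicalSpace X]

/-- If all evaluations are locally constant along a family of inputs, then so are general
algorithms. -/
theorem IsGeneralAlgorithm.isLocallyConstant {M : Type} {Λ : Set (Ω → ℂ)} {Γ : Ω → M} {ι : X → Ω}
    (hΛ : ∀ φ ∈ Λ, IsLocallyConstant (φ ∘ ι)) (hΓ : IsGeneralAlgorithm Λ Γ) :
    IsLocallyConstant (Γ ∘ ι) := by
  obtain ⟨L, hL⟩ := hΓ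
  refine (IsLocallyConstant.iff_eventually_eq _).mpr fun x => ?_
  have : ∀ᶠ y in 𝓝 x, ∀ φ ∈ L (ι x), φ (ι y) = φ (ι x) :=
    (eventually_all_finite (hL.finite _)).mpr fun φ hφ =>
      (hΛ φ (hL.subset _ hφ)).eventually_eq x
  filter_upwards [this] with y hy
  exact hL.output_eq _ _ hy

-- The extended distance is used so that an empty set, at distance ∞ from every point, needs no
-- special treatment.
open TopologicalSpace in
theorem tendsto_infEDist_compacts (p : ℂ) {K : ℕ → Compacts ℂ} {L : Compacts ℂ}
    (h : Tendsto K atTop (𝓝 L)) :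
    Tendsto (fun n => Metric.infEDist p (K n)) atTop (𝓝 (Metric.infEDist p L)) := by
  have h1 : Continuous fun K : Compacts ℂ => Metric.infEDist p (K : Set ℂ) :=
    Closeds.continuous_infEDist.comp
      (continuous_const.prodMk Compacts.isometry_toCloseds.continuous)
  exact (h1.tendsto L).comp h

theorem ofReal_le_infEDist {p : ℂ} {K : TopologicalSpace.Compacts ℂ} {δ : ℝ}
    (h : ∀ z ∈ K, δ ≤ dist p z) : ENNReal.ofReal δ ≤ Metric.infEDist p K :=
  Metric.le_infEDist.mpr fun z hz => by
    rw [edist_dist]; exact ENNReal.ofReal_le_ofReal (h z hz)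

variable {Λ : Set (Ω → ℂ)} {Ξ : Ω → TopologicalSpace.Compacts ℂ} {ι : X → Ω}

theorem not_hasTower_zero (hΛ : ∀ φ ∈ Λ, IsLocallyConstant (φ ∘ ι)) {x : X}
    (hx : ∃ᶠ y in 𝓝 x, Ξ (ι y) ≠ Ξ (ι x)) : ¬ HasTower (IsGeneralAlgorithm Λ) Ξ 0 := by
  rintro ⟨Γ, h0, -, hΓ⟩
  have h := (hΓ [] rfl).isLocallyConstant hΛ
  rw [h0] at h
  exact hx ((h.eventually_eq x).mono fun y hy => not_not.mpr hy)

/-- Two dense alternatives cannot be told apart by a single limit. -/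
theorem not_hasTower_one [BaireSpace X] [Nonempty X] (hΛ : ∀ φ ∈ Λ, IsLocallyConstant (φ ∘ ι))
    {P : Set X} (hP : Dense P) (hP' : Dense Pᶜ) {p : ℂ} {δ : ℝ} (hδ : 0 < δ)
    (h1 : ∀ x ∈ P, p ∈ Ξ (ι x)) (h2 : ∀ x ∉ P, ∀ z ∈ Ξ (ι x), δ ≤ dist p z) :
    ¬ HasTower (IsGeneralAlgorithm Λ) Ξ 1 := by
  rintro ⟨Γ, h0, hlim, hΓ⟩
  let d (n : ℕ) (x : X) : ENNReal := Metric.infEDist p (Γ [n] (ι x))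
  have hd : ∀ n, IsLocallyConstant (d n) := fun n =>
    ((hΓ [n] rfl).isLocallyConstant hΛ).comp fun K : TopologicalSpace.Compacts ℂ =>
      Metric.infEDist p (K : Set ℂ)
  have hdlim : ∀ x, Tendsto (fun n => d n x) atTop (𝓝 (Metric.infEDist p (Ξ (ι x)))) := fun x => by
    have := hlim [] (by simp) (ι x)
    rw [h0] at this
    exact tendsto_infEDist_compacts p this
  set e : ENNReal := ENNReal.ofReal (δ / 2) with he
  have he0 : 0 < e := ENNReal.ofReal_pos.mpr (half_pos hδ)
  have heδ : e < ENNReal.ofReal δ := (ENNReal.ofReal_lt_ofReal_iff hδ).mpr (half_lt_self hδ)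
  have hin : ∀ x ∈ P, ∀ᶠ n in atTop, d n x < e := fun x hx => by
    refine (hdlim x).eventually_lt_const ?_
    rwa [Metric.infEDist_zero_of_mem (h1 x hx)]
  have hout : ∀ x ∉ P, ∀ᶠ n in atTop, e < d n x := fun x hx =>
    (hdlim x).eventually_const_lt (heδ.trans_le (ofReal_le_infEDist (h2 x hx)))
  -- These closed sets collect the inputs whose outputs stay near `p`, or away from it, from stage
  -- `N` on. They cover `X`, so one has interior, and this contains a point of the opposite
  -- alternative.
  let F : ℕ ⊕ ℕ → Set X := Sum.elim (fun N => ⋂ n ≥ N, d n ⁻¹' Set.Iio e)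
    fun N => ⋂ n ≥ N, d n ⁻¹' Set.Ioi e
  have hFclosed : ∀ i, IsClosed (F i) := by
    rintro (N | N)
    · exact isClosed_biInter fun n _ => isOpen_compl_iff.mp (hd n (Set.Iio e)ᶜ)
    · exact isClosed_biInter fun n _ => isOpen_compl_iff.mp (hd n (Set.Ioi e)ᶜ)
  have hFcover : ⋃ i, F i = Set.univ := by
    refine Set.eq_univ_of_forall fun x => ?_
    by_cases hx : x ∈ P
    · obtain ⟨N, hN⟩ := eventually_atTop.mp (hin x hx)
      exact Set.mem_iUnion.mpr ⟨.inl N, Set.mem_iInter₂.mpr hN⟩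
    · obtain ⟨N, hN⟩ := eventually_atTop.mp (hout x hx)
      exact Set.mem_iUnion.mpr ⟨.inr N, Set.mem_iInter₂.mpr hN⟩
  obtain ⟨N | N, hN⟩ := nonempty_interior_of_iUnion_of_closed hFclosed hFcover
  · obtain ⟨x, hx, hxP⟩ := hP'.inter_open_nonempty _ isOpen_interior hN
    have hx' : ∀ n ≥ N, d n x < e := Set.mem_iInter₂.mp (interior_subset hx)
    obtain ⟨n, h3, h4⟩ := ((hout x hxP).and (eventually_ge_atTop N)).exists
    exact lt_asymm h3 (hx' n h4)
  · obtain ⟨x, hx, hxP⟩ := hP.inter_open_nonempty _ isOpen_interior hN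
    have hx' : ∀ n ≥ N, d n x ∈ Set.Ioi e := fun n hn =>
      Set.mem_iInter₂.mp (show x ∈ ⋂ n ≥ N, d n ⁻¹' Set.Ioi e from interior_subset hx) n hn
    obtain ⟨n, h3, h4⟩ := ((hin x hxP).and (eventually_ge_atTop N)).exists
    exact lt_asymm h3 (hx' n h4)

/-- A set which can be decided by two limits is a countable union of `Gδ`-sets. -/
theorem exists_eq_iUnion_isGδ_of_hasTower_two (hΛ : ∀ φ ∈ Λ, IsLocallyConstant (φ ∘ ι))
    {P : Set X} {p : ℂ} {δ : ℝ} (hδ : 0 < δ)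
    (h1 : ∀ x ∈ P, p ∈ Ξ (ι x)) (h2 : ∀ x ∉ P, ∀ z ∈ Ξ (ι x), δ ≤ dist p z)
    (h : HasTower (IsGeneralAlgorithm Λ) Ξ 2) :
    ∃ G : ℕ → Set X, (∀ N, IsGδ (G N)) ∧ P = ⋃ N, G N := by
  obtain ⟨Γ, h0, hlim, hΓ⟩ := h
  let d (n m : ℕ) (x : X) : ENNReal := Metric.infEDist p (Γ [n, m] (ι x))
  let D (n : ℕ) (x : X) : ENNReal := Metric.infEDist p (Γ [n] (ι x))
  have hd : ∀ n m, IsLocallyConstant (d n m) := fun n m =>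
    ((hΓ [n, m] rfl).isLocallyConstant hΛ).comp fun K : TopologicalSpace.Compacts ℂ =>
      Metric.infEDist p (K : Set ℂ)
  have hdlim : ∀ n x, Tendsto (fun m => d n m x) atTop (𝓝 (D n x)) := fun n x =>
    tendsto_infEDist_compacts p (hlim [n] (by simp) (ι x))
  have hDlim : ∀ x, Tendsto (fun n => D n x) atTop (𝓝 (Metric.infEDist p (Ξ (ι x)))) := fun x => by
    have := hlim [] (by simp) (ι x)
    rw [h0] at this
    exact tendsto_infEDist_compacts p this
  obtain ⟨e, he0, heδ⟩ := exists_between (ENNReal.ofReal_pos.mpr hδ)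
  -- The condition `D n x < e` is weakened to `d n m x < e` for infinitely many m, which defines a
  -- Gδ-set. The weakening only admits D n x ≤ e, and this is still incompatible with a limit above
  -- e.
  refine ⟨fun N => ⋂ n ≥ N, {x | ∃ᶠ m in atTop, d n m x < e}, fun N => ?_, ?_⟩
  · refine IsGδ.biInter (Set.to_countable _) fun n _ => ?_
    have : {x | ∃ᶠ m in atTop, d n m x < e} = ⋂ M, ⋃ m ≥ M, d n m ⁻¹' Set.Iio e := by
      ext x
      simp [frequently_atTop]
    rw [this]
    exact IsGδ.iInter fun M => (isOpen_biUnion fun m _ => hd n m _).isGδ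
  · ext x
    simp only [Set.mem_iUnion, Set.mem_iInter]
    constructor
    · intro hx
      have h3 : ∀ᶠ n in atTop, D n x < e := by
        refine (hDlim x).eventually_lt_const ?_
        rwa [Metric.infEDist_zero_of_mem (h1 x hx)]
      obtain ⟨N, hN⟩ := eventually_atTop.mp h3
      exact ⟨N, fun n hn => ((hdlim n x).eventually_lt_const (hN n hn)).frequently⟩
    · rintro ⟨N, hN⟩
      by_contra hx
      have h3 : ∀ᶠ n in atTop, e < D n x :=
        (hDlim x).eventually_const_lt (heδ.trans_le (ofReal_le_infEDist (h2 x hx)))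
      obtain ⟨n, h4, h5⟩ := (h3.and (eventually_ge_atTop N)).exists
      obtain ⟨m, h6, h7⟩ := ((hN n h5).and_eventually ((hdlim n x).eventually_const_lt h4)).exists
      exact lt_asymm h6 h7

end LowerBounds

/-! ### A set which is not a countable union of `Gδ`-sets -/

/-- An enumeration of `ℕ ∪ {∞}`. -/
def enumOnePoint : ℕ → OnePoint ℕ
  | 0 => OnePoint.infty
  | i + 1 => (i : OnePoint ℕ)

theorem exists_enumOnePoint_eq (a : OnePoint ℕ) : ∃ i, enumOnePoint i = a := by
  induction a using OnePoint.rec with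
  | infty => exact ⟨0, rfl⟩
  | coe i => exact ⟨i + 1, rfl⟩

theorem enumOnePoint_eq_infty_iff {i : ℕ} : enumOnePoint i = OnePoint.infty ↔ i = 0 := by
  cases i <;> simp [enumOnePoint]

theorem exists_cylinder_subset {α : Type*} [TopologicalSpace α] [DiscreteTopology α]
    {U : Set (ℕ → α)} (hU : IsOpen U) {s : ℕ → α} (hs : s ∈ U) :
    ∃ k, ∀ y : ℕ → α, (∀ j < k, y j = s j) → y ∈ U := by
  obtain ⟨_, ⟨x, k, rfl⟩, hx, hxU⟩ :=
    (PiNat.isTopologicalBasis_cylinders fun _ => α).exists_subset_of_mem_open hs hU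
  exact ⟨k, fun y hy => hxU fun j hj => (hy j hj).trans (hx j hj)⟩

theorem dense_of_forall_cylinder {α : Type*} [TopologicalSpace α] [DiscreteTopology α]
    {S : Set (ℕ → α)} (h : ∀ (s : ℕ → α) (k : ℕ), ∃ y ∈ S, ∀ j < k, y j = s j) : Dense S := by
  refine dense_iff_inter_open.mpr fun U hU ⟨s, hs⟩ => ?_
  obtain ⟨k, hk⟩ := exists_cylinder_subset hU hs
  obtain ⟨y, hy, hys⟩ := h s k
  exact ⟨y, hk y hys, hy⟩

theorem dense_setOf_infinite {α : Type*} [TopologicalSpace α] [DiscreteTopology α] (a : α) :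
    Dense {y : ℕ → α | {j | y j = a}.Infinite} :=
  dense_of_forall_cylinder fun s k => ⟨fun j => if j < k then s j else a,
    (Set.Ici_infinite k).mono fun j hj => by simp [not_lt.mpr (Set.mem_Ici.mp hj)],
    fun j hj => by simp [hj]⟩

theorem isGδ_setOf_infinite {α : Type*} [TopologicalSpace α] [DiscreteTopology α] (a : α) :
    IsGδ {y : ℕ → α | {j | y j = a}.Infinite} := by
  have heq : {y : ℕ → α | {j | y j = a}.Infinite} = ⋂ N, ⋃ j ∈ Set.Ici N, {y : ℕ → α | y j = a} := by
    ext y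
    rw [Set.mem_ofPred_eq, ← Nat.frequently_atTop_iff_infinite]
    simp [frequently_atTop]
  rw [heq]
  refine IsGδ.iInter fun N => (isOpen_biUnion fun j _ => ?_).isGδ
  have hj : Continuous fun y : ℕ → α => y j := continuous_apply j
  exact (isOpen_discrete ({a} : Set α)).preimage hj

/-- Declaring ∞ isolated gives the Baire space ℕ^ℕ, where the set becomes a dense Gδ. If the Gδ-sets
G N covered it exactly, some G N would be dense in a cylinder of ℕ^ℕ. Back in the coarser topology
of ℕ ∪ {∞}, G N restricted to a fixed prefix is then a dense Gδ-set and meets the dense Gδ-set of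
sequences without ∞ after the prefix. Such a point has ∞ only finitely often, a contradiction. -/
theorem ne_iUnion_of_isGδ {G : ℕ → Set (ℕ → OnePoint ℕ)} (hG : ∀ N, IsGδ (G N)) :
    {x : ℕ → OnePoint ℕ | {j | x j = OnePoint.infty}.Infinite} ≠ ⋃ N, G N := by
  intro hP
  have hc : Continuous enumOnePoint := continuous_of_discreteTopology
  let T (y : ℕ → ℕ) : ℕ → OnePoint ℕ := fun j => enumOnePoint (y j)
  have hT : Continuous T := by fun_prop
  have hcov : {y : ℕ → ℕ | {j | y j = 0}.Infinite} ⊆ ⋃ N, closure (T ⁻¹' G N) := by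
    intro y hy
    have : T y ∈ {x : ℕ → OnePoint ℕ | {j | x j = OnePoint.infty}.Infinite} := by
      simpa [T, enumOnePoint_eq_infty_iff] using hy
    rw [hP] at this
    obtain ⟨N, hN⟩ := Set.mem_iUnion.mp this
    exact Set.mem_iUnion.mpr ⟨N, subset_closure hN⟩
  obtain ⟨s, hs⟩ := ((isGδ_setOf_infinite 0).dense_iUnion_interior_of_closed
    (dense_setOf_infinite 0) (fun _ => isClosed_closure) hcov).nonempty
  obtain ⟨N, hN⟩ := Set.mem_iUnion.mp hs
  obtain ⟨k, hk⟩ : ∃ k, ∀ y : ℕ → ℕ, (∀ j < k, y j = s j) → y ∈ closure (T ⁻¹' G N) := by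
    obtain ⟨k, hk⟩ := exists_cylinder_subset isOpen_interior hN
    exact ⟨k, fun y hy => interior_subset (hk y hy)⟩
  let E (x : ℕ → OnePoint ℕ) : ℕ → OnePoint ℕ := fun j => if j < k then enumOnePoint (s j) else x j
  have hE : Continuous E := by
    refine continuous_pi fun j => ?_
    by_cases h : j < k
    · simpa [E, h] using continuous_const
    · simpa [E, h] using continuous_apply j
  have hHδ : IsGδ (E ⁻¹' G N) := (hG N).preimage hE
  -- Points of the cylinder are compared with points near `x₀` by exchanging the first `k`
  -- coordinates, which are `s` for the former and `x₀` for the latter. `W` makes this exchange and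
  -- is continuous.
  have hHd : Dense (E ⁻¹' G N) := by
    refine dense_iff_inter_open.mpr fun U hU ⟨x₀, hx₀⟩ => ?_
    choose r hr using exists_enumOnePoint_eq
    let W (y : ℕ → ℕ) : ℕ → OnePoint ℕ := fun j => if j < k then x₀ j else enumOnePoint (y j)
    have hW : Continuous W := by
      refine continuous_pi fun j => ?_
      by_cases h : j < k
      · simpa [W, h] using continuous_const
      · simp only [W, h, if_false]
        exact hc.comp (continuous_apply j)
    let y₀ : ℕ → ℕ := fun j => if j < k then s j else r (x₀ j)
    have hy₀ : y₀ ∈ closure (T ⁻¹' G N) := hk y₀ fun j hj => by simp [y₀, hj]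
    have hcyl : IsOpen {y : ℕ → ℕ | ∀ j < k, y j = s j} := PiNat.isOpen_cylinder _ s k
    have hWy₀ : W y₀ = x₀ := by
      ext j
      by_cases h : j < k <;> simp [W, y₀, h, hr]
    obtain ⟨y, ⟨hy1, hy2⟩, hy3⟩ := mem_closure_iff.mp hy₀ (W ⁻¹' U ∩ {y | ∀ j < k, y j = s j})
      ((hU.preimage hW).inter hcyl) ⟨by rwa [Set.mem_preimage, hWy₀], fun j hj => by simp [y₀, hj]⟩
    refine ⟨W y, hy1, ?_⟩
    have : E (W y) = T y := by
      ext j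
      by_cases h : j < k
      · simp [E, T, h, hy2 j h]
      · simp [E, W, T, h]
    rwa [Set.mem_preimage, this]
  have hQo : ∀ j, IsOpen {x : ℕ → OnePoint ℕ | x j ≠ OnePoint.infty} := fun j =>
    isOpen_compl_singleton.preimage (continuous_apply j)
  have hQd : ∀ j, Dense {x : ℕ → OnePoint ℕ | x j ≠ OnePoint.infty} := fun j => by
    have h1 : Dense ({OnePoint.infty}ᶜ : Set (OnePoint ℕ)) := OnePoint.denseRange_coe.mono
      (by rintro _ ⟨i, rfl⟩; simp)
    exact h1.preimage (isOpenMap_eval j)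
  have hQ := dense_iInter_of_isOpen hQo hQd
  obtain ⟨x, hx1, hx2⟩ := (hHd.inter_of_Gδ hHδ (IsGδ.iInter fun j => (hQo j).isGδ) hQ).nonempty
  have hx3 : E x ∈ {x : ℕ → OnePoint ℕ | {j | x j = OnePoint.infty}.Infinite} := by
    rw [hP]; exact Set.mem_iUnion.mpr ⟨N, hx1⟩
  refine hx3 ((Set.finite_Iio k).subset fun j hj => ?_)
  by_contra hjk
  have hj : E x j = OnePoint.infty := hj
  rw [Set.mem_Iio] at hjk
  simp only [E, hjk, if_false] at hj
  exact Set.mem_iInter.mp hx2 j hj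

end SolvIndex

/-! ### Operators from nonnegative matrices, and their transport along sparse sequences -/

namespace SolvIndex

/-! ### Operators with nonnegative matrices -/

/-- A matrix with nonnegative entries and row and column sums at most one, all of whose rows have
finite support. -/
structure IsSchurKernel (K : ℕ → ℕ → ℝ) : Prop where
  nonneg : ∀ u v, 0 ≤ K u v
  finite_row : ∀ u, {v | K u v ≠ 0}.Finite
  row_sum : ∀ u (s : Finset ℕ), ∑ v ∈ s, K u v ≤ 1
  col_sum : ∀ v (s : Finset ℕ), ∑ u ∈ s, K u v ≤ 1

namespace IsSchurKernel

variable {K : ℕ → ℕ → ℝ}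

/-- The action of the matrix on sequences. -/
noncomputable def act (hK : IsSchurKernel K) (x : ℕ → ℂ) (u : ℕ) : ℂ :=
  ∑ v ∈ (hK.finite_row u).toFinset, (K u v : ℂ) * x v

theorem act_eq_sum (hK : IsSchurKernel K) (x : ℕ → ℂ) (u : ℕ) {t : Finset ℕ}
    (ht : ∀ v ∉ t, (K u v : ℂ) * x v = 0) : hK.act x u = ∑ v ∈ t, (K u v : ℂ) * x v := by
  classical
  have h1 : hK.act x u = ∑ v ∈ (hK.finite_row u).toFinset ∪ t, (K u v : ℂ) * x v := by
    refine Finset.sum_subset Finset.subset_union_left fun v _ hv => ?_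
    have : K u v = 0 := by simpa using hv
    rw [this]; simp
  rw [h1]
  exact (Finset.sum_subset Finset.subset_union_right fun v _ hv => ht v hv).symm

/-- This is the Schur test: Cauchy–Schwarz with the weights K u v, row sums first and column sums
after exchanging the summations. -/
theorem sum_norm_act_le (hK : IsSchurKernel K) (x : ℓ²(ℕ, ℂ)) (s : Finset ℕ) :
    ∑ u ∈ s, ‖hK.act x u‖ ^ (2 : ENNReal).toReal ≤ ‖x‖ ^ (2 : ENNReal).toReal := by
  classical
  set t : Finset ℕ := s.biUnion fun u => (hK.finite_row u).toFinset with ht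
  have h1 : ∀ u ∈ s, ‖hK.act x u‖ ^ 2 ≤ ∑ v ∈ t, K u v * ‖x v‖ ^ 2 := by
    intro u hu
    have e1 : hK.act x u = ∑ v ∈ t, (K u v : ℂ) * x v := by
      refine hK.act_eq_sum x u fun v hv => ?_
      have : K u v = 0 := by
        by_contra hne
        exact hv (Finset.mem_biUnion.mpr ⟨u, hu, by simpa using hne⟩)
      rw [this]; simp
    have e2 : ‖hK.act x u‖ ≤ ∑ v ∈ t, K u v * ‖x v‖ := by
      rw [e1]
      refine norm_sum_le_of_le _ fun v _ => ?_
      rw [norm_mul, Complex.norm_real, Real.norm_of_nonneg (hK.nonneg u v)]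
    have e3 := Finset.sum_sq_le_sum_mul_sum_of_sq_le_mul t (r := fun v => K u v * ‖x v‖)
      (f := fun v => K u v) (g := fun v => K u v * ‖x v‖ ^ 2) (fun v _ => hK.nonneg u v)
      (fun v _ => mul_nonneg (hK.nonneg u v) (sq_nonneg _)) fun v _ => (by ring : _ = _).le
    calc _ ≤ (∑ v ∈ t, K u v * ‖x v‖) ^ 2 := pow_le_pow_left₀ (norm_nonneg _) e2 2
      _ ≤ _ := e3
      _ ≤ 1 * ∑ v ∈ t, K u v * ‖x v‖ ^ 2 := by
        refine mul_le_mul_of_nonneg_right (hK.row_sum u t) (Finset.sum_nonneg fun v _ => ?_)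
        exact mul_nonneg (hK.nonneg u v) (sq_nonneg _)
      _ = _ := one_mul _
  have h2 : ∑ u ∈ s, ∑ v ∈ t, K u v * ‖x v‖ ^ 2 ≤ ∑ v ∈ t, ‖x v‖ ^ 2 := by
    rw [Finset.sum_comm]
    refine Finset.sum_le_sum fun v _ => ?_
    rw [← Finset.sum_mul]
    exact mul_le_of_le_one_left (sq_nonneg _) (hK.col_sum v s)
  have h3 := lp.sum_rpow_le_norm_rpow (p := 2) (by simp) x t
  simp only [ENNReal.toReal_ofNat, Real.rpow_ofNat] at h3 ⊢
  exact ((Finset.sum_le_sum h1).trans h2).trans h3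

/-- The operator with the matrix `K`. -/
noncomputable def op (hK : IsSchurKernel K) : Op :=
  LinearMap.mkContinuous
    { toFun := fun x => ⟨hK.act x, memℓp_gen' (hK.sum_norm_act_le x)⟩
      map_add' := fun x y => by
        ext u
        change hK.act (x + y : ℓ²(ℕ, ℂ)) u = hK.act x u + hK.act y u
        simp [act, mul_add, Finset.sum_add_distrib]
      map_smul' := fun c x => by
        ext u
        change hK.act (c • x : ℓ²(ℕ, ℂ)) u = c * hK.act x u
        simp [act, Finset.mul_sum, mul_left_comm] } 1 fun x => by
    rw [one_mul]
    exact lp.norm_le_of_forall_sum_le (by simp) (norm_nonneg _) (hK.sum_norm_act_le x)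

theorem op_apply_apply (hK : IsSchurKernel K) (x : ℓ²(ℕ, ℂ)) (u : ℕ) :
    hK.op x u = hK.act x u := rfl

theorem norm_op_le (hK : IsSchurKernel K) : ‖hK.op‖ ≤ 1 :=
  LinearMap.mkContinuous_norm_le _ zero_le_one _

theorem entry_op (hK : IsSchurKernel K) (u v : ℕ) : entry hK.op u v = K u v := by
  rw [entry_eq, op_apply_apply, hK.act_eq_sum (t := {v}) _ _ fun w hw => ?_]
  · simp [stdVec_apply]
  · rw [stdVec_apply, if_neg (by simpa using hw), mul_zero]

end IsSchurKernel

/-! ### Operators and their matrices -/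

theorem op_ext {A B : Op} (h : ∀ j, A (stdVec j) = B (stdVec j)) : A = B := by
  ext1 x
  have hA := (A.continuous.tendsto x).comp (tendsto_proj_apply x)
  have hB := (B.continuous.tendsto x).comp (tendsto_proj_apply x)
  refine tendsto_nhds_unique hA (hB.congr fun n => ?_)
  simp only [Function.comp_apply, proj_apply, map_sum, map_smul, h]

theorem op_ext_entry {A B : Op} (h : ∀ i j, entry A i j = entry B i j) : A = B :=
  op_ext fun j => by
    ext i
    rw [← entry_eq, ← entry_eq, h]

theorem entry_star (A : Op) (i j : ℕ) : entry (star A) i j = star (entry A j i) := by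
  rw [entry, ContinuousLinearMap.star_eq_adjoint, ContinuousLinearMap.adjoint_inner_right,
    ← inner_conj_symm]
  rfl

theorem IsSchurKernel.isSelfAdjoint_op {K : ℕ → ℕ → ℝ} (hK : IsSchurKernel K)
    (hsymm : ∀ u v, K u v = K v u) : IsSelfAdjoint hK.op :=
  op_ext_entry fun i j => by
    rw [entry_star, hK.entry_op, hK.entry_op, hsymm]
    exact Complex.conj_ofReal _

/-- Eigenvectors supported arbitrarily far out make every lower bound over [m, ∞) vanish. -/
theorem mem_essSpectrum_of_eigenvectors {A : Op} {z : ℂ}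
    (h : ∀ m, ∃ y : ℓ²(ℕ, ℂ), y ≠ 0 ∧ (∀ i < m, y i = 0) ∧ A y = z • y) : z ∈ essSpectrum A := by
  by_contra hz
  obtain ⟨m, hm⟩ := notMem_essSpectrum_iff.mp hz
  obtain ⟨y, hy0, hym, hAy⟩ := h m
  have h1 := lowerBd_le (mem_unitVecsFrom_smul hy0 hym) (B := A) (z := z)
  have h2 : lowerAt A z (((‖y‖⁻¹ : ℝ) : ℂ) • y) ≤ 0 := by
    refine (min_le_left _ _).trans (le_of_eq ?_)
    rw [map_smul, hAy, smul_comm, sub_self, norm_zero]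
  linarith

/-! ### Spreading out the basis vectors -/

theorem isSchurKernel_spread {p : ℕ → ℕ} (hp : Function.Injective p) :
    IsSchurKernel fun u a => if u = p a then 1 else 0 where
  nonneg u a := by split_ifs <;> simp
  finite_row u := by
    refine (Set.finite_singleton u).preimage hp.injOn |>.subset fun a ha => ?_
    have ha : (if u = p a then (1 : ℝ) else 0) ≠ 0 := ha
    by_contra hne
    exact ha (if_neg fun h => hne h.symm)
  row_sum u s := by
    rw [Finset.sum_boole]
    refine Nat.cast_le_one.mpr (Finset.card_le_one.mpr fun a ha b hb => ?_)
    exact hp ((Finset.mem_filter.mp ha).2.symm.trans (Finset.mem_filter.mp hb).2)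
  col_sum a s := by
    rw [Finset.sum_boole]
    refine Nat.cast_le_one.mpr (Finset.card_le_one.mpr fun u hu v hv => ?_)
    exact (Finset.mem_filter.mp hu).2.trans (Finset.mem_filter.mp hv).2.symm

/-- The isometry which maps the `a`-th basis vector to the `p a`-th one. -/
noncomputable def spread {p : ℕ → ℕ} (hp : Function.Injective p) : Op := (isSchurKernel_spread hp).op

section Spread

variable {p : ℕ → ℕ} (hp : Function.Injective p)

theorem spread_stdVec (a : ℕ) : spread hp (stdVec a) = stdVec (p a) := by
  ext u
  rw [← entry_eq, spread, IsSchurKernel.entry_op, stdVec_apply]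
  split_ifs <;> simp

theorem star_spread_stdVec (u : ℕ) :
    star (spread hp) (stdVec u) = 0 ∨ ∃ a, star (spread hp) (stdVec u) = stdVec a := by
  have h : ∀ a, star (spread hp) (stdVec u) a = if u = p a then 1 else 0 := fun a => by
    rw [← entry_eq, entry_star, spread, IsSchurKernel.entry_op]
    split_ifs <;> simp
  by_cases hu : ∃ a, u = p a
  · obtain ⟨a, rfl⟩ := hu
    refine Or.inr ⟨a, ?_⟩
    ext b
    rw [h, stdVec_apply]
    exact if_congr (by rw [hp.eq_iff, eq_comm]) rfl rfl
  · refine Or.inl ?_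
    ext b
    rw [h, if_neg fun hb => hu ⟨b, hb⟩]
    rfl

theorem star_spread_mul_spread : star (spread hp) * spread hp = 1 := by
  refine op_ext_entry fun i j => ?_
  rw [entry, entry, mul_apply_eq_comp, ContinuousLinearMap.star_eq_adjoint,
    ContinuousLinearMap.adjoint_inner_right, spread_stdVec, spread_stdVec, inner_stdVec_left,
    one_apply_eq_self, inner_stdVec_left, stdVec_apply, stdVec_apply]
  exact if_congr hp.eq_iff rfl rfl

theorem norm_spread_le : ‖spread hp‖ ≤ 1 := IsSchurKernel.norm_op_le _

theorem proj_mul_spread {m k : ℕ} (h : ∀ a, p a < m ↔ a < k) :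
    proj m * spread hp = spread hp * proj k := by
  refine op_ext fun a => ?_
  rw [mul_apply_eq_comp, mul_apply_eq_comp, spread_stdVec, proj_stdVec, proj_stdVec]
  by_cases ha : a < k
  · rw [if_pos ha, if_pos ((h a).mpr ha), spread_stdVec]
  · rw [if_neg ha, if_neg (mt (h a).mp ha), map_zero]

/-- The operator `D` transported to the span of the vectors `e (p a)`. -/
noncomputable def transport (D : Op) : Op := spread hp * D * star (spread hp)

theorem norm_spread_mul_mul_star_spread_le (B : Op) :
    ‖spread hp * B * star (spread hp)‖ ≤ ‖B‖ := by
  have h1 := norm_spread_le hp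
  have h2 : ‖star (spread hp)‖ ≤ 1 := by rw [norm_star (spread hp)]; exact h1
  calc _ ≤ ‖spread hp‖ * ‖B‖ * ‖star (spread hp)‖ :=
        (norm_mul_le _ _).trans (mul_le_mul_of_nonneg_right (norm_mul_le _ _) (norm_nonneg _))
    _ ≤ 1 * ‖B‖ * 1 := by gcongr
    _ = ‖B‖ := by ring

theorem isSelfAdjoint_transport {D : Op} (hD : IsSelfAdjoint D) :
    IsSelfAdjoint (transport hp D) := by
  rw [IsSelfAdjoint, transport, star_mul, star_mul, star_star, hD.star_eq, mul_assoc]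

theorem transport_spread_apply (D : Op) (w : ℓ²(ℕ, ℂ)) :
    transport hp D (spread hp w) = spread hp (D w) := by
  rw [transport, mul_apply_eq_comp, mul_apply_eq_comp, ← mul_apply_eq_comp (star (spread hp)),
    star_spread_mul_spread]
  rfl

theorem exists_forall_lt_iff {p : ℕ → ℕ} (hp : StrictMono p) (m : ℕ) : ∃ k, ∀ a, p a < m ↔ a < k := by
  classical
  have hex : ∃ a, m ≤ p a := ⟨m, hp.le_apply⟩
  refine ⟨Nat.find hex, fun a => ⟨fun h => ?_, fun h => not_le.mp (Nat.find_min hex h)⟩⟩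
  by_contra! hle
  exact absurd ((Nat.find_spec hex).trans (hp.monotone hle)) (not_le.mpr h)

/-- If the off-diagonal corners of a self-adjoint `D` tend to zero, then `D` can be transported so
that the dispersion is bounded by any `f` which is adapted to `p`. -/
theorem transport_mem_dispersionClass (hpm : StrictMono p) {f : ℕ → ℕ} (hf : Tendsto f atTop atTop)
    (hpf : ∀ m i, p (i + 1) < m → p i < f m) {D : Op} (hD : IsSelfAdjoint D)
    (hlim : Tendsto (fun l => ‖(1 - proj l) * D * proj (l + 1)‖) atTop (𝓝 0)) :
    transport hpm.injective D ∈ dispersionClass f := by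
  choose κ hκ using exists_forall_lt_iff hpm
  have hκtop : Tendsto (fun m => κ (f m)) atTop atTop := by
    refine tendsto_atTop.mpr fun b => ?_
    filter_upwards [hf.eventually_gt_atTop (p b)] with m hm
    exact ((hκ _ _).mp hm).le
  -- `κ m` counts the a with p a < m. As `f` is adapted to `p`, passing from m to f m loses at most
  -- one basis vector, so only the corners (1 - P_l) D P_{l+1} matter.
  have hκle : ∀ m, κ m ≤ κ (f m) + 1 := by
    intro m
    by_contra! hlt
    have h1 : p (κ (f m) + 1) < m := (hκ m _).mpr hlt
    exact lt_irrefl _ ((hκ (f m) _).mp (hpf m _ h1))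
  set V := spread hpm.injective with hV
  have hle : ∀ m, ‖(1 - proj (f m)) * transport hpm.injective D * proj m‖ ≤
      ‖(1 - proj (κ (f m))) * D * proj (κ (f m) + 1)‖ := by
    intro m
    have h1 : (1 - proj (f m)) * V = V * (1 - proj (κ (f m))) := by
      rw [sub_mul, proj_mul_spread hpm.injective (hκ (f m)), mul_sub, one_mul, mul_one]
    have h2 : star V * proj m = proj (κ m) * star V := by
      have := congrArg star (proj_mul_spread hpm.injective (hκ m))
      rwa [star_mul, star_mul, (isSelfAdjoint_proj _).star_eq, (isSelfAdjoint_proj _).star_eq]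
        at this
    have h3 : (1 - proj (f m)) * transport hpm.injective D * proj m
        = V * ((1 - proj (κ (f m))) * D * proj (κ m)) * star V := by
      calc _ = ((1 - proj (f m)) * V) * D * (star V * proj m) := by
            rw [transport]; noncomm_ring
        _ = _ := by rw [h1, h2]; noncomm_ring
    rw [h3]
    refine (norm_spread_mul_mul_star_spread_le _ _).trans ?_
    rw [← proj_mul_of_le (hκle m), ← mul_assoc]
    exact (norm_mul_le _ _).trans (mul_le_of_le_one_right (norm_nonneg _) (norm_proj_le _))
  refine squeeze_zero (fun m => le_max_of_le_left (norm_nonneg _)) (fun m => max_le (hle m) ?_)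
    (hlim.comp hκtop)
  rw [← norm_star, star_mul, star_mul, star_sub, star_one, (isSelfAdjoint_proj _).star_eq,
    (isSelfAdjoint_proj _).star_eq, (isSelfAdjoint_transport _ hD).star_eq, ← mul_assoc]
  exact hle m

/-- Choose p (i + 1) so large that f exceeds p i from there on. This works however slowly f tends to
infinity. -/
theorem exists_strictMono_adapted {f : ℕ → ℕ} (hf : Tendsto f atTop atTop) :
    ∃ p : ℕ → ℕ, StrictMono p ∧ ∀ m i, p (i + 1) < m → p i < f m := by
  have h : ∀ b, ∃ c, b < c ∧ ∀ m, c < m → b < f m := fun b => by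
    obtain ⟨N, hN⟩ := eventually_atTop.mp (hf.eventually_gt_atTop b)
    exact ⟨max N (b + 1), by omega, fun m hm => hN m (by omega)⟩
  choose c hc hc' using h
  refine ⟨fun i => c^[i] 0, strictMono_nat_of_lt_succ fun i => ?_, fun m i hm => ?_⟩
  · rw [Function.iterate_succ_apply']
    exact hc _
  · have hm : c^[i + 1] 0 < m := hm
    rw [Function.iterate_succ_apply'] at hm
    exact hc' _ m hm

end Spread

end SolvIndex

namespace SolvIndex

/-! ### Dyadic averages -/

/-- Split off s = 0: the square of S/2 + b₀ is S²/4 + S b₀ + b₀² ≤ S²/4 + 3b₀, because S ≤ 2 and b₀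
≤ 1. This is the recursion satisfied by the right-hand side. -/
theorem sq_sum_geometric_le (n : ℕ) : ∀ b : ℕ → ℝ, (∀ s, 0 ≤ b s) → (∀ s, b s ≤ 1) →
    (∑ s ∈ Finset.range n, ((2 : ℝ) ^ s)⁻¹ * b s) ≤ 2 ∧
      (∑ s ∈ Finset.range n, ((2 : ℝ) ^ s)⁻¹ * b s) ^ 2 ≤
        3 * ∑ s ∈ Finset.range n, ((4 : ℝ) ^ s)⁻¹ * b s := by
  induction n with
  | zero => intro b _ _; simp
  | succ n ih =>
    intro b h0 h1
    obtain ⟨i1, i2⟩ := ih (fun s => b (s + 1)) (fun s => h0 _) fun s => h1 _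
    have hn : 0 ≤ ∑ s ∈ Finset.range n, ((2 : ℝ) ^ s)⁻¹ * b (s + 1) :=
      Finset.sum_nonneg fun s _ => mul_nonneg (by positivity) (h0 _)
    have e : ∀ q : ℝ, ∑ s ∈ Finset.range (n + 1), (q ^ s)⁻¹ * b s =
        q⁻¹ * (∑ s ∈ Finset.range n, (q ^ s)⁻¹ * b (s + 1)) + b 0 := by
      intro q
      rw [Finset.sum_range_succ', Finset.mul_sum]
      congr 1
      · refine Finset.sum_congr rfl fun s _ => ?_
        rw [pow_succ, mul_inv]; ring
      · simp
    rw [e, e]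
    have h00 := h0 0
    have h10 := h1 0
    constructor
    · linarith
    · nlinarith

theorem div_two_pow_eq_iff {u s c : ℕ} : u / 2 ^ s = c ↔ u ∈ Finset.Ico (c * 2 ^ s) ((c + 1) * 2 ^ s) := by
  have : 0 < 2 ^ s := by positivity
  rw [Finset.mem_Ico, Nat.div_eq_iff this, add_mul, one_mul]
  omega

theorem card_Ico_two_pow (c s : ℕ) : (Finset.Ico (c * 2 ^ s) ((c + 1) * 2 ^ s)).card = 2 ^ s := by
  rw [Nat.card_Ico, add_mul]; omega

theorem sum_div_two_pow_le (t : Finset ℕ) (s c : ℕ) :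
    ∑ v ∈ t, (if v / 2 ^ s = c then (1 : ℝ) else 0) ≤ 2 ^ s := by
  rw [Finset.sum_boole]
  have h : (t.filter fun v => v / 2 ^ s = c) ⊆ Finset.Ico (c * 2 ^ s) ((c + 1) * 2 ^ s) :=
    fun v hv => div_two_pow_eq_iff.mp (Finset.mem_filter.mp hv).2
  have := Finset.card_le_card h
  rw [card_Ico_two_pow] at this
  exact_mod_cast this

/-- A dyadic interval shorter than the block of `u` does not leave this block, so the operator is
block diagonal. -/
theorem log_eq_of_div_two_pow_eq {u v s : ℕ} (hs : s < Nat.log 2 u) (h : u / 2 ^ s = v / 2 ^ s) :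
    Nat.log 2 v = Nat.log 2 u := by
  have h1 : Nat.log 2 u - s = Nat.log 2 v - s := by
    rw [← Nat.log_div_base_pow, ← Nat.log_div_base_pow, h]
  omega

open Classical in
/-- On the dyadic block of length `2 ^ n` the mean of the averages over the dyadic intervals of the
lengths `1, 2, …, 2 ^ (n - 1)`, if `x n` holds, and zero otherwise. -/
noncomputable def dyadicKernel (x : ℕ → Bool) (u v : ℕ) : ℝ :=
  if x (Nat.log 2 u) = true then
    (Nat.log 2 u : ℝ)⁻¹ * ∑ s ∈ Finset.range (Nat.log 2 u),
      ((2 : ℝ) ^ s)⁻¹ * if v / 2 ^ s = u / 2 ^ s then 1 else 0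
  else 0

variable (x : ℕ → Bool)

theorem dyadicKernel_nonneg (u v : ℕ) : 0 ≤ dyadicKernel x u v := by
  unfold dyadicKernel
  split_ifs
  · refine mul_nonneg (by positivity) (Finset.sum_nonneg fun s _ => mul_nonneg (by positivity) ?_)
    split_ifs <;> simp
  · rfl

variable {x}

theorem dyadicKernel_eq_zero {u v : ℕ}
    (h : x (Nat.log 2 u) = true → ∀ s < Nat.log 2 u, v / 2 ^ s ≠ u / 2 ^ s) :
    dyadicKernel x u v = 0 := by
  unfold dyadicKernel
  split_ifs with hx
  · rw [Finset.sum_eq_zero, mul_zero]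
    intro s hs
    rw [if_neg (h hx s (Finset.mem_range.mp hs)), mul_zero]
  · rfl

theorem dyadicKernel_eq_zero_of_log_ne {u v : ℕ} (h : Nat.log 2 v ≠ Nat.log 2 u) :
    dyadicKernel x u v = 0 :=
  dyadicKernel_eq_zero fun _ _ hs he => h (log_eq_of_div_two_pow_eq hs he.symm)

variable (x)

theorem dyadicKernel_symm (u v : ℕ) : dyadicKernel x u v = dyadicKernel x v u := by
  by_cases h : Nat.log 2 v = Nat.log 2 u
  · simp only [dyadicKernel, h, eq_comm]
  · rw [dyadicKernel_eq_zero_of_log_ne h, dyadicKernel_eq_zero_of_log_ne (Ne.symm h)]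

theorem sum_dyadicKernel_le (u : ℕ) (t : Finset ℕ) : ∑ v ∈ t, dyadicKernel x u v ≤ 1 := by
  unfold dyadicKernel
  split_ifs
  · rw [← Finset.mul_sum, Finset.sum_comm]
    have h : ∑ s ∈ Finset.range (Nat.log 2 u), ∑ v ∈ t,
        ((2 : ℝ) ^ s)⁻¹ * (if v / 2 ^ s = u / 2 ^ s then 1 else 0) ≤ (Nat.log 2 u : ℝ) := by
      refine (Finset.sum_le_sum fun s _ => ?_).trans_eq (b := ∑ s ∈ Finset.range (Nat.log 2 u), 1)
        (by simp)
      rw [← Finset.mul_sum]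
      refine (mul_le_mul_of_nonneg_left (sum_div_two_pow_le t s _) (by positivity)).trans_eq ?_
      exact inv_mul_cancel₀ (by positivity)
    refine (mul_le_mul_of_nonneg_left h (by positivity)).trans ?_
    exact inv_mul_le_one
  · simp

theorem isSchurKernel_dyadicKernel : IsSchurKernel (dyadicKernel x) where
  nonneg := dyadicKernel_nonneg x
  finite_row u := by
    refine (Set.finite_lt_nat (2 ^ (Nat.log 2 u + 1))).subset fun v hv => ?_
    have : Nat.log 2 v = Nat.log 2 u := by
      by_contra hne
      exact hv (dyadicKernel_eq_zero_of_log_ne hne)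
    exact this ▸ Nat.lt_pow_succ_log_self one_lt_two v
  row_sum := sum_dyadicKernel_le x
  col_sum v t := by
    simp_rw [dyadicKernel_symm x _ v]
    exact sum_dyadicKernel_le x v t

/-- The operator with the matrix `dyadicKernel x`. -/
noncomputable def dyadicOp : Op := (isSchurKernel_dyadicKernel x).op

theorem isSelfAdjoint_dyadicOp : IsSelfAdjoint (dyadicOp x) :=
  IsSchurKernel.isSelfAdjoint_op _ (dyadicKernel_symm x)

theorem entry_dyadicOp (u v : ℕ) : entry (dyadicOp x) u v = dyadicKernel x u v :=
  IsSchurKernel.entry_op _ u v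

/-- As v ≤ l ≤ u, a dyadic interval that contains u and v also contains l. So one interval per scale
contributes, and the indicator function factorises. -/
theorem dyadicKernel_sq_le {l u v : ℕ} (hu : l ≤ u) (hv : v ≤ l) :
    dyadicKernel x u v ^ 2 ≤ ((Nat.log 2 l : ℝ)⁻¹) ^ 2 * (3 * ∑ s ∈ Finset.range (Nat.log 2 l),
      ((4 : ℝ) ^ s)⁻¹ * ((if u / 2 ^ s = l / 2 ^ s then 1 else 0) *
        if v / 2 ^ s = l / 2 ^ s then 1 else 0)) := by
  have hR : 0 ≤ ((Nat.log 2 l : ℝ)⁻¹) ^ 2 * (3 * ∑ s ∈ Finset.range (Nat.log 2 l),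
      ((4 : ℝ) ^ s)⁻¹ * ((if u / 2 ^ s = l / 2 ^ s then 1 else 0) *
        if v / 2 ^ s = l / 2 ^ s then 1 else 0)) := by
    refine mul_nonneg (by positivity) (mul_nonneg (by norm_num) (Finset.sum_nonneg fun s _ => ?_))
    refine mul_nonneg (by positivity) ?_
    split_ifs <;> simp
  by_cases hlog : Nat.log 2 v = Nat.log 2 u
  swap
  · rw [dyadicKernel_eq_zero_of_log_ne hlog]
    simpa using hR
  have hl : Nat.log 2 u = Nat.log 2 l :=
    le_antisymm (hlog ▸ Nat.log_mono_right hv) (Nat.log_mono_right hu)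
  unfold dyadicKernel
  split_ifs
  swap
  · simpa using hR
  rw [mul_pow, hl]
  refine mul_le_mul_of_nonneg_left ?_ (by positivity)
  refine (sq_sum_geometric_le _ (fun s => if v / 2 ^ s = u / 2 ^ s then 1 else 0)
    (fun s => by split_ifs <;> simp) fun s => by split_ifs <;> simp).2.trans ?_
  refine mul_le_mul_of_nonneg_left (Finset.sum_le_sum fun s _ => ?_) (by norm_num)
  refine mul_le_mul_of_nonneg_left ?_ (by positivity)
  by_cases h : v / 2 ^ s = u / 2 ^ s
  · have h1 : v / 2 ^ s ≤ l / 2 ^ s := Nat.div_le_div_right hv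
    have h2 : l / 2 ^ s ≤ u / 2 ^ s := Nat.div_le_div_right hu
    rw [if_pos h, if_pos (by omega), if_pos (by omega), one_mul]
  · rw [if_neg h]
    split_ifs <;> simp

/-- The interval of scale s through l has at most 2^s · 2^s pairs, which cancels 4^(-s). There are n
scales and a prefactor n⁻², so the squared Hilbert–Schmidt norm of the corner is O(1/n). Averaging
over many scales is what makes it tend to zero. -/
theorem sum_dyadicKernel_sq_le (l : ℕ) (t : Finset ℕ) (ht : ∀ u ∈ t, l ≤ u) :
    ∑ u ∈ t, ∑ v ∈ Finset.range (l + 1), dyadicKernel x u v ^ 2 ≤ 3 * (Nat.log 2 l : ℝ)⁻¹ := by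
  set n := Nat.log 2 l with hn
  calc _ ≤ ∑ u ∈ t, ∑ v ∈ Finset.range (l + 1), ((n : ℝ)⁻¹) ^ 2 * (3 * ∑ s ∈ Finset.range n,
      ((4 : ℝ) ^ s)⁻¹ * ((if u / 2 ^ s = l / 2 ^ s then 1 else 0) *
        if v / 2 ^ s = l / 2 ^ s then 1 else 0)) :=
        Finset.sum_le_sum fun u hu => Finset.sum_le_sum fun v hv =>
          dyadicKernel_sq_le x (ht u hu) (Nat.lt_succ_iff.mp (Finset.mem_range.mp hv))
    _ = ((n : ℝ)⁻¹) ^ 2 * (3 * ∑ s ∈ Finset.range n, ((4 : ℝ) ^ s)⁻¹ *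
        ((∑ u ∈ t, if u / 2 ^ s = l / 2 ^ s then 1 else 0) *
          ∑ v ∈ Finset.range (l + 1), if v / 2 ^ s = l / 2 ^ s then 1 else 0)) := by
        simp_rw [← Finset.mul_sum (a := ((n : ℝ)⁻¹) ^ 2), ← Finset.mul_sum (a := (3 : ℝ))]
        congr 2
        rw [Finset.sum_congr rfl fun u _ => Finset.sum_comm, Finset.sum_comm]
        refine Finset.sum_congr rfl fun s _ => ?_
        rw [Finset.sum_mul_sum, Finset.mul_sum]
        exact Finset.sum_congr rfl fun u _ => (Finset.mul_sum _ _ _).symm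
    _ ≤ ((n : ℝ)⁻¹) ^ 2 * (3 * ∑ s ∈ Finset.range n, 1) := by
        refine mul_le_mul_of_nonneg_left ?_ (by positivity)
        refine mul_le_mul_of_nonneg_left (Finset.sum_le_sum fun s _ => ?_) (by norm_num)
        have h4 : ((4 : ℝ) ^ s)⁻¹ * (2 ^ s * 2 ^ s) = 1 := by
          rw [← mul_pow, show (2 : ℝ) * 2 = 4 by norm_num]
          exact inv_mul_cancel₀ (by positivity)
        refine (mul_le_mul_of_nonneg_left ?_ (by positivity)).trans_eq h4
        refine mul_le_mul (sum_div_two_pow_le _ _ _) (sum_div_two_pow_le _ _ _)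
          (Finset.sum_nonneg fun v _ => ?_) (by positivity)
        split_ifs <;> simp
    _ = 3 * (n : ℝ)⁻¹ := by
        rcases eq_or_ne n 0 with h | h
        · simp [h]
        · have : (n : ℝ) ≠ 0 := by exact_mod_cast h
          simp
          field_simp

theorem norm_corner_dyadicOp_le (l : ℕ) :
    ‖(1 - proj l) * dyadicOp x * proj (l + 1)‖ ≤ √(3 * (Nat.log 2 l : ℝ)⁻¹) := by
  refine ContinuousLinearMap.opNorm_le_bound _ (Real.sqrt_nonneg _) fun y => ?_
  refine lp.norm_le_of_forall_sum_le (by simp) (by positivity) fun t => ?_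
  simp only [ENNReal.toReal_ofNat, Real.rpow_ofNat]
  rw [mul_pow, Real.sq_sqrt (by positivity)]
  have hval : ∀ u, ‖((1 - proj l) * dyadicOp x * proj (l + 1)) y u‖ ^ 2 ≤
      if l ≤ u then (∑ v ∈ Finset.range (l + 1), dyadicKernel x u v ^ 2) * ‖y‖ ^ 2 else 0 := by
    intro u
    rw [mul_apply_eq_comp, mul_apply_eq_comp, one_sub_proj_apply_apply]
    split_ifs with h1 h2 h2
    · omega
    · simp
    · rw [dyadicOp, IsSchurKernel.op_apply_apply,
        IsSchurKernel.act_eq_sum _ _ _ (t := Finset.range (l + 1))]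
      · have e1 : ‖∑ v ∈ Finset.range (l + 1), (dyadicKernel x u v : ℂ) * proj (l + 1) y v‖ ≤
            ∑ v ∈ Finset.range (l + 1), dyadicKernel x u v * ‖y v‖ := by
          refine norm_sum_le_of_le _ fun v hv => ?_
          rw [norm_mul, Complex.norm_real, Real.norm_of_nonneg (dyadicKernel_nonneg x u v),
            proj_apply_apply, if_pos (Finset.mem_range.mp hv)]
        have e2 := lp.sum_rpow_le_norm_rpow (p := 2) (by simp) y (Finset.range (l + 1))
        simp only [ENNReal.toReal_ofNat, Real.rpow_ofNat] at e2
        calc _ ≤ (∑ v ∈ Finset.range (l + 1), dyadicKernel x u v * ‖y v‖) ^ 2 :=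
              pow_le_pow_left₀ (norm_nonneg _) e1 2
          _ ≤ _ := Finset.sum_mul_sq_le_sq_mul_sq _ _ _
          _ ≤ _ := mul_le_mul_of_nonneg_left e2 (Finset.sum_nonneg fun v _ => sq_nonneg _)
      · intro v hv
        rw [proj_apply_apply, if_neg (by simpa using hv), mul_zero]
    · omega
  refine (Finset.sum_le_sum fun u _ => hval u).trans ?_
  rw [← Finset.sum_filter, ← Finset.sum_mul]
  refine mul_le_mul_of_nonneg_right ?_ (by positivity)
  exact sum_dyadicKernel_sq_le x l _ fun u hu => (Finset.mem_filter.mp hu).2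

theorem tendsto_norm_corner_dyadicOp :
    Tendsto (fun l => ‖(1 - proj l) * dyadicOp x * proj (l + 1)‖) atTop (𝓝 0) := by
  refine squeeze_zero (fun l => norm_nonneg _) (norm_corner_dyadicOp_le x) ?_
  have hlog : Tendsto (Nat.log 2) atTop atTop :=
    tendsto_atTop.mpr fun b => (eventually_ge_atTop (2 ^ b)).mono fun l hl =>
      Nat.le_log_of_pow_le one_lt_two hl
  have h := ((tendsto_inv_atTop_zero.comp (tendsto_natCast_atTop_atTop (R := ℝ))).comp hlog)
  have h' := (h.const_mul 3).sqrt
  simpa using h'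

/-- The indicator function of the dyadic block of length `2 ^ n`. -/
noncomputable def blockVec (n : ℕ) : ℓ²(ℕ, ℂ) := ∑ v ∈ Finset.Ico (2 ^ n) (2 ^ (n + 1)), stdVec v

theorem blockVec_apply (n u : ℕ) :
    blockVec n u = if u ∈ Finset.Ico (2 ^ n) (2 ^ (n + 1)) then 1 else 0 := by
  simp only [blockVec, lp.coeFn_sum, Finset.sum_apply, stdVec_apply, Finset.sum_ite_eq]

theorem blockVec_ne_zero (n : ℕ) : blockVec n ≠ 0 := fun h => by
  have h1 := blockVec_apply n (2 ^ n)
  rw [h, if_pos (Finset.mem_Ico.mpr ⟨le_rfl, by rw [pow_succ]; linarith [pow_pos two_pos (M₀ := ℕ) n]⟩)]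
    at h1
  exact zero_ne_one h1

theorem mem_block_iff {n u : ℕ} (hn : n ≠ 0) :
    u ∈ Finset.Ico (2 ^ n) (2 ^ (n + 1)) ↔ Nat.log 2 u = n := by
  rw [Finset.mem_Ico, Nat.log_eq_iff (Or.inl hn)]

/-- Each dyadic average fixes the constant vector of the block, and so does their mean. For n = 0
there is no scale to average over. -/
theorem dyadicOp_blockVec {n : ℕ} (hn : n ≠ 0) (hx : x n = true) :
    dyadicOp x (blockVec n) = blockVec n := by
  ext u
  rw [dyadicOp, IsSchurKernel.op_apply_apply, IsSchurKernel.act_eq_sum _ _ _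
    (t := Finset.Ico (2 ^ n) (2 ^ (n + 1))) fun v hv => by rw [blockVec_apply, if_neg hv, mul_zero],
    blockVec_apply]
  have h0 : ∑ v ∈ Finset.Ico (2 ^ n) (2 ^ (n + 1)), (dyadicKernel x u v : ℂ) * blockVec n v =
      ((∑ v ∈ Finset.Ico (2 ^ n) (2 ^ (n + 1)), dyadicKernel x u v : ℝ) : ℂ) := by
    push_cast
    exact Finset.sum_congr rfl fun v hv => by rw [blockVec_apply, if_pos hv, mul_one]
  rw [h0]
  split_ifs with hu
  · have hlog := (mem_block_iff hn).mp hu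
    have h1 : ∑ v ∈ Finset.Ico (2 ^ n) (2 ^ (n + 1)), dyadicKernel x u v = 1 := by
      simp only [dyadicKernel, hlog, hx, if_true]
      rw [← Finset.mul_sum, Finset.sum_comm]
      have h2 : ∀ s ∈ Finset.range n, ∑ v ∈ Finset.Ico (2 ^ n) (2 ^ (n + 1)),
          ((2 : ℝ) ^ s)⁻¹ * (if v / 2 ^ s = u / 2 ^ s then 1 else 0) = 1 := by
        intro s hs
        rw [← Finset.mul_sum, Finset.sum_boole]
        have h3 : (Finset.Ico (2 ^ n) (2 ^ (n + 1))).filter (fun v => v / 2 ^ s = u / 2 ^ s) =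
            Finset.Ico (u / 2 ^ s * 2 ^ s) ((u / 2 ^ s + 1) * 2 ^ s) := by
          ext v
          rw [Finset.mem_filter, ← div_two_pow_eq_iff, and_iff_right_iff_imp]
          intro hv
          rw [mem_block_iff hn, ← hlog]
          exact log_eq_of_div_two_pow_eq (hlog.symm ▸ Finset.mem_range.mp hs) hv.symm
        rw [h3, card_Ico_two_pow]
        push_cast
        exact inv_mul_cancel₀ (by positivity)
      rw [Finset.sum_congr rfl h2]
      simp [hn]
    rw [h1, Complex.ofReal_one]
  · rw [Finset.sum_eq_zero, Complex.ofReal_zero]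
    intro v hv
    refine dyadicKernel_eq_zero_of_log_ne fun h => hu ?_
    rw [mem_block_iff hn] at hv ⊢
    exact h ▸ hv

theorem dyadicOp_mul_proj {N : ℕ} (hx : ∀ n, N ≤ n → x n = false) :
    dyadicOp x * proj (2 ^ N) = dyadicOp x := by
  refine op_ext fun v => ?_
  rw [mul_apply_eq_comp, proj_stdVec]
  split_ifs with hv
  · rfl
  · rw [map_zero]
    ext u
    rw [← entry_eq, entry_dyadicOp, dyadicKernel_eq_zero]
    · simp
    · intro hxu s hs he
      have h1 := log_eq_of_div_two_pow_eq hs he.symm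
      rw [← h1, hx _ (Nat.le_log_of_pow_le one_lt_two (not_lt.mp hv))] at hxu
      exact Bool.false_ne_true hxu

/-- An entry in row `u` depends only on the coordinate of `x` that switches the block of `u`. -/
theorem isLocallyConstant_entry_dyadicOp (u v : ℕ) :
    IsLocallyConstant fun x : ℕ → Bool => entry (dyadicOp x) u v := by
  let F (b : Bool) : ℂ := entry (dyadicOp fun _ => b) u v
  have h : (fun x : ℕ → Bool => entry (dyadicOp x) u v) = F ∘ fun x => x (Nat.log 2 u) := by
    funext x
    simp only [F, Function.comp_apply, entry_dyadicOp, dyadicKernel]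
  rw [h]
  exact (IsLocallyConstant.of_discrete F).comp_continuous (continuous_apply _)

end SolvIndex

namespace SolvIndex

/-! ### Lower bounds for operators with bounded dispersion -/

theorem notMem_essSpectrum_of_hasNoetherianRange {A : Op} (hA : A.toLinearMap.HasNoetherianRange)
    {z : ℂ} (hz : z ≠ 0) : z ∉ essSpectrum A := by
  have h1 : (-z⁻¹ • (1 : Op)) * (A - z • (1 : Op)) - 1 = (-z⁻¹ • (1 : Op)) * A := by
    simp [smul_sub, smul_smul, hz]
  have h2 : (A - z • (1 : Op)) * (-z⁻¹ • (1 : Op)) - 1 = (-z⁻¹ • (1 : Op)) * A := by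
    simp [smul_sub, smul_smul, hz]
  have h3 := hA.comp_left (-z⁻¹ • (1 : Op)).toLinearMap
  exact not_not.mpr (isFredholm_of_mul_sub_one (v := -z⁻¹ • (1 : Op)) (h1 ▸ h3) (h2 ▸ h3))

theorem essSpectrum_subset_spectrum (A : Op) : essSpectrum A ⊆ spectrum ℂ A := by
  intro z hz
  by_contra hu
  rw [spectrum.mem_iff, not_not, Algebra.algebraMap_eq_smul_one] at hu
  have hu := hu.neg
  rw [neg_sub] at hu
  obtain ⟨a, ha⟩ := hu
  refine hz (ha ▸ isFredholm_of_mul_sub_one (v := ↑a⁻¹) ?_ ?_)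
  · rw [Units.inv_mul, sub_self]
    exact LinearMap.HasNoetherianRange.zero
  · rw [Units.mul_inv, sub_self]
    exact LinearMap.HasNoetherianRange.zero

/-- The adjoint of `spread` maps basis vectors to basis vectors or zero, so an entry of the
transported operator is zero or an entry of `D x`. -/
theorem isLocallyConstant_entry_transport {X : Type*} [TopologicalSpace X] {D : X → Op}
    (hD : ∀ i j, IsLocallyConstant fun x => entry (D x) i j) {p : ℕ → ℕ}
    (hp : Function.Injective p) (i j : ℕ) :
    IsLocallyConstant fun x => entry (transport hp (D x)) i j := by
  have h : ∀ x, entry (transport hp (D x)) i j =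
      inner ℂ (star (spread hp) (stdVec i)) (D x (star (spread hp) (stdVec j))) := fun x => by
    rw [entry, transport, mul_apply_eq_comp, mul_apply_eq_comp, ContinuousLinearMap.star_eq_adjoint,
      ContinuousLinearMap.adjoint_inner_left]
  simp_rw [h]
  rcases star_spread_stdVec hp i with hi | ⟨a, hi⟩
  · simp only [hi, inner_zero_left]
    exact IsLocallyConstant.const 0
  · rcases star_spread_stdVec hp j with hj | ⟨b, hj⟩
    · simp only [hj, map_zero, inner_zero_right]
      exact IsLocallyConstant.const 0
    · simp only [hi, hj]
      exact hD a b

theorem isLocallyConstant_smul {X : Type*} [TopologicalSpace X] {D : X → Op} (c : ℂ)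
    (hD : ∀ i j, IsLocallyConstant fun x => entry (D x) i j) (i j : ℕ) :
    IsLocallyConstant fun x => entry (c • D x) i j := by
  have h : (fun x => entry (c • D x) i j) = (c * ·) ∘ fun x => entry (D x) i j := by
    funext x
    simp [entry]
  rw [h]
  exact (hD i j).comp _

/-- A family of self-adjoint operators, parametrized by the binary sequences, whose entries are
locally constant, and which have finite rank for the sequences with finitely many terms `true` and
`M` in the essential spectrum for all others. -/
theorem exists_selfAdjoint_family {f : ℕ → ℕ} (hf : Tendsto f atTop atTop) {M : ℝ} (hM : 0 < M) :
    ∃ A : (ℕ → Bool) → Op,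
      (∀ x, A x ∈ selfAdjointClass ∩ dispersionClass f ∩ normClass M) ∧
      (∀ i j, IsLocallyConstant fun x => entry (A x) i j) ∧
      (∀ x, {n | x n = true}.Infinite → (M : ℂ) ∈ essSpectrum (A x)) ∧
      (∀ x, ¬ {n | x n = true}.Infinite → ∀ z ∈ essSpectrum (A x), z = 0) ∧
      A (fun _ => false) = 0 := by
  obtain ⟨p, hpm, hpf⟩ := exists_strictMono_adapted hf
  have hsa : ∀ x, IsSelfAdjoint ((M : ℂ) • dyadicOp x) := fun x =>
    IsSelfAdjoint.smul (Complex.conj_ofReal M) (isSelfAdjoint_dyadicOp x)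
  have hnorm : ‖(M : ℂ)‖ = M := by rw [Complex.norm_real, Real.norm_of_nonneg hM.le]
  refine ⟨fun x => transport hpm.injective ((M : ℂ) • dyadicOp x),
    fun x => ⟨⟨isSelfAdjoint_transport _ (hsa x), ?_⟩, ?_⟩,
    isLocallyConstant_entry_transport
      (isLocallyConstant_smul _ isLocallyConstant_entry_dyadicOp) _, fun x hx => ?_,
    fun x hx z hz => ?_, ?_⟩
  · refine transport_mem_dispersionClass hpm hf hpf (hsa x) ?_
    have := (tendsto_norm_corner_dyadicOp x).const_mul M
    rw [mul_zero] at this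
    refine this.congr fun l => ?_
    rw [mul_smul_comm, smul_mul_assoc, norm_smul, hnorm]
  · refine (norm_spread_mul_mul_star_spread_le _ _).trans ?_
    rw [norm_smul, hnorm]
    exact mul_le_of_le_one_right hM.le (IsSchurKernel.norm_op_le _)
  · refine mem_essSpectrum_of_eigenvectors fun m => ?_
    obtain ⟨n, hn, hmn⟩ := hx.exists_gt m
    have hn : x n = true := hn
    refine ⟨spread hpm.injective (blockVec n), fun h => blockVec_ne_zero n ?_, fun i hi => ?_, ?_⟩
    · have h1 := congrArg (fun B : Op => B (blockVec n)) (star_spread_mul_spread hpm.injective)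
      simp only [mul_apply_eq_comp, h, map_zero, one_apply_eq_self] at h1
      exact h1.symm
    · rw [blockVec, map_sum, lp.coeFn_sum, Finset.sum_apply]
      refine Finset.sum_eq_zero fun v hv => ?_
      rw [spread_stdVec, stdVec_apply, if_neg]
      have h1 : n < 2 ^ n := Nat.lt_two_pow_self
      have h2 := (Finset.mem_Ico.mp hv).1
      have h3 : v ≤ p v := hpm.le_apply
      omega
    · rw [transport_spread_apply, smul_apply,
        dyadicOp_blockVec x (by omega) hn, map_smul]
  · by_contra hz0
    refine notMem_essSpectrum_of_hasNoetherianRange ?_ hz0 hz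
    obtain ⟨N, hN⟩ := (Set.not_infinite.mp hx).bddAbove
    have hN' : ∀ n, N + 1 ≤ n → x n = false := fun n hn => by
      by_contra hne
      have : n ≤ N := hN (by simpa using hne)
      omega
    have h1 : transport hpm.injective ((M : ℂ) • dyadicOp x) =
        spread hpm.injective * ((M : ℂ) • dyadicOp x) * (proj (2 ^ (N + 1)) *
          star (spread hpm.injective)) := by
      rw [transport]
      nth_rewrite 1 [← dyadicOp_mul_proj x hN']
      rw [← smul_mul_assoc]
      noncomm_ring
    change (transport hpm.injective ((M : ℂ) • dyadicOp x)).toLinearMap.HasNoetherianRange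
    rw [h1]
    exact ((hasNoetherianRange_proj _).comp_right (star (spread hpm.injective)).toLinearMap).comp_left
      (spread hpm.injective * ((M : ℂ) • dyadicOp x)).toLinearMap
  · have h0 : dyadicOp (fun _ => false) = 0 := by
      rw [← dyadicOp_mul_proj (fun _ => false) (N := 0) (fun _ _ => rfl)]
      refine op_ext_entry fun i j => ?_
      rw [dyadicOp_mul_proj _ fun _ _ => rfl, entry_dyadicOp]
      simp [dyadicKernel, entry]
    simp [h0, transport]

theorem isLocallyConstant_of_mem_restr {X : Type*} [TopologicalSpace X] {Ω : Set Op}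
    {Λ : Set (Op → ℂ)} (hΛ : ∀ φ ∈ Λ, φ ∈ entries ∨ ∃ c, φ = fun _ => c) {ι : X → Ω}
    (hι : ∀ i j, IsLocallyConstant fun x => entry (ι x) i j) :
    ∀ φ ∈ restr Ω Λ, IsLocallyConstant (φ ∘ ι) := by
  rintro _ ⟨φ, hφ, rfl⟩
  rcases hΛ φ hφ with ⟨i, j, rfl⟩ | ⟨c, rfl⟩
  · exact hι i j
  · exact IsLocallyConstant.const c

/-- The zero sequence, with spectrum {0}, is a limit of sequences for which M is in the spectrum. -/
theorem not_hasTower_spec_zero {f : ℕ → ℕ} (hf : Tendsto f atTop atTop) {M : ℝ} (hM : 0 < M)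
    {Ω : Set Op} (hΩ : selfAdjointClass ∩ dispersionClass f ∩ normClass M ⊆ Ω) {Λ : Set (Op → ℂ)}
    (hΛ : ∀ φ ∈ Λ, φ ∈ entries ∨ ∃ c, φ = fun _ => c) :
    ¬ HasTower (IsGeneralAlgorithm (restr Ω Λ)) (fun A : Ω => spec A) 0 := by
  obtain ⟨A, hA, hloc, h1, -, h0⟩ := exists_selfAdjoint_family hf hM
  refine not_hasTower_zero (ι := fun x => ⟨A x, hΩ (hA x)⟩) (x := fun _ => false)
    (isLocallyConstant_of_mem_restr hΛ hloc) ?_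
  refine (mem_closure_iff_frequently.mp ((dense_setOf_infinite true) fun _ => false)).mono
    fun y hy heq => ?_
  have h2 : (M : ℂ) ∈ spec (A y) := essSpectrum_subset_spectrum _ (h1 y hy)
  have heq : spec (A y) = spec (A fun _ => false) := heq
  rw [heq, h0] at h2
  have h3 : (M : ℂ) ∈ spectrum ℂ (0 : Op) := h2
  rw [spectrum.zero_eq, Set.mem_singleton_iff, Complex.ofReal_eq_zero] at h3
  exact hM.ne' h3

/-- Every finite prefix continues both to a sequence with infinitely many blocks switched on and to
one with finitely many, so both alternatives are dense. -/
theorem not_hasTower_essSpec_one {f : ℕ → ℕ} (hf : Tendsto f atTop atTop) {M : ℝ} (hM : 0 < M)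
    {Ω : Set Op} (hΩ : selfAdjointClass ∩ dispersionClass f ∩ normClass M ⊆ Ω) {Λ : Set (Op → ℂ)}
    (hΛ : ∀ φ ∈ Λ, φ ∈ entries ∨ ∃ c, φ = fun _ => c) :
    ¬ HasTower (IsGeneralAlgorithm (restr Ω Λ)) (fun A : Ω => essSpec A) 1 := by
  obtain ⟨A, hA, hloc, h1, h2, -⟩ := exists_selfAdjoint_family hf hM
  refine not_hasTower_one (ι := fun x => ⟨A x, hΩ (hA x)⟩) (p := M) (δ := M)
    (isLocallyConstant_of_mem_restr hΛ hloc) (dense_setOf_infinite true) ?_ hM h1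
    fun x hx z hz => ?_
  · refine dense_of_forall_cylinder fun s k => ⟨fun j => if j < k then s j else false, ?_,
      fun j hj => by simp [hj]⟩
    refine not_not.mpr ((Set.finite_lt_nat k).subset fun j hj => ?_)
    by_contra hjk
    have hjk : ¬ j < k := hjk
    simp [hjk] at hj
  · rw [h2 x hx z hz, dist_zero_right, Complex.norm_real, Real.norm_of_nonneg hM.le]

end SolvIndex

namespace SolvIndex

/-! ### Lower bounds for general operators -/

/-- Natural numbers are isolated points, so only a neighbourhood of ∞ has to be examined. -/
theorem isLocallyConstant_onePoint {α : Type*} {F : OnePoint ℕ → α}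
    (h : ∀ᶠ k : ℕ in atTop, F k = F OnePoint.infty) : IsLocallyConstant F := by
  refine (IsLocallyConstant.iff_eventually_eq F).mpr fun t => ?_
  induction t using OnePoint.rec with
  | infty =>
    rw [OnePoint.nhds_infty_eq, eventually_sup, eventually_map, eventually_pure,
      coclosedCompact_eq_cocompact, cocompact_eq_cofinite, Nat.cofinite_eq_atTop]
    exact ⟨h, rfl⟩
  | coe k =>
    rw [OnePoint.nhds_coe_eq, nhds_discrete, eventually_map, eventually_pure]

/-- The involution of `ℕ` which exchanges `0` and `k + 1`, and the identity for `k = ∞`. -/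
def exchange (t : OnePoint ℕ) (i : ℕ) : ℕ := t.elim i fun k => Equiv.swap 0 (k + 1) i

theorem exchange_exchange (t : OnePoint ℕ) (i : ℕ) : exchange t (exchange t i) = i := by
  induction t using OnePoint.rec with
  | infty => rfl
  | coe k => exact Equiv.swap_apply_self _ _ _

/-- The involution of `ℕ` which acts on the `j`-th column as `exchange (x j)`. -/
def partner (x : ℕ → OnePoint ℕ) (u : ℕ) : ℕ :=
  Nat.pair u.unpair.1 (exchange (x u.unpair.1) u.unpair.2)

theorem partner_partner (x : ℕ → OnePoint ℕ) (u : ℕ) : partner x (partner x u) = u := by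
  simp [partner, exchange_exchange]

/-- The bases of the columns on which `partner x` is the identity. -/
def isolated (x : ℕ → OnePoint ℕ) : Set ℕ := {u | x u.unpair.1 = OnePoint.infty ∧ u.unpair.2 = 0}

theorem partner_eq_of_mem {x : ℕ → OnePoint ℕ} {u : ℕ} (hu : u ∈ isolated x) : partner x u = u := by
  rw [partner, hu.1]
  exact Nat.pair_unpair u

theorem partner_notMem {x : ℕ → OnePoint ℕ} {u : ℕ} (hu : u ∉ isolated x) :
    partner x u ∉ isolated x := fun h => by
  have := partner_eq_of_mem h
  rw [partner_partner] at this
  exact hu (this ▸ h)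

theorem infinite_isolated_iff {x : ℕ → OnePoint ℕ} :
    (isolated x).Infinite ↔ {j | x j = OnePoint.infty}.Infinite := by
  have h : isolated x = (fun j => Nat.pair j 0) '' {j | x j = OnePoint.infty} := by
    ext u
    constructor
    · rintro ⟨h1, h2⟩
      exact ⟨u.unpair.1, h1, by simp only; rw [← h2, Nat.pair_unpair]⟩
    · rintro ⟨j, hj, rfl⟩
      simpa [isolated] using hj
  rw [h]
  exact Set.infinite_image_iff fun a _ b _ hab => (Nat.pair_eq_pair.mp hab).1

open Classical in
/-- The matrix of the permutation `partner x`, without the isolated points. -/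
noncomputable def partnerKernel (x : ℕ → OnePoint ℕ) (u v : ℕ) : ℝ :=
  if v = partner x u ∧ u ∉ isolated x then 1 else 0

variable (x : ℕ → OnePoint ℕ)

theorem partnerKernel_symm (u v : ℕ) : partnerKernel x u v = partnerKernel x v u := by
  have h : ∀ u v, v = partner x u ∧ u ∉ isolated x → u = partner x v ∧ v ∉ isolated x := by
    rintro u _ ⟨rfl, hu⟩
    exact ⟨(partner_partner x u).symm, partner_notMem hu⟩
  classical
  simp only [partnerKernel]
  exact if_congr ⟨h u v, h v u⟩ rfl rfl

theorem sum_partnerKernel_le (u : ℕ) (t : Finset ℕ) : ∑ v ∈ t, partnerKernel x u v ≤ 1 := by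
  classical
  simp only [partnerKernel]
  rw [Finset.sum_boole]
  refine Nat.cast_le_one.mpr (Finset.card_le_one.mpr fun a ha b hb => ?_)
  exact (Finset.mem_filter.mp ha).2.1.trans (Finset.mem_filter.mp hb).2.1.symm

theorem isSchurKernel_partnerKernel : IsSchurKernel (partnerKernel x) where
  nonneg u v := by unfold partnerKernel; split_ifs <;> simp
  finite_row u := (Set.finite_singleton (partner x u)).subset fun v hv => by
    by_contra hne
    exact hv (if_neg fun h => hne h.1)
  row_sum := sum_partnerKernel_le x
  col_sum v t := by
    simp_rw [partnerKernel_symm x _ v]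
    exact sum_partnerKernel_le x v t

/-- The operator with the matrix `partnerKernel x`. -/
noncomputable def partnerOp : Op := (isSchurKernel_partnerKernel x).op

variable {x}

theorem partnerOp_stdVec_of_mem {v : ℕ} (hv : v ∈ isolated x) : partnerOp x (stdVec v) = 0 := by
  ext u
  rw [← entry_eq, partnerOp, IsSchurKernel.entry_op, partnerKernel_symm, partnerKernel,
    if_neg fun h => h.2 hv]
  simp

theorem partnerOp_stdVec_of_notMem {v : ℕ} (hv : v ∉ isolated x) :
    partnerOp x (stdVec v) = stdVec (partner x v) := by
  ext u
  rw [← entry_eq, partnerOp, IsSchurKernel.entry_op, partnerKernel_symm, partnerKernel, stdVec_apply]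
  by_cases h : u = partner x v <;> simp [h, hv]

-- When x j tends to ∞, the base of the j-th column is exchanged with a point that moves out of the
-- range of any given entry. In the limit this base becomes isolated and its row zero.
variable (x) in
theorem isLocallyConstant_entry_partnerOp (u v : ℕ) :
    IsLocallyConstant fun x : ℕ → OnePoint ℕ => entry (partnerOp x) u v := by
  let F (t : OnePoint ℕ) : ℂ := entry (partnerOp fun _ => t) u v
  have h : (fun x : ℕ → OnePoint ℕ => entry (partnerOp x) u v) = F ∘ fun x => x u.unpair.1 := by
    funext x
    simp only [F, Function.comp_apply, partnerOp, IsSchurKernel.entry_op, partnerKernel, partner,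
      isolated, Set.mem_ofPred_eq]
    congr
  have hF : IsLocallyConstant F := by
    refine isLocallyConstant_onePoint ?_
    filter_upwards [eventually_ge_atTop (max u v)] with k hk
    have hku : u.unpair.2 ≤ k := (Nat.unpair_right_le u).trans ((le_max_left _ _).trans hk)
    simp only [F, partnerOp, IsSchurKernel.entry_op, partnerKernel, partner, isolated,
      Set.mem_ofPred_eq, exchange, OnePoint.elim_some, OnePoint.elim_infty, OnePoint.coe_ne_infty,
      false_and, not_false_eq_true, and_true, true_and]
    by_cases hi : u.unpair.2 = 0
    · have hne : v ≠ Nat.pair u.unpair.1 (k + 1) := fun h => by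
        have := Nat.right_le_pair u.unpair.1 (k + 1)
        have := (le_max_right u v).trans hk
        omega
      simp [hi, hne]
    · rw [Equiv.swap_apply_of_ne_of_ne hi (by omega)]
      simp [hi]
  rw [h]
  exact hF.comp_continuous (continuous_apply _)

theorem one_sub_partnerOp_sq_mul_proj {m : ℕ} (hm : ∀ u ∈ isolated x, u < m) :
    (1 - partnerOp x * partnerOp x) * proj m = 1 - partnerOp x * partnerOp x := by
  refine op_ext fun v => ?_
  rw [mul_apply_eq_comp, proj_stdVec]
  split_ifs with hv
  · rfl
  · have hv' : v ∉ isolated x := fun h => hv (hm v h)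
    rw [map_zero, sub_apply, mul_apply_eq_comp, partnerOp_stdVec_of_notMem hv',
      partnerOp_stdVec_of_notMem (partner_notMem hv'), partner_partner, one_apply_eq_self, sub_self]

theorem zero_mem_essSpectrum_smul_partnerOp (c : ℂ) (hx : {j | x j = OnePoint.infty}.Infinite) :
    (0 : ℂ) ∈ essSpectrum (c • partnerOp x) := by
  refine mem_essSpectrum_of_eigenvectors fun m => ?_
  obtain ⟨u, hu, hmu⟩ := (infinite_isolated_iff.mpr hx).exists_gt m
  refine ⟨stdVec u, fun h => ?_, fun i hi => ?_, ?_⟩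
  · have := norm_stdVec u
    rw [h, norm_zero] at this
    exact zero_ne_one this
  · rw [stdVec_apply, if_neg (by omega)]
  · rw [smul_apply, partnerOp_stdVec_of_mem hu, smul_zero, zero_smul]

/-- With finitely many isolated points, J² is 1 up to finite rank. Then (cJ + z)(cJ - z) is c² - z²
up to finite rank, and c² ≠ z² as ‖z‖ < ‖c‖. -/
theorem notMem_essSpectrum_smul_partnerOp {c z : ℂ} (hz : ‖z‖ < ‖c‖)
    (hx : ¬ {j | x j = OnePoint.infty}.Infinite) : z ∉ essSpectrum (c • partnerOp x) := by
  obtain ⟨m, hm⟩ := (Set.not_infinite.mp (mt infinite_isolated_iff.mp hx)).bddAbove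
  have hproj := one_sub_partnerOp_sq_mul_proj (m := m + 1) fun u hu => Nat.lt_succ_of_le (hm hu)
  have hd : c ^ 2 - z ^ 2 ≠ 0 := fun h => by
    have h1 := congrArg norm (sub_eq_zero.mp h)
    rw [norm_pow, norm_pow] at h1
    exact absurd h1 (pow_lt_pow_left₀ hz (norm_nonneg _) two_ne_zero).ne'
  set J := partnerOp x with hJ
  set d := (c ^ 2 - z ^ 2)⁻¹ with hdd
  have hd1 : d * (c * c) = 1 + d * (z * z) := by
    rw [hdd]; field_simp; ring
  have h3 : (((-(d * (c * c))) • (1 - J * J)) : Op).toLinearMap.HasNoetherianRange := by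
    rw [← hproj, ← smul_mul_assoc]
    exact (hasNoetherianRange_proj _).comp_left ((-(d * (c * c))) • (1 - J * J)).toLinearMap
  have h1 : (d • (c • J + z • (1 : Op))) * (c • J - z • (1 : Op)) - 1 =
      (-(d * (c * c))) • (1 - J * J) := by
    simp only [mul_sub, add_mul, smul_mul_assoc, mul_smul_comm, one_mul, mul_one]
    linear_combination (norm := module) hd1 • (1 : Op)
  have h2 : (c • J - z • (1 : Op)) * (d • (c • J + z • (1 : Op))) - 1 =
      (-(d * (c * c))) • (1 - J * J) := by
    rw [← h1]
    congr 1
    rw [mul_smul_comm, smul_mul_assoc]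
    congr 1
    simp only [mul_add, sub_mul, mul_sub, add_mul, smul_mul_assoc, mul_smul_comm, one_mul, mul_one]
    module
  exact not_not.mpr (isFredholm_of_mul_sub_one (h1 ▸ h3) (h2 ▸ h3))

theorem not_hasTower_essSpec_two {M : ℝ} (hM : 0 < M) {Ω : Set Op} (hΩ : normClass M ⊆ Ω)
    {Λ : Set (Op → ℂ)} (hΛ : ∀ φ ∈ Λ, φ ∈ entries ∨ ∃ c, φ = fun _ => c) :
    ¬ HasTower (IsGeneralAlgorithm (restr Ω Λ)) (fun A : Ω => essSpec A) 2 := by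
  have hnorm : ‖(M : ℂ)‖ = M := by rw [Complex.norm_real, Real.norm_of_nonneg hM.le]
  have hmem : ∀ x, (M : ℂ) • partnerOp x ∈ Ω := fun x => hΩ <| by
    change ‖(M : ℂ) • partnerOp x‖ ≤ M
    rw [norm_smul, hnorm]
    exact mul_le_of_le_one_right hM.le (IsSchurKernel.norm_op_le _)
  intro h
  obtain ⟨G, hG, hP⟩ := exists_eq_iUnion_isGδ_of_hasTower_two
    (ι := fun x : ℕ → OnePoint ℕ => (⟨(M : ℂ) • partnerOp x, hmem x⟩ : Ω))
    (P := {x | {j | x j = OnePoint.infty}.Infinite}) (p := 0)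
    (isLocallyConstant_of_mem_restr hΛ
      (isLocallyConstant_smul _ isLocallyConstant_entry_partnerOp)) hM
    (fun x hx => zero_mem_essSpectrum_smul_partnerOp _ hx)
    (fun x hx z hz => by
      by_contra! hlt
      rw [dist_zero_left] at hlt
      exact notMem_essSpectrum_smul_partnerOp (hnorm.symm ▸ hlt) hx hz) h
  exact ne_iUnion_of_isGδ hG hP

end SolvIndex

namespace SolvIndex

/-! ### The classification -/

theorem mem_entries_or_const {f : ℕ → ℕ} :
    ∀ φ ∈ entries ∪ dispersionConsts f, φ ∈ entries ∨ ∃ c, φ = fun _ => c := by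
  rintro φ (h | ⟨m, rfl⟩)
  · exact Or.inl h
  · exact Or.inr ⟨_, rfl⟩

theorem mem_entries_or_const' {f : ℕ → ℕ} {g : ℝ≥0 → ℝ≥0} :
    ∀ φ ∈ entries ∪ dispersionConsts f ∪ resolventConsts g, φ ∈ entries ∨ ∃ c, φ = fun _ => c := by
  rintro φ (h | ⟨i, j, -, -, rfl⟩)
  · exact mem_entries_or_const φ h
  · exact Or.inr ⟨_, rfl⟩

/-- Towers restrict to smaller classes and obstructions persist in larger ones, so obstructions
within the norm balls settle the restricted and the unrestricted problem together. -/
theorem hasIndex_of_forall {Ξ : Op → TopologicalSpace.Compacts ℂ} {Ω : Set Op} {Λ : Set (Op → ℂ)}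
    {k : ℕ} (h : ∀ Ω' ⊆ Ω, HasTower (IsArithmeticAlgorithm (restr Ω' Λ)) (fun A : Ω' => Ξ A) (k + 1))
    (h' : ∀ M : ℝ, 0 < M → ∀ Ω', Ω ∩ normClass M ⊆ Ω' →
      ¬ HasTower (IsGeneralAlgorithm (restr Ω' Λ)) (fun A : Ω' => Ξ A) k) :
    HasIndex Ξ Ω Λ (k + 1 : ℕ) :=
  ⟨sciG_sciA_eq (h _ subset_rfl) (h' 1 one_pos _ Set.inter_subset_left), fun M hM =>
    sciG_sciA_eq (h _ Set.inter_subset_left) (h' M hM _ subset_rfl)⟩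

theorem hasIndex_spec_one {f : ℕ → ℕ} (hf : Tendsto f atTop atTop) {g : ℝ≥0 → ℝ≥0}
    (hg : Continuous g) (hg_zero : ∀ x, g x = 0 ↔ x = 0) (hg_top : Tendsto g atTop atTop)
    {S : Set Op} (hS : selfAdjointClass ⊆ S) (hSg : S ⊆ resolventClass g) {Λ : Set (Op → ℂ)}
    (hΛ : entries ⊆ Λ) (hΛ' : ∀ φ ∈ Λ, φ ∈ entries ∨ ∃ c, φ = fun _ => c) :
    HasIndex spec (S ∩ dispersionClass f) Λ 1 :=
  hasIndex_of_forall (k := 0)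
    (fun _ hΩ => hasTower_spec hg hg_zero hg_top
      (hΩ.trans (Set.inter_subset_inter_left _ hSg)) hΛ)
    fun _ hM _ hΩ => not_hasTower_spec_zero hf hM (subset_trans (Set.inter_subset_inter_left _
      (Set.inter_subset_inter_left _ hS)) hΩ) hΛ'

theorem hasIndex_essSpec_two {f : ℕ → ℕ} (hf : Tendsto f atTop atTop) {S : Set Op}
    (hS : selfAdjointClass ⊆ S) {Λ : Set (Op → ℂ)} (hΛ : entries ⊆ Λ)
    (hΛ' : ∀ φ ∈ Λ, φ ∈ entries ∨ ∃ c, φ = fun _ => c) :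
    HasIndex essSpec (S ∩ dispersionClass f) Λ 2 :=
  hasIndex_of_forall (k := 1)
    (fun _ hΩ => hasTower_essSpec_dispersion (hΩ.trans Set.inter_subset_right) hΛ)
    fun _ hM _ hΩ => not_hasTower_essSpec_one hf hM (subset_trans (Set.inter_subset_inter_left _
      (Set.inter_subset_inter_left _ hS)) hΩ) hΛ'

theorem hasIndex_essSpec_three : HasIndex essSpec Set.univ entries 3 :=
  hasIndex_of_forall (k := 2) (fun _ _ => hasTower_essSpec subset_rfl)
    fun _ hM _ hΩ => not_hasTower_essSpec_two hM (by rwa [Set.univ_inter] at hΩ)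
      fun _ hφ => Or.inl hφ

end SolvIndex

open SolvIndex
theorem mainTheorem3
    (f : ℕ → ℕ) (hf : Tendsto f atTop atTop)
    (g : ℝ≥0 → ℝ≥0) (hg_cont : Continuous g) (hg_zero : ∀ x, g x = 0 ↔ x = 0)
    (hg_top : Tendsto g atTop atTop) (hg_le : ∀ x, g x ≤ x) :
    -- operators with controlled resolvent and known dispersion bound
    (HasIndex spec (resolventClass g ∩ dispersionClass f)
        (entries ∪ dispersionConsts f ∪ resolventConsts g) 1 ∧
      HasIndex essSpec (resolventClass g ∩ dispersionClass f)
        (entries ∪ dispersionConsts f ∪ resolventConsts g) 2) ∧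
    -- normal operators with known dispersion bound
    (HasIndex spec (normalClass ∩ dispersionClass f) (entries ∪ dispersionConsts f) 1 ∧
      HasIndex essSpec (normalClass ∩ dispersionClass f) (entries ∪ dispersionConsts f) 2) ∧
    -- self-adjoint operators with known dispersion bound
    (HasIndex spec (selfAdjointClass ∩ dispersionClass f) (entries ∪ dispersionConsts f) 1 ∧
      HasIndex essSpec (selfAdjointClass ∩ dispersionClass f)
        (entries ∪ dispersionConsts f) 2) ∧
    -- all bounded operators
    HasIndex essSpec Set.univ entries 3 := by
  have hsn : selfAdjointClass ⊆ normalClass := fun A hA => IsSelfAdjoint.isStarNormal hA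
  have hnr : normalClass ⊆ resolventClass g := fun A hA =>
    mem_resolventClass_of_isStarNormal hA hg_le
  have h1 : entries ⊆ entries ∪ dispersionConsts f := Set.subset_union_left
  have h2 : entries ⊆ entries ∪ dispersionConsts f ∪ resolventConsts g :=
    h1.trans Set.subset_union_left
  exact ⟨⟨hasIndex_spec_one hf hg_cont hg_zero hg_top (hsn.trans hnr) subset_rfl h2
        mem_entries_or_const',
      hasIndex_essSpec_two hf (hsn.trans hnr) h2 mem_entries_or_const'⟩,
    ⟨hasIndex_spec_one hf hg_cont hg_zero hg_top hsn hnr h1 mem_entries_or_const,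
      hasIndex_essSpec_two hf hsn h1 mem_entries_or_const⟩,
    ⟨hasIndex_spec_one hf hg_cont hg_zero hg_top subset_rfl (hsn.trans hnr) h1 mem_entries_or_const,
      hasIndex_essSpec_two hf subset_rfl h1 mem_entries_or_const⟩,
    hasIndex_essSpec_three⟩
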